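/- **Setting.** For $\alpha,M>0$ let $k=\lceil\alpha\rceil-1$ be the greatest integer strictly less than $\alpha$, and let $F(\alpha,M)$ be the class of functions $f$ with $k$ derivatives on $[0,1]$ such that $|f^{(k)}(x)-f^{(k)}(y)|\le M|x-y|^{\alpha-k}$ for $0\le x<y\le 1$. One observes $Z_n(t)=\int_0^t f(x)\,dx+n^{-1/2}B(t)$, $0\le t\le1$, with $B$ a standard Brownian motion. The risk of an estimator $\hat f_n$ (a measurable function of the path $Z_n$) at $f$ is $$R(\hat f_n,f;x_0,c_n)=\frac1{2c_n}\,E_f\int_{x_0-c_n}^{x_0+c_n}(\hat f_n(x)-f(x))^2\,dx .$$ Fix $0<x_0<1$, $0<\gamma<1$ and $c_n=n^{-\gamma}$. Let $\phi,\psi$ be compactly supported father and mother wavelets which, with boundary corrections, generate an orthonormal basis $\{\phi_{j_0,k},\,0\le k<2^{j_0};\ \psi_{j,k},\ j\ge j_0,\ 0\le k<2^j\}$ of $L^2[0,1]$: in the interior $\phi_{j,k}(t)=2^{j/2}\phi(2^jt-k)$, $\psi_{j,k}(t)=2^{j/2}\psi(2^jt-k)$, and for a fixed number of indices $k$ next to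 each end point these are replaced by dilates of fixed compactly supported edge functions. Let the basis be $r$-regular, $r$ an integer: the wavelets and the edge functions have $r$ continuous derivatives, and $\psi$ and its edge functions have $r$ vanishing moments. **Estimator.** Put $\tilde y_{j_0,k}=\int_0^1\phi_{j_0,k}\,dZ_n$ and $y_{j,k}=\int_0^1\psi_{j,k}\,dZ_n$. Let $J,J_*,J^*$ be the smallest nonnegative integers with $2^J\ge n$, $2^{J_*}\ge c_n^{-1}$, $2^{J^*}\ge c_n^{-1}\log n$ (with $J_*$ replaced by $j_0$ if $J_*<j_0$). Let $H^*$ be the set of all $(j,k)$ with $J_*\le j<J^*$ such that $\operatorname{supp}\psi_{j,k}$ meets $[x_0-c_n,x_0+c_n]$, let $L_v$ be the number of elements of $H^*$, and $S_v^2=\sum_{(j,k)\in H^*}y_{j,k}^2$. At each level $J^*\le j<J$ divide the indices $k=0,\dots,2^j-1$ into consecutive blocks of length $L=\lceil\log n\rceil$ (the last one possibly shorter), and let $S^2_{(jb)}$ be the sum of the $y_{j,k}^2$ over the $b$-th block. Let $\lambda_*=4.50524\ldots$ be the root larger than $1$ of $\lambda-\log\lambda-1=2$. Set $$\hat\theta_{j,k}=\begin{cases}\operatorname{sgn}(y_{j,k})\bigl(|y_{j,k}|-\sqrt{2n^{-1}\log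 n}\bigr)_+,& j_0\le j<J^*,\ (j,k)\notin H^*,\\ \bigl(1-\lambda_*L_vn^{-1}/S_v^2\bigr)_+\,y_{j,k},&(j,k)\in H^*,\\ \bigl(1-\lambda_*Ln^{-1}/S_{(jb)}^2\bigr)_+\,y_{j,k},& J^*\le j<J,\ k \text{ in the } b\text{-th block},\\ 0,& j\ge J,\ (\text{and } j\ge J^*),\end{cases}$$ and $\hat f_n(x)=\sum_{k}\tilde y_{j_0,k}\phi_{j_0,k}(x)+\sum_{j\ge j_0}\sum_{k}\hat\theta_{j,k}\psi_{j,k}(x)$. This estimator depends on neither $\alpha$ nor $M$. **Corollary 3.** Suppose $r>\frac{1-\gamma}{2\gamma}$. (a) For all $0<\alpha<\frac{1-\gamma}{2\gamma}$ and $M>0$, $$\limsup_{n\to\infty}\,n^{2\alpha/(1+2\alpha)}\sup_{f\in F(\alpha,M)}R(\hat f_n,f;x_0,c_n)<\infty .$$ (b) For all $\frac{1-\gamma}{2\gamma}\le\alpha<r$ and $M>0$, $$\limsup_{n\to\infty}\Bigl(\frac n{\log n}\Bigr)^{2\alpha/(1+2\alpha)}\sup_{f\in F(\alpha,M)}R(\hat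 f_n,f;x_0,c_n)<\infty .$$ (c) So full rate adaptation is possible exactly below $\frac{1-\gamma}{2\gamma}$: by (a) the single estimator $\hat f_n$ attains the rate $n^{-2\alpha/(1+2\alpha)}$ for all $\alpha<\frac{1-\gamma}{2\gamma}$, while for any $\frac{1-\gamma}{2\gamma}\le\alpha_1<\alpha_2$ and $M_1,M_2>0$ no sequence of estimators $\hat g_n$ satisfies $\limsup_{n}n^{2\alpha_i/(1+2\alpha_i)}\sup_{f\in F(\alpha_i,M_i)}R(\hat g_n,f;x_0,c_n)<\infty$ for both $i=1$ and $i=2$. -/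

import Mathlib

open Set MeasureTheory ProbabilityTheory Filter
open scoped ENNReal NNReal

noncomputable section

/-! ### Hölder classes -/

/-- The Hölder class `F(α, M)` on `[0,1]`: with `k = ⌈α⌉ - 1` the greatest integer strictly less
than `α`, the functions with `k` derivatives on `[0,1]` such that
`|f^(k)(x) - f^(k)(y)| ≤ M |x - y|^(α - k)` for `0 ≤ x < y ≤ 1`.
The values of `f` outside `[0,1]` are unconstrained and are never used. -/
def holderClass (α M : ℝ) : Set (ℝ → ℝ) :=
  {f | ContDiffOn ℝ (⌈α⌉₊ - 1 : ℕ) f (Icc 0 1) ∧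
    ∀ x y : ℝ, 0 ≤ x → x < y → y ≤ 1 →
      |iteratedDerivWithin (⌈α⌉₊ - 1) f (Icc 0 1) x
        - iteratedDerivWithin (⌈α⌉₊ - 1) f (Icc 0 1) y|
        ≤ M * |x - y| ^ (α - ((⌈α⌉₊ - 1 : ℕ) : ℝ))}

/-! ### Compactly supported orthonormal wavelets on `[0,1]` with boundary corrections -/

/-- The functions `b i`, restricted to `S`, form an orthonormal basis of `L²(S)`: they are square
integrable and orthonormal on `S`, and only the null function is orthogonal to all of them. -/
structure IsONBOn (S : Set ℝ) {ι : Type} (b : ι → ℝ → ℝ) : Prop where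
  memLp : ∀ i, MemLp (b i) 2 (volume.restrict S)
  norm_one : ∀ i, ∫ x in S, b i x * b i x = 1
  orthogonal : ∀ i i', i ≠ i' → ∫ x in S, b i x * b i' x = 0
  complete : ∀ f : ℝ → ℝ, MemLp f 2 (volume.restrict S) →
    (∀ i, ∫ x in S, f x * b i x = 0) → f =ᵐ[volume.restrict S] 0

/-- The dilated translate `g_{j,k}(t) = 2^{j/2} g(2^j t - k)`. -/
def dilate (g : ℝ → ℝ) (j : ℕ) (k : ℤ) (t : ℝ) : ℝ :=
  √((2 : ℝ) ^ j) * g ((2 : ℝ) ^ j * t - k)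

/-- `φ` and `ψ` are a pair of compactly supported father and mother wavelets on the line: `∫ φ = 1`
and the integer translates of `φ` together with the `ψ_{j,k}`, `j ≥ 0`, `k ∈ ℤ`, form an
orthonormal basis of `L²(ℝ)`. -/
structure IsWaveletPair (φ ψ : ℝ → ℝ) : Prop where
  compact_father : HasCompactSupport φ
  compact_mother : HasCompactSupport ψ
  integral_father : ∫ x, φ x = 1
  basis : IsONBOn univ (Sum.elim (fun k : ℤ => dilate φ 0 k)
    (fun p : ℕ × ℤ => dilate ψ p.1 p.2))

/-- The `2^j` functions of level `j` on `[0,1]`, indexed by `k = 0, …, 2^j - 1`: the dilated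
translates `g_{j,k}` in the interior, replaced by dilates of the edge functions `gL 0, …, gL (m-1)`
for the `m` indices next to the left end point `0`, and by dilates of `gR 0, …, gR (m-1)` (attached
to the point `1`) for the `m` indices next to the right end point. -/
def levelFun (m : ℕ) (g : ℝ → ℝ) (gL gR : ℕ → ℝ → ℝ) (j : ℕ) (k : Fin (2 ^ j)) (t : ℝ) : ℝ :=
  if (k : ℕ) < m then √((2 : ℝ) ^ j) * gL k ((2 : ℝ) ^ j * t)
  else if (k : ℕ) + m < 2 ^ j then dilate g j (k : ℕ) t
  else √((2 : ℝ) ^ j) * gR (2 ^ j - 1 - k) ((2 : ℝ) ^ j * (t - 1))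

/-- A compactly supported `r`-regular orthonormal wavelet basis of `L²[0,1]` with boundary
corrections. A father and a mother wavelet `φ`, `ψ` on the line are given; at each level `j ≥ j0`
the functions whose support would leave `[0,1]` are replaced by dilates of fixed, compactly
supported edge functions (defined on the half lines `[0,∞)` and `(-∞,0]`). Being `r`-regular means:
`r` continuous derivatives, and `r` vanishing moments for the mother wavelet and its edge
functions. -/
structure IntervalWaveletBasis (r : ℕ) where
  /-- the father wavelet -/
  φ : ℝ → ℝ
  /-- the mother wavelet -/
  ψ : ℝ → ℝ
  /-- the coarsest level -/
  j0 : ℕ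
  /-- the number of edge functions at each end -/
  m : ℕ
  /-- the left edge father wavelets -/
  φL : ℕ → ℝ → ℝ
  /-- the right edge father wavelets -/
  φR : ℕ → ℝ → ℝ
  /-- the left edge mother wavelets -/
  ψL : ℕ → ℝ → ℝ
  /-- the right edge mother wavelets -/
  ψR : ℕ → ℝ → ℝ
  pair : IsWaveletPair φ ψ
  two_mul_m_le : 2 * m ≤ 2 ^ j0
  -- supports: the interior functions live inside `[0,1]`, and so do the edge functions
  supp_φ : Function.support φ ⊆ Icc (-(m : ℝ)) (m + 1)
  supp_ψ : Function.support ψ ⊆ Icc (-(m : ℝ)) (m + 1)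
  supp_φL : ∀ i < m, Function.support (φL i) ⊆ Icc 0 ((2 : ℝ) ^ j0)
  supp_φR : ∀ i < m, Function.support (φR i) ⊆ Icc (-(2 : ℝ) ^ j0) 0
  supp_ψL : ∀ i < m, Function.support (ψL i) ⊆ Icc 0 ((2 : ℝ) ^ j0)
  supp_ψR : ∀ i < m, Function.support (ψR i) ⊆ Icc (-(2 : ℝ) ^ j0) 0
  -- `r` continuous derivatives
  smooth_φ : ContDiff ℝ r φ
  smooth_ψ : ContDiff ℝ r ψ
  smooth_φL : ∀ i < m, ContDiffOn ℝ r (φL i) (Ici 0)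
  smooth_φR : ∀ i < m, ContDiffOn ℝ r (φR i) (Iic 0)
  smooth_ψL : ∀ i < m, ContDiffOn ℝ r (ψL i) (Ici 0)
  smooth_ψR : ∀ i < m, ContDiffOn ℝ r (ψR i) (Iic 0)
  -- `r` vanishing moments
  moment_ψ : ∀ p < r, ∫ x, x ^ p * ψ x = 0
  moment_ψL : ∀ i < m, ∀ p < r, ∫ x, x ^ p * ψL i x = 0
  moment_ψR : ∀ i < m, ∀ p < r, ∫ x, x ^ p * ψR i x = 0
  basis : IsONBOn (Icc 0 1)
    (Sum.elim (fun k : Fin (2 ^ j0) => levelFun m φ φL φR j0 k)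
      (fun p : Σ i : ℕ, Fin (2 ^ (j0 + i)) => levelFun m ψ ψL ψR (j0 + p.1) p.2))

namespace IntervalWaveletBasis

variable {r : ℕ} (W : IntervalWaveletBasis r)

/-- The coarse basis functions `φ_{j0,k}`. -/
def father (k : Fin (2 ^ W.j0)) : ℝ → ℝ := levelFun W.m W.φ W.φL W.φR W.j0 k

/-- The detail basis functions `ψ_{j,k}`. -/
def mother (j : ℕ) (k : Fin (2 ^ j)) : ℝ → ℝ := levelFun W.m W.ψ W.ψL W.ψR j k

end IntervalWaveletBasis

/-! ### The white noise model, estimators and their risk -/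

/-- The observed path `Z_n(t) = ∫_0^t f + n^{-1/2} B(t)`, `0 ≤ t ≤ 1`, for the outcome `ω`. -/
def observedPath {Ω : Type*} (B : ℝ≥0 → Ω → ℝ) (f : ℝ → ℝ) (n : ℕ) (ω : Ω)
    (t : unitInterval) : ℝ :=
  (∫ x in (0 : ℝ)..t, f x) + (√(n : ℝ))⁻¹ * B (unitInterval.toNNReal t) ω

/-- The integral `∫_0^1 g dz` of a continuously differentiable `g` on `[0,1]` against a continuous
path `z`: the Riemann–Stieltjes integral, by integration by parts. -/
def pathIntegral (g : ℝ → ℝ) (z : unitInterval → ℝ) : ℝ :=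
  g 1 * z 1 - g 0 * z 0 - ∫ t : unitInterval, derivWithin g (Icc 0 1) t * z t

/-- A rule assigning a function on the line to a path is an estimator if the value at `x` is
jointly measurable in the (continuous) path and in `x`. -/
def IsEstimator (T : (unitInterval → ℝ) → ℝ → ℝ) : Prop :=
  Measurable fun p : {z : unitInterval → ℝ // Continuous z} × ℝ => T p.1.1 p.2

/-- The average mean squared error `R(T, f; x0, c) = (2c)⁻¹ E_f ∫_{x0-c}^{x0+c} (T - f)²` of the
estimator `T` based on the path `Z_n`. -/
def risk {Ω : Type*} [MeasurableSpace Ω] (P : Measure Ω) (B : ℝ≥0 → Ω → ℝ)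
    (T : (unitInterval → ℝ) → ℝ → ℝ) (n : ℕ) (x0 c : ℝ) (f : ℝ → ℝ) : ℝ≥0∞ :=
  ENNReal.ofReal (1 / (2 * c)) *
    ∫⁻ ω, (∫⁻ x in Icc (x0 - c) (x0 + c),
      ENNReal.ofReal ((T (observedPath B f n ω) x - f x) ^ 2) ∂volume) ∂P

/-- The maximum risk over the Hölder class `F(α, M)`. -/
def maxRisk {Ω : Type*} [MeasurableSpace Ω] (P : Measure Ω) (B : ℝ≥0 → Ω → ℝ)
    (T : (unitInterval → ℝ) → ℝ → ℝ) (n : ℕ) (x0 c α M : ℝ) : ℝ≥0∞ :=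
  ⨆ f ∈ holderClass α M, risk P B T n x0 c f

/-! ### The hybrid block thresholding estimator -/

/-- The smallest `j ∈ ℕ` with `2^j ≥ a`. -/
def dyadicLevel (a : ℝ) : ℕ := sInf {j : ℕ | a ≤ (2 : ℝ) ^ j}

/-- The factor `(1 - lam * L * n⁻¹ / S²)_+` of the James–Stein shrinkage rule. -/
def jamesStein (lam : ℝ) (L n : ℕ) (S2 : ℝ) : ℝ := max (1 - lam * L * (n : ℝ)⁻¹ / S2) 0

namespace IntervalWaveletBasis

variable {r : ℕ} (W : IntervalWaveletBasis r)

/-- The empirical coefficient `y_{j,k} = ∫_0^1 ψ_{j,k} dZ_n`. -/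
def detailCoeff (z : unitInterval → ℝ) (j : ℕ) (k : Fin (2 ^ j)) : ℝ :=
  pathIntegral (W.mother j k) z

/-- The empirical coefficient `∫_0^1 φ_{j0,k} dZ_n`. -/
def coarseCoeff (z : unitInterval → ℝ) (k : Fin (2 ^ W.j0)) : ℝ :=
  pathIntegral (W.father k) z

/-- The level `J_*`: smallest with `2^{J_*} ≥ c⁻¹`, but at least `j0`. -/
def lowLevel (c : ℝ) : ℕ := max (dyadicLevel c⁻¹) W.j0

/-- The level `J^*`: smallest with `2^{J^*} ≥ c⁻¹ log n`. -/
def highLevel (c : ℝ) (n : ℕ) : ℕ := dyadicLevel (c⁻¹ * Real.log n)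

open Classical in
/-- The indices `k` of the set `H_j`: the support of `ψ_{j,k}` meets `[x0 - c, x0 + c]`. -/
def nearIndices (x0 c : ℝ) (j : ℕ) : Finset (Fin (2 ^ j)) :=
  {k | (tsupport (W.mother j k) ∩ Icc (x0 - c) (x0 + c)).Nonempty}

/-- The number of coefficients in the vertical block `H^* = ⋃_{J_* ≤ j < J^*} H_j`. -/
def verticalCard (x0 c : ℝ) (n : ℕ) : ℕ :=
  ∑ j ∈ Finset.Ico (W.lowLevel c) (highLevel c n), (W.nearIndices x0 c j).card

/-- The sum of squares `S_v²` over the vertical block. -/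
def verticalSq (x0 c : ℝ) (n : ℕ) (z : unitInterval → ℝ) : ℝ :=
  ∑ j ∈ Finset.Ico (W.lowLevel c) (highLevel c n), ∑ k ∈ W.nearIndices x0 c j,
    W.detailCoeff z j k ^ 2

/-- The length `L = ⌈log n⌉` of the horizontal blocks. -/
def blockLength (n : ℕ) : ℕ := ⌈Real.log n⌉₊

/-- The sum of squares over the horizontal block of `k` at level `j`; the blocks are
`{bL, …, (b+1)L - 1}`, `b = 0, 1, …`, with `L = ⌈log n⌉`. -/
def blockSq (n : ℕ) (z : unitInterval → ℝ) (j : ℕ) (k : Fin (2 ^ j)) : ℝ :=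
  ∑ k' ∈ Finset.univ.filter fun k' : Fin (2 ^ j) =>
      (k' : ℕ) / blockLength n = (k : ℕ) / blockLength n,
    W.detailCoeff z j k' ^ 2

open Classical in
/-- The estimated wavelet coefficients: James–Stein shrinkage of the vertical block `H^*`, soft
thresholding of the other coefficients at levels `j < J^*`, James–Stein shrinkage of horizontal
blocks at levels `J^* ≤ j < J`, and `0` at levels `j ≥ J`, where `J` is smallest with `2^J ≥ n`. -/
def thetaHat (lam x0 c : ℝ) (n : ℕ) (z : unitInterval → ℝ) (j : ℕ) (k : Fin (2 ^ j)) : ℝ :=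
  if W.lowLevel c ≤ j ∧ j < highLevel c n ∧ k ∈ W.nearIndices x0 c j then
    jamesStein lam (W.verticalCard x0 c n) n (W.verticalSq x0 c n z) * W.detailCoeff z j k
  else if j < highLevel c n then
    SignType.sign (W.detailCoeff z j k)
      * max (|W.detailCoeff z j k| - √(2 * (n : ℝ)⁻¹ * Real.log n)) 0
  else if j < dyadicLevel n then
    jamesStein lam (blockLength n) n (W.blockSq n z j k) * W.detailCoeff z j k
  else 0

/-- The wavelet estimator
`∑_k ỹ_{j0,k} φ_{j0,k}(x) + ∑_{j ≥ j0} ∑_k θ̂_{j,k} ψ_{j,k}(x)` (only finitely many levels `j`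
contribute). -/
def estimator (lam x0 c : ℝ) (n : ℕ) (z : unitInterval → ℝ) (x : ℝ) : ℝ :=
  ∑ k, W.coarseCoeff z k * W.father k x +
    ∑' i : ℕ, ∑ k : Fin (2 ^ (W.j0 + i)),
      W.thetaHat lam x0 c n z (W.j0 + i) k * W.mother (W.j0 + i) k x

end IntervalWaveletBasis

end

/-!
# Adaptive wavelet estimation over a shrinking window

**Upper bounds.** By the vanishing moments, the coefficients at level `j` of a function of
`F(α, M)` are `O(2 ^ (-j (α + 1/2)))` (`IntervalWaveletBasis.exists_coeff_sq_le`). Their empirical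
counterparts add Wiener integrals of an orthonormal system, that is, independent standard Gaussians
times `n ^ (-1/2)`; the path integrals are limits of Riemann–Stieltjes sums, so that
`wienerProcess_gaussian` and `iIndepFun_wiener` follow from the covariance of Brownian motion.
Soft thresholding and James–Stein shrinkage each satisfy two risk bounds, one of the order of the
noise level and one of the order of the signal (`upperExp_soft`, `upperExp_block`). In the second
one, the noise above the threshold is negligible because `lam - log lam - 1 = 2` makes Chernoff's
bound for a `χ²` variable with `L` degrees of freedom equal to `exp (-L)`, and `L` is at least
about `log n`; for the vertical block this holds since its top level alone has about `log n`
indices near the window (`IntervalWaveletBasis.exists_le_verticalCard`).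

On the window only wavelets whose support meets it matter. `IntervalWaveletBasis.risk_le` bounds the
levels below `J_*`, where the wavelets are longer than the window and only boundedly many per level
count, in sup norm, and the levels above by orthonormality. Inserting the better of the two risk
bounds at each level and summing geometric series gives, with `c = n ^ (-γ)`, a maximal risk of
order `n ^ (-2α/(1+2α)) + log n / (n c)` as well as
`n ^ (-2α/(1+2α)) + c ^ (2α) + (log n / n) ^ (2α/(1+2α))` (`IntervalWaveletBasis.exists_risk_le`).
The first bound has the order `n ^ (-2α/(1+2α))` when `α < (1-γ)/(2γ)`, and the second one the
order `(log n / n) ^ (2α/(1+2α))` when `α ≥ (1-γ)/(2γ)`.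

**Impossibility.** Let an estimator have risk `O(n ^ (-2α₂/(1+2α₂)))` at the zero signal. Compare
the zero signal with a bump of `F(α₁, M₁)` of width `h`, a small multiple of `log n / n` to
the power `1/(1+2α₁)`, and height of order `h ^ α₁`. Since `α₁ ≥ (1-γ)/(2γ)`, the width exceeds
that of the window, on which the bump is constant. The path splits into its component along the
bump and an independent remainder, so that the likelihood ratio is that of a shifted Gaussian, and
it is at most a small power of `n` outside an event of probability `1/4`
(`exists_paths_measure_le`). The small risk at zero therefore forces the estimate to be near zero
under the bump as well, with probability at least `1/2`, and the risk at the bump is at least of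
order `(log n / n) ^ (2α₁/(1+2α₁))` (`le_risk_of_risk_zero_le`), which is more than
`O(n ^ (-2α₁/(1+2α₁)))`.
-/

/-! ### Level functions of the wavelet basis -/

/-- Each level function is a dilated translate `√2^j h(2^j t - b)` of one of finitely many
profiles `h`: the interior function or an edge function. -/
lemma levelFun_cases (m : ℕ) (g : ℝ → ℝ) (gL gR : ℕ → ℝ → ℝ) (j : ℕ) (k : Fin (2 ^ j)) :
    ∃ h : ℝ → ℝ, ∃ b : ℝ,
      (levelFun m g gL gR j k = fun t => √((2 : ℝ) ^ j) * h ((2 : ℝ) ^ j * t - b)) ∧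
      ((h = g ∧ b = (k : ℕ) ∧ m ≤ k ∧ (k : ℕ) + m < 2 ^ j) ∨
        (∃ i < m, h = gL i ∧ b = 0 ∧ (k : ℕ) < m) ∨
        (∃ i < m, h = gR i ∧ b = (2 : ℝ) ^ j ∧ 2 ^ j ≤ (k : ℕ) + m)) := by
  have hk := k.2
  by_cases h1 : (k : ℕ) < m
  · refine ⟨gL k, 0, ?_, Or.inr (Or.inl ⟨k, h1, rfl, rfl, h1⟩)⟩
    funext t
    simp [levelFun, h1]
  · by_cases h2 : (k : ℕ) + m < 2 ^ j
    · refine ⟨g, (k : ℕ), ?_, Or.inl ⟨rfl, rfl, not_lt.1 h1, h2⟩⟩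
      funext t
      simp [levelFun, h1, h2, dilate]
    · refine ⟨gR (2 ^ j - 1 - k), (2 : ℝ) ^ j, ?_,
        Or.inr (Or.inr ⟨2 ^ j - 1 - k, by omega, rfl, rfl, not_lt.1 h2⟩)⟩
      funext t
      simp only [levelFun, h1, h2, if_false]
      congr 2
      ring

lemma levelFun_support {m j0 : ℕ} {g : ℝ → ℝ} {gL gR : ℕ → ℝ → ℝ}
    (hg : Function.support g ⊆ Icc (-(m : ℝ)) (m + 1))
    (hgL : ∀ i < m, Function.support (gL i) ⊆ Icc 0 ((2 : ℝ) ^ j0))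
    (hgR : ∀ i < m, Function.support (gR i) ⊆ Icc (-(2 : ℝ) ^ j0) 0)
    {j : ℕ} (hj : j0 ≤ j) (k : Fin (2 ^ j)) :
    Function.support (levelFun m g gL gR j k) ⊆
      Icc 0 1 ∩ {t | |(2 : ℝ) ^ j * t - (k : ℕ)| ≤ 2 ^ j0 + m + 1} := by
  intro t ht
  have h2 : (0 : ℝ) < 2 ^ j := by positivity
  have h20 : (0 : ℝ) < 2 ^ j0 := by positivity
  have hjj : (2 : ℝ) ^ j0 ≤ 2 ^ j := pow_le_pow_right₀ (by norm_num) hj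
  have hk : ((k : ℕ) : ℝ) + 1 ≤ 2 ^ j := by exact_mod_cast k.2
  have hk0 : (0 : ℝ) ≤ ((k : ℕ) : ℝ) := by positivity
  have hm0 : (0 : ℝ) ≤ (m : ℝ) := by positivity
  obtain ⟨h, b, he, hc⟩ := levelFun_cases m g gL gR j k
  rw [Function.mem_support, he] at ht
  have hh : h ((2 : ℝ) ^ j * t - b) ≠ 0 := right_ne_zero_of_mul ht
  rcases hc with ⟨rfl, rfl, hm, hkm⟩ | ⟨i, hi, rfl, rfl, hkm⟩ | ⟨i, hi, rfl, rfl, hkm⟩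
  · have := hg hh
    have hm' : (m : ℝ) ≤ (k : ℕ) := by exact_mod_cast hm
    have hkm' : ((k : ℕ) : ℝ) + m + 1 ≤ 2 ^ j := by exact_mod_cast hkm
    refine ⟨⟨?_, ?_⟩, ?_⟩
    · have : 0 ≤ (2 : ℝ) ^ j * t := by linarith [this.1]
      exact nonneg_of_mul_nonneg_right this h2
    · have : (2 : ℝ) ^ j * t ≤ 2 ^ j * 1 := by linarith [this.2]
      exact le_of_mul_le_mul_left this h2
    · rw [mem_ofPred_eq, abs_le]
      constructor <;> linarith [this.1, this.2]
  · have := hgL i hi hh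
    have hkm' : ((k : ℕ) : ℝ) + 1 ≤ m := by exact_mod_cast hkm
    rw [sub_zero] at this
    refine ⟨⟨nonneg_of_mul_nonneg_right this.1 h2, ?_⟩, ?_⟩
    · have : (2 : ℝ) ^ j * t ≤ 2 ^ j * 1 := by linarith [this.2]
      exact le_of_mul_le_mul_left this h2
    · rw [mem_ofPred_eq, abs_le]
      constructor <;> linarith [this.1, this.2]
  · have := hgR i hi hh
    have hkm' : (2 : ℝ) ^ j ≤ ((k : ℕ) : ℝ) + m := by exact_mod_cast hkm
    refine ⟨⟨?_, ?_⟩, ?_⟩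
    · have : 0 ≤ (2 : ℝ) ^ j * t := by linarith [this.1]
      exact nonneg_of_mul_nonneg_right this h2
    · have : (2 : ℝ) ^ j * t ≤ 2 ^ j * 1 := by linarith [this.2]
      exact le_of_mul_le_mul_left this h2
    · rw [mem_ofPred_eq, abs_le]
      constructor <;> linarith [this.1, this.2]

lemma exists_abs_le_of_continuousOn {h : ℝ → ℝ} {a b : ℝ} {s : Set ℝ} (hs : Icc a b ⊆ s)
    (hc : ContinuousOn h s) (hsupp : Function.support h ⊆ Icc a b) :
    ∃ K : ℝ, ∀ x, |h x| ≤ K := by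
  obtain ⟨K, hK⟩ := isCompact_Icc.exists_bound_of_continuousOn (hc.mono hs)
  refine ⟨max K 0, fun x => ?_⟩
  by_cases hx : x ∈ Icc a b
  · exact (hK x hx).trans (le_max_left _ _)
  · have : h x = 0 := by
      by_contra h0
      exact hx (hsupp h0)
    simp [this]

/-- All level functions of level `j` are bounded by one multiple of `√2^j`, since only finitely many
profiles occur. -/
lemma levelFun_bound {m j0 : ℕ} {g : ℝ → ℝ} {gL gR : ℕ → ℝ → ℝ}
    (hg : Function.support g ⊆ Icc (-(m : ℝ)) (m + 1))
    (hgL : ∀ i < m, Function.support (gL i) ⊆ Icc 0 ((2 : ℝ) ^ j0))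
    (hgR : ∀ i < m, Function.support (gR i) ⊆ Icc (-(2 : ℝ) ^ j0) 0)
    (cg : Continuous g) (cgL : ∀ i < m, ContinuousOn (gL i) (Ici 0))
    (cgR : ∀ i < m, ContinuousOn (gR i) (Iic 0)) :
    ∃ K : ℝ, 0 < K ∧ ∀ (j : ℕ) (k : Fin (2 ^ j)) (t : ℝ),
      |levelFun m g gL gR j k t| ≤ K * √((2 : ℝ) ^ j) := by
  obtain ⟨K0, hK0⟩ := exists_abs_le_of_continuousOn (subset_univ _) cg.continuousOn hg
  have hL : ∀ i, ∃ K : ℝ, i < m → ∀ x, |gL i x| ≤ K := fun i => by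
    by_cases hi : i < m
    · obtain ⟨K, hK⟩ := exists_abs_le_of_continuousOn (fun x hx => hx.1) (cgL i hi) (hgL i hi)
      exact ⟨K, fun _ => hK⟩
    · exact ⟨0, fun h => absurd h hi⟩
  have hR : ∀ i, ∃ K : ℝ, i < m → ∀ x, |gR i x| ≤ K := fun i => by
    by_cases hi : i < m
    · obtain ⟨K, hK⟩ := exists_abs_le_of_continuousOn (fun x hx => hx.2) (cgR i hi) (hgR i hi)
      exact ⟨K, fun _ => hK⟩
    · exact ⟨0, fun h => absurd h hi⟩
  choose KL hKL using hL
  choose KR hKR using hR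
  set K : ℝ := 1 + |K0| + ∑ i ∈ Finset.range m, |KL i| + ∑ i ∈ Finset.range m, |KR i| with hK
  have n1 : 0 ≤ ∑ i ∈ Finset.range m, |KL i| := Finset.sum_nonneg fun _ _ => abs_nonneg _
  have n2 : 0 ≤ ∑ i ∈ Finset.range m, |KR i| := Finset.sum_nonneg fun _ _ => abs_nonneg _
  refine ⟨K, by positivity, fun j k t => ?_⟩
  obtain ⟨h, b, he, hc⟩ := levelFun_cases m g gL gR j k
  rw [he, abs_mul, abs_of_nonneg (Real.sqrt_nonneg _), mul_comm]
  refine mul_le_mul_of_nonneg_right ?_ (Real.sqrt_nonneg _)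
  rcases hc with ⟨rfl, -⟩ | ⟨i, hi, rfl, -⟩ | ⟨i, hi, rfl, -⟩
  · linarith [hK0 ((2 : ℝ) ^ j * t - b), le_abs_self K0]
  · have := Finset.single_le_sum (f := fun i => |KL i|) (fun _ _ => abs_nonneg _)
      (Finset.mem_range.2 hi)
    linarith [hKL i hi ((2 : ℝ) ^ j * t - b), le_abs_self (KL i), abs_nonneg K0]
  · have := Finset.single_le_sum (f := fun i => |KR i|) (fun _ _ => abs_nonneg _)
      (Finset.mem_range.2 hi)
    linarith [hKR i hi ((2 : ℝ) ^ j * t - b), le_abs_self (KR i), abs_nonneg K0]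

lemma levelFun_contDiffOn {m r : ℕ} {g : ℝ → ℝ} {gL gR : ℕ → ℝ → ℝ}
    (cg : ContDiff ℝ r g) (cgL : ∀ i < m, ContDiffOn ℝ r (gL i) (Ici 0))
    (cgR : ∀ i < m, ContDiffOn ℝ r (gR i) (Iic 0)) (j : ℕ) (k : Fin (2 ^ j)) :
    ContDiffOn ℝ r (levelFun m g gL gR j k) (Icc 0 1) := by
  obtain ⟨h, b, he, hc⟩ := levelFun_cases m g gL gR j k
  have h2 : (0 : ℝ) < 2 ^ j := by positivity
  rw [he]
  have hlin : ContDiff ℝ r fun t : ℝ => (2 : ℝ) ^ j * t - b := by fun_prop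
  refine contDiffOn_const.mul ?_
  rcases hc with ⟨rfl, -⟩ | ⟨i, hi, rfl, rfl, -⟩ | ⟨i, hi, rfl, rfl, -⟩
  · exact (cg.comp hlin).contDiffOn
  · refine (cgL i hi).comp hlin.contDiffOn fun t ht => ?_
    have := mul_nonneg h2.le ht.1
    simpa using this
  · refine (cgR i hi).comp hlin.contDiffOn fun t ht => ?_
    have := mul_le_mul_of_nonneg_left ht.2 h2.le
    simp only [mem_Iic]
    linarith

/-- Vanishing moments are inherited by dilated translates. -/
lemma integral_pow_mul_dilate_eq_zero {h : ℝ → ℝ} {a b : ℝ} {r : ℕ} {s : Set ℝ}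
    (hs : Icc a b ⊆ s) (hc : ContinuousOn h s) (hsupp : Function.support h ⊆ Icc a b)
    (hmom : ∀ p < r, ∫ x, x ^ p * h x = 0) {A : ℝ} (hA : 0 < A) (β : ℝ) {p : ℕ} (hp : p < r) :
    ∫ x, x ^ p * h (A * x - β) = 0 := by
  have hint : ∀ q : ℕ, Integrable fun x : ℝ => x ^ q * h x := fun q => by
    have h1 : IntegrableOn (fun x : ℝ => x ^ q * h x) (Icc a b) :=
      ((continuous_pow q).continuousOn.mul (hc.mono hs)).integrableOn_Icc
    refine h1.integrable_of_forall_notMem_eq_zero fun x hx => ?_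
    have : h x = 0 := by
      by_contra h0
      exact hx (hsupp h0)
    simp [this]
  have e1 : ∀ x : ℝ, x ^ p * h (A * x - β) =
      (fun u => ((u + β) / A) ^ p * h u) (A * x - β) := fun x => by
    simp only [sub_add_cancel]
    rw [mul_div_cancel_left₀ _ hA.ne']
  -- substitute `u = A x - β` and expand `(u + β) ^ p`: only moments of order at most `p` occur
  simp_rw [e1]
  rw [Measure.integral_comp_mul_left (fun y => (fun u => ((u + β) / A) ^ p * h u) (y - β)) A,
    integral_sub_right_eq_self (μ := volume) (fun u => ((u + β) / A) ^ p * h u) β]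
  have e2 : ∀ u : ℝ, ((u + β) / A) ^ p * h u =
      ∑ q ∈ Finset.range (p + 1), (β ^ (p - q) * (p.choose q) / A ^ p) * (u ^ q * h u) :=
    fun u => by
      rw [div_pow, add_pow, Finset.sum_div, Finset.sum_mul]
      refine Finset.sum_congr rfl fun q _ => ?_
      ring
  simp_rw [e2]
  rw [integral_finsetSum _ fun q _ => (hint q).const_mul _]
  rw [Finset.sum_eq_zero, smul_zero]
  intro q hq
  rw [integral_const_mul, hmom q (by have := Finset.mem_range.1 hq; omega), mul_zero]

namespace IntervalWaveletBasis

variable {r : ℕ} (W : IntervalWaveletBasis r)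

/-- A radius, in units of `2^{-j}`, within which `ψ_{j,k}` and `φ_{j,k}` live around `k 2^{-j}`. -/
noncomputable def reach : ℝ := 2 ^ W.j0 + W.m + 1

lemma one_le_reach : 1 ≤ W.reach := by
  unfold reach
  have : (0 : ℝ) ≤ 2 ^ W.j0 := by positivity
  have : (0 : ℝ) ≤ W.m := by positivity
  linarith

lemma mother_support {j : ℕ} (hj : W.j0 ≤ j) (k : Fin (2 ^ j)) :
    Function.support (W.mother j k) ⊆
      Icc 0 1 ∩ {t | |(2 : ℝ) ^ j * t - (k : ℕ)| ≤ W.reach} :=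
  levelFun_support W.supp_ψ W.supp_ψL W.supp_ψR hj k

lemma mother_tsupport {j : ℕ} (hj : W.j0 ≤ j) (k : Fin (2 ^ j)) :
    tsupport (W.mother j k) ⊆
      Icc 0 1 ∩ {t | |(2 : ℝ) ^ j * t - (k : ℕ)| ≤ W.reach} := by
  refine closure_minimal (W.mother_support hj k) (isClosed_Icc.inter ?_)
  exact isClosed_le (by fun_prop) continuous_const

lemma exists_mother_bound : ∃ K : ℝ, 0 < K ∧ ∀ (j : ℕ) (k : Fin (2 ^ j)) (t : ℝ),
    |W.mother j k t| ≤ K * √((2 : ℝ) ^ j) :=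
  levelFun_bound W.supp_ψ W.supp_ψL W.supp_ψR W.smooth_ψ.continuous
    (fun i hi => (W.smooth_ψL i hi).continuousOn) (fun i hi => (W.smooth_ψR i hi).continuousOn)

lemma exists_father_bound : ∃ K : ℝ, 0 < K ∧ ∀ (k : Fin (2 ^ W.j0)) (t : ℝ),
    |W.father k t| ≤ K := by
  obtain ⟨K, hK, h⟩ := levelFun_bound W.supp_φ W.supp_φL W.supp_φR W.smooth_φ.continuous
    (fun i hi => (W.smooth_φL i hi).continuousOn) (fun i hi => (W.smooth_φR i hi).continuousOn)
  exact ⟨K * √((2 : ℝ) ^ W.j0), by positivity, fun k t => h W.j0 k t⟩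

lemma mother_contDiffOn (j : ℕ) (k : Fin (2 ^ j)) : ContDiffOn ℝ r (W.mother j k) (Icc 0 1) :=
  levelFun_contDiffOn W.smooth_ψ W.smooth_ψL W.smooth_ψR j k

lemma father_contDiffOn (k : Fin (2 ^ W.j0)) : ContDiffOn ℝ r (W.father k) (Icc 0 1) :=
  levelFun_contDiffOn W.smooth_φ W.smooth_φL W.smooth_φR W.j0 k

lemma mother_moment {j : ℕ} (hj : W.j0 ≤ j) (k : Fin (2 ^ j)) {p : ℕ} (hp : p < r) :
    ∫ x in Icc (0 : ℝ) 1, x ^ p * W.mother j k x = 0 := by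
  rw [setIntegral_eq_integral_of_forall_compl_eq_zero]
  · obtain ⟨h, b, he, hc⟩ := levelFun_cases W.m W.ψ W.ψL W.ψR j k
    have h2 : (0 : ℝ) < 2 ^ j := by positivity
    unfold mother
    rw [he]
    have : ∫ x, x ^ p * h ((2 : ℝ) ^ j * x - b) = 0 := by
      rcases hc with ⟨rfl, -⟩ | ⟨i, hi, rfl, -⟩ | ⟨i, hi, rfl, -⟩
      · exact integral_pow_mul_dilate_eq_zero (subset_univ _) W.smooth_ψ.continuous.continuousOn
          W.supp_ψ W.moment_ψ h2 b hp
      · exact integral_pow_mul_dilate_eq_zero (fun x hx => hx.1)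
          (W.smooth_ψL i hi).continuousOn (W.supp_ψL i hi) (W.moment_ψL i hi) h2 b hp
      · exact integral_pow_mul_dilate_eq_zero (fun x hx => hx.2)
          (W.smooth_ψR i hi).continuousOn (W.supp_ψR i hi) (W.moment_ψR i hi) h2 b hp
    simp_rw [mul_left_comm _ (√((2 : ℝ) ^ j))]
    rw [integral_const_mul, this, mul_zero]
  · intro x hx
    have : W.mother j k x = 0 := by
      by_contra h0
      exact hx (W.mother_support hj k h0).1
    simp [this]

end IntervalWaveletBasis

/-! ### Wavelet coefficients of Hölder functions -/

/-- Local polynomial approximation of order `k` of a function whose `k`-th derivative oscillates by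
at most `K`, by induction: integrate the approximation of the derivative. No Taylor formula with
remainder is needed. -/
lemma exists_poly_approx (k : ℕ) : ∀ f : ℝ → ℝ, ContDiffOn ℝ k f (Icc 0 1) →
    ∀ a b K : ℝ, 0 ≤ a → a ≤ b → b ≤ 1 →
    (∀ x ∈ Icc a b, ∀ y ∈ Icc a b, |iteratedDerivWithin k f (Icc 0 1) x
      - iteratedDerivWithin k f (Icc 0 1) y| ≤ K) →
    ∃ c : ℕ → ℝ, ∀ x ∈ Icc a b,
      |f x - ∑ i ∈ Finset.range (k + 1), c i * x ^ i| ≤ K * (b - a) ^ k := by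
  induction k with
  | zero =>
    intro f hf a b K ha hab hb h
    refine ⟨fun _ => f a, fun x hx => ?_⟩
    simpa using h x hx a (left_mem_Icc.2 hab)
  | succ k ih =>
    intro f hf a b K ha hab hb h
    have hu : UniqueDiffOn ℝ (Icc (0 : ℝ) 1) := uniqueDiffOn_Icc zero_lt_one
    have hsub : Icc a b ⊆ Icc (0 : ℝ) 1 := Icc_subset_Icc ha hb
    have hf' := (contDiffOn_succ_iff_derivWithin (n := (k : WithTop ℕ∞)) hu).1
      (by exact_mod_cast hf)
    simp_rw [iteratedDerivWithin_succ'] at h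
    obtain ⟨c, hc⟩ := ih _ hf'.2.2 a b K ha hab hb h
    set Q : ℝ → ℝ := fun x => ∑ i ∈ Finset.range (k + 1), c i / (i + 1) * x ^ (i + 1) with hQ
    have hQd : ∀ x, HasDerivAt Q (∑ i ∈ Finset.range (k + 1), c i * x ^ i) x := fun x => by
      refine HasDerivAt.fun_sum fun i _ => ?_
      have := (hasDerivAt_pow (i + 1) x).const_mul (c i / (i + 1))
      have hi : (i : ℝ) + 1 ≠ 0 := by positivity
      rwa [Nat.add_sub_cancel, Nat.cast_succ, ← mul_assoc, div_mul_cancel₀ _ hi] at this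
    refine ⟨fun i => Nat.casesOn i (f a - Q a) fun i => c i / (i + 1), fun x hx => ?_⟩
    rw [Finset.sum_range_succ']
    have hmv := (convex_Icc a b).norm_image_sub_le_of_norm_hasDerivWithin_le
      (f := fun x => f x - Q x)
      (f' := fun x => derivWithin f (Icc 0 1) x - ∑ i ∈ Finset.range (k + 1), c i * x ^ i)
      (C := K * (b - a) ^ k) (fun y hy => ?_) (fun y hy => hc y hy) (left_mem_Icc.2 hab) hx
    · have hK : 0 ≤ K * (b - a) ^ k := (abs_nonneg _).trans (hc x hx)
      simp only [Real.norm_eq_abs] at hmv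
      have e : f x - (∑ i ∈ Finset.range (k + 1), c i / (i + 1) * x ^ (i + 1)
          + (f a - Q a) * x ^ 0) = f x - Q x - (f a - Q a) := by
        simp only [hQ, pow_zero]
        ring
      refine (le_of_eq (congrArg abs e)).trans (hmv.trans ?_)
      rw [abs_of_nonneg (sub_nonneg.2 hx.1), pow_succ, ← mul_assoc]
      exact mul_le_mul_of_nonneg_left (by linarith [hx.2]) hK
    · exact (((hf'.1 y (hsub hy)).hasDerivWithinAt).mono hsub).sub (hQd y).hasDerivWithinAt

lemma continuousOn_of_mem_holderClass {α M : ℝ} {f : ℝ → ℝ} (hf : f ∈ holderClass α M) :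
    ContinuousOn f (Icc 0 1) := hf.1.continuousOn

/-- A function of the Hölder class is, on every interval of length `δ`, within `M δ ^ α` of a
polynomial of degree less than `⌈α⌉`. -/
lemma exists_poly_approx_of_mem_holderClass {α M : ℝ} (hα : 0 < α) (hM : 0 ≤ M) {f : ℝ → ℝ}
    (hf : f ∈ holderClass α M) {a b : ℝ} (ha : 0 ≤ a) (hab : a < b) (hb : b ≤ 1) :
    ∃ c : ℕ → ℝ, ∀ x ∈ Icc a b,
      |f x - ∑ i ∈ Finset.range ⌈α⌉₊, c i * x ^ i| ≤ M * (b - a) ^ α := by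
  have hc : 0 < ⌈α⌉₊ := Nat.ceil_pos.2 hα
  have hk : ((⌈α⌉₊ - 1 : ℕ) : ℝ) < α := by
    have := Nat.ceil_lt_add_one hα.le
    rw [Nat.cast_sub hc, Nat.cast_one]
    linarith
  have hba : 0 < b - a := sub_pos.2 hab
  obtain ⟨c, h⟩ := _root_.exists_poly_approx (⌈α⌉₊ - 1) f hf.1 a b
    (M * (b - a) ^ (α - ((⌈α⌉₊ - 1 : ℕ) : ℝ))) ha hab.le hb (fun x hx y hy => by
      have key : ∀ x y : ℝ, x ∈ Icc a b → y ∈ Icc a b → x < y →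
          |iteratedDerivWithin (⌈α⌉₊ - 1) f (Icc 0 1) x
            - iteratedDerivWithin (⌈α⌉₊ - 1) f (Icc 0 1) y|
            ≤ M * (b - a) ^ (α - ((⌈α⌉₊ - 1 : ℕ) : ℝ)) := fun x y hx hy hxy => by
        refine (hf.2 x y (ha.trans hx.1) hxy (hy.2.trans hb)).trans ?_
        refine mul_le_mul_of_nonneg_left ?_ hM
        refine Real.rpow_le_rpow (abs_nonneg _) ?_ (by linarith)
        rw [abs_sub_comm, abs_of_pos (sub_pos.2 hxy)]
        linarith [hx.1, hy.2]
      rcases lt_trichotomy x y with h | h | h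
      · exact key x y hx hy h
      · rw [h, sub_self, abs_zero]
        positivity
      · rw [abs_sub_comm]
        exact key y x hy hx h)
  refine ⟨c, fun x hx => ?_⟩
  have := h x hx
  rw [Nat.sub_add_cancel hc, mul_assoc, ← Real.rpow_natCast, ← Real.rpow_add hba,
    sub_add_cancel] at this
  exact this

namespace IntervalWaveletBasis

variable {r : ℕ} (W : IntervalWaveletBasis r)

/-- The wavelet coefficient `θ_{j,k} = ∫_0^1 f ψ_{j,k}`. -/
noncomputable def coeff (f : ℝ → ℝ) (j : ℕ) (k : Fin (2 ^ j)) : ℝ :=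
  ∫ x in Icc (0 : ℝ) 1, f x * W.mother j k x

/-- The coarse coefficient `∫_0^1 f φ_{j0,k}`. -/
noncomputable def coarse (f : ℝ → ℝ) (k : Fin (2 ^ W.j0)) : ℝ :=
  ∫ x in Icc (0 : ℝ) 1, f x * W.father k x

/-- Decay of the wavelet coefficients over a Hölder class: subtract the local polynomial
approximation, which the vanishing moments do not see. -/
lemma exists_coeff_sq_le {α M : ℝ} (hα : 0 < α) (hαr : α < r) (hM : 0 < M) :
    ∃ C : ℝ, 0 < C ∧ ∀ f ∈ holderClass α M, ∀ j, W.j0 ≤ j → ∀ k : Fin (2 ^ j),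
      W.coeff f j k ^ 2 ≤ C * ((2 : ℝ) ^ j) ^ (-(2 * α + 1)) := by
  obtain ⟨K, hK, hKb⟩ := W.exists_mother_bound
  have hD := W.one_le_reach
  set D := W.reach
  refine ⟨(M * (2 * D) ^ (α + 1) * K) ^ 2, by positivity, fun f hf j hj k => ?_⟩
  set X : ℝ := 2 ^ j with hX
  have hX0 : 0 < X := by positivity
  have hX1 : 1 ≤ X := one_le_pow₀ (by norm_num)
  have hkX : ((k : ℕ) : ℝ) + 1 ≤ X := by rw [hX]; exact_mod_cast k.2
  have hk0 : (0 : ℝ) ≤ (k : ℕ) := by positivity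
  -- `[a,b]` contains the support of `ψ_{j,k}` and has length of order `2 ^ (-j)`
  set a : ℝ := max 0 (((k : ℕ) - D) / X) with ha
  set b : ℝ := min 1 (((k : ℕ) + D) / X) with hb
  have hab : a < b := by
    rw [ha, hb, max_lt_iff, lt_min_iff, lt_min_iff]
    refine ⟨⟨one_pos, by positivity⟩, ?_, ?_⟩
    · rw [div_lt_one hX0]; linarith
    · gcongr; linarith
  have hlen : b - a ≤ 2 * D / X := by
    have h1 : b ≤ ((k : ℕ) + D) / X := min_le_right _ _
    have h2 : ((k : ℕ) - D) / X ≤ a := le_max_right _ _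
    have : 2 * D / X = ((k : ℕ) + D) / X - ((k : ℕ) - D) / X := by ring
    linarith
  have ha0 : 0 ≤ a := le_max_left _ _
  have hb1 : b ≤ 1 := min_le_left _ _
  have hsub : Icc a b ⊆ Icc (0 : ℝ) 1 := Icc_subset_Icc ha0 hb1
  have hsupp : ∀ x, x ∉ Icc a b → W.mother j k x = 0 := fun x hx => by
    by_contra h0
    obtain ⟨h1, h2⟩ := W.mother_support hj k h0
    rw [mem_ofPred_eq, abs_le] at h2
    refine hx ⟨max_le h1.1 ?_, le_min h1.2 ?_⟩
    · rw [div_le_iff₀ hX0]; linarith [h2.1]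
    · rw [le_div_iff₀ hX0]; linarith [h2.2]
  obtain ⟨c, hc⟩ := exists_poly_approx_of_mem_holderClass hα hM.le hf ha0 hab hb1
  have hψ : ContinuousOn (W.mother j k) (Icc 0 1) := (W.mother_contDiffOn j k).continuousOn
  have hpoly : ∫ x in Icc (0 : ℝ) 1, (∑ i ∈ Finset.range ⌈α⌉₊, c i * x ^ i) * W.mother j k x
      = 0 := by
    simp_rw [Finset.sum_mul, mul_assoc]
    rw [integral_finsetSum]
    · refine Finset.sum_eq_zero fun i hi => ?_
      rw [integral_const_mul, W.mother_moment hj k, mul_zero]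
      exact (Finset.mem_range.1 hi).trans_le (Nat.ceil_le.2 hαr.le)
    · intro i _
      exact ContinuousOn.integrableOn_Icc (by fun_prop)
  have e1 : W.coeff f j k = ∫ x in Icc a b,
      (f x - ∑ i ∈ Finset.range ⌈α⌉₊, c i * x ^ i) * W.mother j k x := by
    have hfc := continuousOn_of_mem_holderClass hf
    have : W.coeff f j k = ∫ x in Icc (0 : ℝ) 1,
        (f x - ∑ i ∈ Finset.range ⌈α⌉₊, c i * x ^ i) * W.mother j k x := by
      simp_rw [sub_mul]
      rw [integral_sub, hpoly, sub_zero, coeff]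
      · exact ContinuousOn.integrableOn_Icc (by fun_prop)
      · exact ContinuousOn.integrableOn_Icc (by fun_prop)
    rw [this]
    refine setIntegral_eq_of_subset_of_forall_sdiff_eq_zero measurableSet_Icc hsub fun x hx => ?_
    rw [hsupp x hx.2, mul_zero]
  have h1 : |W.coeff f j k| ≤ M * (b - a) ^ α * (K * √X) * (b - a) := by
    have := norm_setIntegral_le_of_norm_le_const (μ := volume) (s := Icc a b)
      (f := fun x => (f x - ∑ i ∈ Finset.range ⌈α⌉₊, c i * x ^ i) * W.mother j k x)
      (C := M * (b - a) ^ α * (K * √X)) (by simp) (fun x hx => ?_)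
    · rw [e1]
      simpa [hab.le] using this
    · rw [norm_mul]
      exact mul_le_mul (hc x hx) (hKb j k x) (abs_nonneg _)
        (mul_nonneg hM.le (Real.rpow_nonneg (sub_pos.2 hab).le _))
  have hba : 0 < b - a := sub_pos.2 hab
  have h2 : |W.coeff f j k| ≤ M * (2 * D) ^ (α + 1) * K * (X ^ (-(α + 1)) * √X) := by
    calc |W.coeff f j k| ≤ M * K * √X * (b - a) ^ (α + 1) := by
          rw [Real.rpow_add_one hba.ne']
          linarith [h1]
      _ ≤ M * K * √X * (2 * D / X) ^ (α + 1) := by gcongr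
      _ = _ := by
          rw [Real.div_rpow (by positivity) hX0.le, Real.rpow_neg hX0.le]
          ring
  have h3 : (X ^ (-(α + 1)) * √X) ^ 2 = X ^ (-(2 * α + 1)) := by
    rw [mul_pow, Real.sq_sqrt hX0.le, ← Real.rpow_natCast, ← Real.rpow_mul hX0.le]
    nth_rw 2 [← Real.rpow_one X]
    rw [← Real.rpow_add hX0]
    congr 1
    push_cast
    ring
  calc W.coeff f j k ^ 2 = |W.coeff f j k| ^ 2 := (sq_abs _).symm
    _ ≤ (M * (2 * D) ^ (α + 1) * K * (X ^ (-(α + 1)) * √X)) ^ 2 := by gcongr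
    _ = _ := by rw [mul_pow, h3]

end IntervalWaveletBasis

/-! ### Orthonormal expansions -/

namespace IsONBOn

variable {S : Set ℝ} {ι : Type} {b : ι → ℝ → ℝ}

lemma memLp_sum (h : IsONBOn S b) (s : Finset ι) (d : ι → ℝ) :
    MemLp (fun x => ∑ i ∈ s, d i * b i x) 2 (volume.restrict S) :=
  memLp_finsetSum _ fun i _ => (h.memLp i).const_mul (d i)

/-- The expansion of an `L²` function converges in `L²`. -/
lemma exists_expansion (h : IsONBOn S b) {f : ℝ → ℝ} (hf : MemLp f 2 (volume.restrict S))
    {ε : ℝ} (hε : 0 < ε) : ∃ s0 : Finset ι, ∀ s, s0 ⊆ s →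
      ∫ x in S, (f x - ∑ i ∈ s, (∫ y in S, f y * b i y) * b i x) ^ 2 ≤ ε := by
  classical
  set μ := volume.restrict S
  let e : ι → Lp ℝ 2 μ := fun i => (h.memLp i).toLp
  have inner_toLp : ∀ {u v : ℝ → ℝ} (hu : MemLp u 2 μ) (hv : MemLp v 2 μ),
      inner ℝ hu.toLp hv.toLp = ∫ x, u x * v x ∂μ := fun hu hv => by
    rw [L2.inner_def]
    refine integral_congr_ae ?_
    filter_upwards [hu.coeFn_toLp, hv.coeFn_toLp] with x h1 h2
    rw [h1, h2]
    simp [mul_comm]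
  have ho : Orthonormal ℝ e := by
    rw [orthonormal_iff_ite]
    intro i i'
    rw [inner_toLp]
    split_ifs with hi
    · rw [← hi]; exact h.norm_one i
    · exact h.orthogonal i i' hi
  have hbot : (Submodule.span ℝ (range e))ᗮ = ⊥ := by
    rw [Submodule.eq_bot_iff]
    intro v hv
    have hv' : MemLp v 2 μ := Lp.memLp v
    have : v =ᵐ[μ] 0 := by
      refine h.complete v hv' fun i => ?_
      have h1 := (Submodule.mem_orthogonal _ _).1 hv (e i)
        (Submodule.subset_span (mem_range_self i))
      rw [← Lp.toLp_coeFn v hv', inner_toLp] at h1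
      simp_rw [mul_comm (v _)]
      exact h1
    rw [← Lp.toLp_coeFn v hv']
    exact (MemLp.toLp_eq_toLp_iff hv' MemLp.zero).2 this
  -- the classes of the `b i` form a Hilbert basis of `L²`, whose expansions converge
  let B := HilbertBasis.mkOfOrthogonalEqBot ho hbot
  have hs := B.hasSum_repr hf.toLp
  have hB : ∀ i, B i = e i := fun i => by simp [B]
  obtain ⟨s0, hs0⟩ := (Metric.tendsto_atTop.1 hs) (√ε) (Real.sqrt_pos.2 hε)
  refine ⟨s0, fun s hss => ?_⟩
  have h1 := (hs0 s hss).le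
  have hmem : MemLp (fun x => f x - ∑ i ∈ s, (∫ y, f y * b i y ∂μ) * b i x) 2 μ :=
    hf.sub (h.memLp_sum s _)
  have h2 : hmem.toLp = hf.toLp - ∑ i ∈ s, B.repr hf.toLp i • B i := by
    have e1 : ∀ i, B.repr hf.toLp i = ∫ y, f y * b i y ∂μ := fun i => by
      rw [HilbertBasis.repr_apply_apply, hB, real_inner_comm, inner_toLp]
    simp_rw [e1, hB]
    have e2 : hmem.toLp = hf.toLp - (h.memLp_sum s fun i => ∫ y, f y * b i y ∂μ).toLp :=
      MemLp.toLp_sub hf _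
    rw [e2]
    congr 1
    refine Lp.ext ((MemLp.coeFn_toLp _).trans ?_)
    have e3 := Lp.coeFn_finsetSum s (fun i => (∫ y, f y * b i y ∂μ) • e i)
    have e4 : ∀ᵐ x ∂μ, ∀ i ∈ s, ((∫ y, f y * b i y ∂μ) • e i : Lp ℝ 2 μ) x
        = (∫ y, f y * b i y ∂μ) * b i x := by
      rw [Finset.eventually_all]
      intro i _
      filter_upwards [Lp.coeFn_smul (∫ y, f y * b i y ∂μ) (e i), (h.memLp i).coeFn_toLp]
        with x h1 h2
      rw [h1, Pi.smul_apply, h2, smul_eq_mul]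
    filter_upwards [e3, e4] with x h3 h4
    rw [h3, Finset.sum_apply]
    exact (Finset.sum_congr rfl h4).symm
  have h3 : ‖hmem.toLp‖ ^ 2 = ∫ x, (f x - ∑ i ∈ s, (∫ y, f y * b i y ∂μ) * b i x) ^ 2 ∂μ := by
    rw [← real_inner_self_eq_norm_sq, inner_toLp]
    simp_rw [sq]
  rw [← h3, h2, ← dist_eq_norm, dist_comm]
  calc _ ≤ √ε ^ 2 := by gcongr
    _ = ε := Real.sq_sqrt hε.le

end IsONBOn

/-! ### Riemann sums and integration by parts -/

lemma grid_le {N i : ℕ} (hi : i < N) : 0 ≤ (i : ℝ) / N ∧ (i : ℝ) / N ≤ ((i + 1 : ℕ) : ℝ) / N ∧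
    ((i + 1 : ℕ) : ℝ) / N ≤ 1 := by
  have hN : (0 : ℝ) < N := by exact_mod_cast (Nat.zero_le i).trans_lt hi
  refine ⟨by positivity, ?_, ?_⟩
  · gcongr; omega
  · rw [div_le_one hN]; exact_mod_cast hi

/-- Tagged Riemann–Stieltjes sums of a continuous `F` against the primitive of a bounded `k`
converge to `∫ F k`. -/
lemma tendsto_tagged_sum {F k : ℝ → ℝ} (hF : ContinuousOn F (Icc 0 1))
    (hk : IntegrableOn k (Icc 0 1)) {K : ℝ} (hK : ∀ x ∈ Icc (0 : ℝ) 1, |k x| ≤ K)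
    {τ : ℕ → ℕ → ℝ} (hτ : ∀ N i : ℕ, i < N → τ N i ∈ Icc ((i : ℝ) / N) (((i + 1 : ℕ) : ℝ) / N)) :
    Tendsto (fun N : ℕ => ∑ i ∈ Finset.range N,
        F (τ N i) * ∫ x in ((i : ℝ) / N)..(((i + 1 : ℕ) : ℝ) / N), k x)
      atTop (nhds (∫ x in (0 : ℝ)..1, F x * k x)) := by
  have hK0 : 0 ≤ K := (abs_nonneg _).trans (hK 0 ⟨le_rfl, zero_le_one⟩)
  have hFk : IntegrableOn (fun x => F x * k x) (Icc 0 1) := hk.continuousOn_mul hF isCompact_Icc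
  have hii : ∀ {h : ℝ → ℝ}, IntegrableOn h (Icc 0 1) → ∀ {N i : ℕ}, i < N →
      IntervalIntegrable h volume ((i : ℝ) / N) (((i + 1 : ℕ) : ℝ) / N) := fun hh N i hi => by
    obtain ⟨h1, h2, h3⟩ := grid_le hi
    exact (intervalIntegrable_iff_integrableOn_Icc_of_le h2).2
      (hh.mono_set (Icc_subset_Icc h1 h3))
  have huc := isCompact_Icc.uniformContinuousOn_of_continuous hF
  rw [Metric.uniformContinuousOn_iff_le] at huc
  rw [Metric.tendsto_atTop]
  intro ε hε
  obtain ⟨δ, hδ, hu⟩ := huc (ε / (2 * (K + 1))) (by positivity)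
  obtain ⟨N0, hN0⟩ := exists_nat_gt (1 / δ)
  refine ⟨N0 + 1, fun N hN => ?_⟩
  have hNpos : (0 : ℝ) < N := by exact_mod_cast (Nat.succ_pos N0).trans_le hN
  have hNδ : 1 / (N : ℝ) ≤ δ := by
    rw [div_le_iff₀ hNpos]
    have : (N0 : ℝ) ≤ N := by exact_mod_cast (Nat.le_succ N0).trans hN
    rw [div_lt_iff₀ hδ] at hN0
    nlinarith
  have hsplit : ∫ x in (0 : ℝ)..1, F x * k x = ∑ i ∈ Finset.range N,
      ∫ x in ((i : ℝ) / N)..(((i + 1 : ℕ) : ℝ) / N), F x * k x := by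
    rw [intervalIntegral.sum_integral_adjacent_intervals (a := fun i : ℕ => (i : ℝ) / N)
      (fun i hi => hii hFk hi)]
    simp [div_self hNpos.ne']
  rw [hsplit, dist_eq_norm, ← Finset.sum_sub_distrib]
  have hterm : ∀ i ∈ Finset.range N,
      ‖F (τ N i) * (∫ x in ((i : ℝ) / N)..(((i + 1 : ℕ) : ℝ) / N), k x)
        - ∫ x in ((i : ℝ) / N)..(((i + 1 : ℕ) : ℝ) / N), F x * k x‖
        ≤ ε / (2 * (K + 1)) * K * (1 / N) := fun i hi => by
    have hi' := Finset.mem_range.1 hi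
    obtain ⟨h1, h2, h3⟩ := grid_le hi'
    have hlen : ((i + 1 : ℕ) : ℝ) / N - (i : ℝ) / N = 1 / N := by push_cast; ring
    rw [← intervalIntegral.integral_const_mul, ← intervalIntegral.integral_sub
      ((hii hk hi').const_mul _) (hii hFk hi')]
    have := intervalIntegral.norm_integral_le_of_norm_le_const
      (f := fun x => F (τ N i) * k x - F x * k x)
      (a := (i : ℝ) / N) (b := ((i + 1 : ℕ) : ℝ) / N) (C := ε / (2 * (K + 1)) * K)
      (fun x hx => ?_)
    · rwa [hlen, abs_of_pos (by positivity)] at this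
    · rw [uIoc_of_le h2] at hx
      have hx' : x ∈ Icc (0 : ℝ) 1 := ⟨h1.trans hx.1.le, hx.2.trans h3⟩
      have ht := hτ N i hi'
      rw [← sub_mul, norm_mul]
      refine mul_le_mul ?_ (hK x hx') (norm_nonneg _) (by positivity)
      rw [← dist_eq_norm]
      refine hu _ ⟨h1.trans ht.1, ht.2.trans h3⟩ _ hx' ?_
      rw [Real.dist_eq, abs_le]
      constructor <;> linarith [hx.1, hx.2, ht.1, ht.2]
  calc _ ≤ ∑ i ∈ Finset.range N, ε / (2 * (K + 1)) * K * (1 / N) :=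
        norm_sum_le_of_le _ hterm
    _ = ε / 2 * (K / (K + 1)) := by
        rw [Finset.sum_const, Finset.card_range, nsmul_eq_mul]
        field_simp
    _ ≤ ε / 2 * 1 := by
        gcongr
        rw [div_le_one (by positivity)]
        linarith
    _ < ε := by linarith

/-- Interior points of `[0,1]` see the ordinary derivative. -/
lemma hasDerivAt_of_contDiffOn {g : ℝ → ℝ} (hg : ContDiffOn ℝ 1 g (Icc 0 1)) {x : ℝ}
    (hx : x ∈ Ioo (0 : ℝ) 1) : HasDerivAt g (derivWithin g (Icc 0 1) x) x :=
  ((hg.differentiableOn one_ne_zero x (Ioo_subset_Icc_self hx)).hasDerivWithinAt).hasDerivAt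
    (Icc_mem_nhds hx.1 hx.2)

lemma continuousOn_derivWithin_Icc {g : ℝ → ℝ} (hg : ContDiffOn ℝ 1 g (Icc 0 1)) :
    ContinuousOn (derivWithin g (Icc 0 1)) (Icc 0 1) :=
  hg.continuousOn_derivWithin (uniqueDiffOn_Icc zero_lt_one) le_rfl

lemma integral_derivWithin_eq_sub {g : ℝ → ℝ} (hg : ContDiffOn ℝ 1 g (Icc 0 1)) {a b : ℝ}
    (ha : 0 ≤ a) (hab : a ≤ b) (hb : b ≤ 1) :
    ∫ x in a..b, derivWithin g (Icc 0 1) x = g b - g a := by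
  have hsub : Icc a b ⊆ Icc (0 : ℝ) 1 := Icc_subset_Icc ha hb
  refine intervalIntegral.integral_eq_sub_of_hasDerivAt_of_le hab (hg.continuousOn.mono hsub)
    (fun x hx => hasDerivAt_of_contDiffOn hg ⟨ha.trans_lt hx.1, hx.2.trans_le hb⟩) ?_
  rw [intervalIntegrable_iff_integrableOn_Icc_of_le hab]
  exact ((continuousOn_derivWithin_Icc hg).mono hsub).integrableOn_Icc

/-- The path integral, written with an extension `b` of the path to the line. -/
lemma pathIntegral_eq {g b : ℝ → ℝ} {z : unitInterval → ℝ} (hz : ∀ t, z t = b t) :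
    pathIntegral g z = g 1 * b 1 - g 0 * b 0
      - ∫ x in (0 : ℝ)..1, b x * derivWithin g (Icc 0 1) x := by
  have h : ∫ t : unitInterval, derivWithin g (Icc 0 1) t * z t
      = ∫ x in (0 : ℝ)..1, b x * derivWithin g (Icc 0 1) x := by
    rw [intervalIntegral.integral_of_le zero_le_one, ← integral_Icc_eq_integral_Ioc,
      ← integral_subtype measurableSet_Icc]
    exact integral_congr_ae (ae_of_all _ fun t => by simp only [hz, mul_comm])
  rw [pathIntegral, h, hz, hz]
  simp

lemma pathIntegral_add_smul {g : ℝ → ℝ} (hg : ContDiffOn ℝ 1 g (Icc 0 1))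
    {z w : unitInterval → ℝ} (hz : Continuous z) (hw : Continuous w) (c : ℝ) :
    pathIntegral g (fun t => z t + c * w t) = pathIntegral g z + c * pathIntegral g w := by
  have hd : Continuous fun t : unitInterval => derivWithin g (Icc 0 1) t :=
    continuousOn_iff_continuous_domRestrict.1 (continuousOn_derivWithin_Icc hg)
  have h1 : Integrable fun t : unitInterval => derivWithin g (Icc 0 1) t * z t :=
    (hd.mul hz).integrable_of_hasCompactSupport (HasCompactSupport.of_compactSpace _)
  have h2 : Integrable fun t : unitInterval => derivWithin g (Icc 0 1) t * w t :=
    (hd.mul hw).integrable_of_hasCompactSupport (HasCompactSupport.of_compactSpace _)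
  simp only [pathIntegral, mul_add, mul_left_comm _ c]
  rw [integral_add h1 (h2.const_mul c), integral_const_mul]
  ring

/-- The signal part of an empirical coefficient. -/
lemma pathIntegral_primitive {f g : ℝ → ℝ} (hf : ContinuousOn f (Icc 0 1))
    (hg : ContDiffOn ℝ 1 g (Icc 0 1)) :
    pathIntegral g (fun t => ∫ x in (0 : ℝ)..t, f x) = ∫ x in Icc (0 : ℝ) 1, f x * g x := by
  have hint : ∀ t ∈ Icc (0 : ℝ) 1, IntervalIntegrable f volume 0 t := fun t ht => by
    rw [intervalIntegrable_iff_integrableOn_Icc_of_le ht.1]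
    exact (hf.mono (Icc_subset_Icc_right ht.2)).integrableOn_Icc
  have hprim : ∀ x ∈ Ioo (0 : ℝ) 1, HasDerivAt (fun t => ∫ x in (0 : ℝ)..t, f x) (f x) x :=
    fun x hx => by
      refine intervalIntegral.integral_hasDerivAt_right (hint x (Ioo_subset_Icc_self hx)) ?_
        (hf.continuousAt (Icc_mem_nhds hx.1 hx.2))
      exact (hf.mono Ioo_subset_Icc_self).stronglyMeasurableAtFilter isOpen_Ioo x hx
  have hpc : ContinuousOn (fun t => ∫ x in (0 : ℝ)..t, f x) (Icc 0 1) :=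
    intervalIntegral.continuousOn_primitive_interval'
      ((intervalIntegrable_iff_integrableOn_Icc_of_le zero_le_one).2 hf.integrableOn_Icc)
      left_mem_uIcc |>.mono (by rw [uIcc_of_le zero_le_one])
  have hd := continuousOn_derivWithin_Icc hg
  have hgc := hg.continuousOn
  have i1 : IntervalIntegrable (fun x => derivWithin g (Icc 0 1) x * ∫ y in (0 : ℝ)..x, f y)
      volume 0 1 := by
    rw [intervalIntegrable_iff_integrableOn_Icc_of_le zero_le_one]
    exact (hd.mul hpc).integrableOn_Icc
  have i2 : IntervalIntegrable (fun x => g x * f x) volume 0 1 := by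
    rw [intervalIntegrable_iff_integrableOn_Icc_of_le zero_le_one]
    exact (hgc.mul hf).integrableOn_Icc
  have hftc := intervalIntegral.integral_eq_sub_of_hasDerivAt_of_le zero_le_one (hgc.mul hpc)
    (fun x hx => (hasDerivAt_of_contDiffOn hg hx).mul (hprim x hx)) (i1.add i2)
  rw [intervalIntegral.integral_add i1 i2] at hftc
  rw [pathIntegral_eq (b := fun t => ∫ x in (0 : ℝ)..t, f x) (fun t => rfl)]
  simp only [Pi.mul_apply, intervalIntegral.integral_same, mul_zero, sub_zero] at hftc ⊢
  rw [integral_Icc_eq_integral_Ioc, ← intervalIntegral.integral_of_le zero_le_one]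
  simp_rw [mul_comm (f _) (g _), mul_comm _ (derivWithin g (Icc 0 1) _)]
  linarith

/-- Left Riemann–Stieltjes sums against a continuous path converge to the path integral. -/
lemma tendsto_sum_increments {g b : ℝ → ℝ} (hg : ContDiffOn ℝ 1 g (Icc 0 1))
    (hb : ContinuousOn b (Icc 0 1)) {z : unitInterval → ℝ} (hz : ∀ t, z t = b t) :
    Tendsto (fun N : ℕ => ∑ i ∈ Finset.range N,
        g ((i : ℝ) / N) * (b (((i + 1 : ℕ) : ℝ) / N) - b ((i : ℝ) / N)))
      atTop (nhds (pathIntegral g z)) := by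
  have hd := continuousOn_derivWithin_Icc hg
  obtain ⟨K, hK⟩ := isCompact_Icc.exists_bound_of_continuousOn hd
  have h1 := tendsto_tagged_sum hb hd.integrableOn_Icc hK
    (τ := fun N i => ((i + 1 : ℕ) : ℝ) / N) (fun N i hi => ⟨(grid_le hi).2.1, le_rfl⟩)
  rw [pathIntegral_eq hz]
  refine (tendsto_const_nhds.sub h1).congr' ?_
  filter_upwards [eventually_gt_atTop 0] with N hN
  have hNpos : (N : ℝ) ≠ 0 := by exact_mod_cast hN.ne'
  -- summation by parts turns the increments of `b` into those of `g`, which are integrals of `g'`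
  have htel := Finset.sum_range_sub (fun i : ℕ => g ((i : ℝ) / N) * b ((i : ℝ) / N)) N
  simp only [div_self hNpos, Nat.cast_zero, zero_div] at htel
  rw [← htel, ← Finset.sum_sub_distrib]
  refine Finset.sum_congr rfl fun i hi => ?_
  obtain ⟨h1, h2, h3⟩ := grid_le (Finset.mem_range.1 hi)
  rw [integral_derivWithin_eq_sub hg h1 h2 h3]
  ring

/-! ### Limits of centred Gaussian processes -/

section GaussianLimit

variable {Ω : Type*} {mΩ : MeasurableSpace Ω} {P : Measure Ω}

/-- Almost sure limits of centred Gaussian variables with convergent variances are Gaussian: their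
characteristic functions converge. -/
lemma map_eq_gaussianReal_of_tendsto [IsProbabilityMeasure P] {Z : ℕ → Ω → ℝ} {Y : Ω → ℝ}
    {v : ℕ → ℝ≥0} {w : ℝ≥0} (hZm : ∀ N, AEMeasurable (Z N) P)
    (hZ : ∀ N, P.map (Z N) = gaussianReal 0 (v N))
    (hlim : ∀ᵐ ω ∂P, Tendsto (fun N => Z N ω) atTop (nhds (Y ω)))
    (hv : Tendsto v atTop (nhds w)) : P.map Y = gaussianReal 0 w := by
  have hYm : AEMeasurable Y P := aemeasurable_of_tendsto_metrizable_ae atTop hZm hlim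
  have : IsProbabilityMeasure (P.map Y) := Measure.isProbabilityMeasure_map hYm
  refine Measure.ext_of_charFun ?_
  ext t
  rw [charFun_gaussianReal, charFun_apply_real, integral_map hYm (by fun_prop)]
  have h1 : Tendsto (fun N => ∫ ω, Complex.exp (t * Z N ω * Complex.I) ∂P) atTop
      (nhds (∫ ω, Complex.exp (t * Y ω * Complex.I) ∂P)) := by
    refine tendsto_integral_of_dominated_convergence (fun _ => (1 : ℝ)) (fun N => ?_)
      (integrable_const _) (fun N => ae_of_all _ fun ω => ?_) ?_
    · have := (hZm N)
      have h : AEMeasurable (fun ω => Complex.exp (t * Z N ω * Complex.I)) P := by fun_prop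
      exact h.aestronglyMeasurable
    · rw [← Complex.ofReal_mul, Complex.norm_exp_ofReal_mul_I]
    · filter_upwards [hlim] with ω hω
      have hc : Continuous fun x : ℝ => Complex.exp (t * x * Complex.I) := by fun_prop
      exact (hc.tendsto _).comp hω
  have h2 : ∀ N, ∫ ω, Complex.exp (t * Z N ω * Complex.I) ∂P
      = Complex.exp (t * (0 : ℝ) * Complex.I - (v N) * t ^ 2 / 2) := fun N => by
    rw [← charFun_gaussianReal, ← hZ N, charFun_apply_real,
      integral_map (hZm N) (by fun_prop)]
  simp_rw [h2] at h1
  refine tendsto_nhds_unique h1 ?_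
  have hc : Continuous fun x : ℝ≥0 =>
      Complex.exp (t * (0 : ℝ) * Complex.I - ((x : ℝ) : ℂ) * t ^ 2 / 2) := by fun_prop
  exact (hc.tendsto w).comp hv

variable {T : Type}

/-- An almost sure limit of centred Gaussian processes whose covariances converge is a centred
Gaussian process with the limiting covariance. -/
lemma gaussianProcess_of_tendsto [IsProbabilityMeasure P] {Z : ℕ → T → Ω → ℝ} {Y : T → Ω → ℝ}
    {C : T → T → ℝ}
    (hZ : ∀ N, IsGaussianProcess (Z N) P) (h0 : ∀ N s, ∫ ω, Z N s ω ∂P = 0)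
    (hlim : ∀ s, ∀ᵐ ω ∂P, Tendsto (fun N => Z N s ω) atTop (nhds (Y s ω)))
    (hcov : ∀ s t, Tendsto (fun N => cov[Z N s, Z N t; P]) atTop (nhds (C s t))) :
    IsGaussianProcess Y P ∧ (∀ s, ∫ ω, Y s ω ∂P = 0) ∧ ∀ s t, cov[Y s, Y t; P] = C s t := by
  classical
  have hZm : ∀ N s, AEMeasurable (Z N s) P := fun N s => (hZ N).aemeasurable s
  have hYm : ∀ s, AEMeasurable (Y s) P := fun s =>
    aemeasurable_of_tendsto_metrizable_ae atTop (fun N => hZm N s) (hlim s)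
  -- linear combinations of the limit have the right Gaussian law
  have key : ∀ {ι : Type} [Fintype ι] (σ : ι → T) (a : ι → ℝ),
      P.map (fun ω => ∑ i, a i * Y (σ i) ω) =
        gaussianReal 0 (∑ i, ∑ i', a i * a i' * C (σ i) (σ i')).toNNReal ∧
        0 ≤ ∑ i, ∑ i', a i * a i' * C (σ i) (σ i') := by
    intro ι _ σ a
    have hlp : ∀ N i, MemLp (fun ω => a i * Z N (σ i) ω) 2 P := fun N i =>
      ((hZ N).hasGaussianLaw_eval (σ i)).memLp_two.const_mul _
    have hg : ∀ N, HasGaussianLaw (fun ω => ∑ i, a i * Z N (σ i) ω) P := fun N => by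
      have h1 : IsGaussianProcess (fun i => Z N (σ i)) P := (hZ N).comp_right σ
      have h2 := h1.smul a
      exact h2.hasGaussianLaw_fun_sum (I := Finset.univ)
    have hmean : ∀ N, ∫ ω, ∑ i, a i * Z N (σ i) ω ∂P = 0 := fun N => by
      rw [integral_finsetSum _ fun i _ => (hlp N i).integrable (by norm_num)]
      simp [integral_const_mul, h0]
    have hvar : ∀ N, Var[fun ω => ∑ i, a i * Z N (σ i) ω; P]
        = ∑ i, ∑ i', a i * a i' * cov[Z N (σ i), Z N (σ i'); P] := fun N => by
      rw [← covariance_self (hg N).aemeasurable,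
        covariance_fun_sum_fun_sum (hlp N) (hlp N)]
      refine Finset.sum_congr rfl fun i _ => Finset.sum_congr rfl fun i' _ => ?_
      rw [covariance_const_mul_left, covariance_const_mul_right]
      ring
    have hvl : Tendsto (fun N => Var[fun ω => ∑ i, a i * Z N (σ i) ω; P]) atTop
        (nhds (∑ i, ∑ i', a i * a i' * C (σ i) (σ i'))) := by
      simp_rw [hvar]
      exact tendsto_finsetSum _ fun i _ => tendsto_finsetSum _ fun i' _ =>
        (hcov _ _).const_mul _
    refine ⟨?_, ge_of_tendsto' hvl fun N => variance_nonneg _ _⟩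
    refine map_eq_gaussianReal_of_tendsto (fun N => (hg N).aemeasurable) (fun N => ?_) ?_
      ((continuous_real_toNNReal.tendsto _).comp hvl)
    · rw [(hg N).map_eq_gaussianReal, hmean]
      rfl
    · have : ∀ᵐ ω ∂P, ∀ i, Tendsto (fun N => Z N (σ i) ω) atTop (nhds (Y (σ i) ω)) :=
        ae_all_iff.2 fun i => hlim (σ i)
      filter_upwards [this] with ω hω
      exact tendsto_finsetSum _ fun i _ => (hω i).const_mul _
  have hlaw : ∀ s, P.map (Y s) = gaussianReal 0 (C s s).toNNReal ∧ 0 ≤ C s s := fun s => by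
    simpa using key (fun _ : Fin 1 => s) (fun _ => 1)
  have hGL : ∀ s, HasGaussianLaw (Y s) P := fun s => ⟨by rw [(hlaw s).1]; infer_instance⟩
  have hvarY : ∀ s, Var[Y s; P] = C s s := fun s => by
    rw [← variance_id_map (hYm s), (hlaw s).1, variance_id_gaussianReal,
      Real.coe_toNNReal _ (hlaw s).2]
  refine ⟨⟨fun I => ⟨?_⟩⟩, fun s => ?_, fun s t => ?_⟩
  · have hm : AEMeasurable (fun ω => I.restrict (Y · ω)) P :=
      aemeasurable_pi_lambda _ fun i => hYm i
    refine isGaussian_of_map_eq_gaussianReal fun L => ?_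
    refine ⟨0, (∑ i : I, ∑ i' : I, L (Pi.single i 1) * L (Pi.single i' 1) * C i i').toNNReal, ?_⟩
    rw [AEMeasurable.map_map_of_aemeasurable (by fun_prop) hm]
    rw [← (key (fun i : I => (i : T)) (fun i => L (Pi.single i 1))).1]
    congr 1
    funext ω
    simp only [Function.comp_apply]
    conv_lhs => rw [← Finset.univ_sum_single (I.restrict (Y · ω)), map_sum]
    refine Finset.sum_congr rfl fun i _ => ?_
    have : (Pi.single i (I.restrict (Y · ω) i) : I → ℝ) = (Y i ω) • Pi.single i 1 := by
      rw [← Pi.single_smul, smul_eq_mul, mul_one]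
      rfl
    rw [this, map_smul, smul_eq_mul, mul_comm]
  · have := integral_map (hYm s) (f := fun x : ℝ => x) (by fun_prop)
    rw [← this, (hlaw s).1, integral_id_gaussianReal]
  -- the covariance, from the variance of `Y s + Y t`
  · have h2 := key (fun i : Fin 2 => if i = 0 then s else t) (fun _ => 1)
    simp only [Fin.sum_univ_two, one_mul, if_true, one_ne_zero, if_false] at h2
    have h3 : Var[fun ω => Y s ω + Y t ω; P] = C s s + C s t + (C t s + C t t) := by
      have h5 : AEMeasurable (fun ω => Y s ω + Y t ω) P := (hYm s).add (hYm t)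
      rw [← variance_id_map h5, h2.1, variance_id_gaussianReal,
        Real.coe_toNNReal _ h2.2]
    have h4 := variance_add (hGL s).memLp_two (hGL t).memLp_two
    have hsymm : C t s = C s t := tendsto_nhds_unique (hcov t s)
      ((hcov s t).congr fun N => covariance_comm _ _)
    rw [hvarY, hvarY] at h4
    change Var[fun ω => Y s ω + Y t ω; P] = _ at h4
    rw [h3, hsymm] at h4
    linarith

end GaussianLimit

/-! ### Wiener integrals of continuously differentiable functions -/

section Wiener

variable {Ω : Type*} [MeasurableSpace Ω] {P : Measure Ω} {B : ℝ≥0 → Ω → ℝ}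

/-- The path of `B` on `[0,1]`. -/
def pathOf (B : ℝ≥0 → Ω → ℝ) (ω : Ω) (t : unitInterval) : ℝ := B (unitInterval.toNNReal t) ω

/-- The Wiener integral `∫_0^1 g dB`. -/
noncomputable def wiener (B : ℝ≥0 → Ω → ℝ) (g : ℝ → ℝ) (ω : Ω) : ℝ :=
  pathIntegral g (pathOf B ω)

/-- The Wiener integrals together with the path itself, as one process. -/
noncomputable def wienerProcess (B : ℝ≥0 → Ω → ℝ) :
    {g : ℝ → ℝ // ContDiffOn ℝ 1 g (Icc 0 1)} ⊕ unitInterval → Ω → ℝ :=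
  Sum.elim (fun g => wiener B g.1) (fun t ω => pathOf B ω t)

/-- The covariance of `wienerProcess`. -/
noncomputable def wienerCov :
    {g : ℝ → ℝ // ContDiffOn ℝ 1 g (Icc 0 1)} ⊕ unitInterval →
    {g : ℝ → ℝ // ContDiffOn ℝ 1 g (Icc 0 1)} ⊕ unitInterval → ℝ
  | Sum.inl g, Sum.inl h => ∫ x in Icc (0 : ℝ) 1, g.1 x * h.1 x
  | Sum.inl g, Sum.inr t => ∫ x in (0 : ℝ)..t, g.1 x
  | Sum.inr t, Sum.inl g => ∫ x in (0 : ℝ)..t, g.1 x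
  | Sum.inr s, Sum.inr t => min (s : ℝ) t

/-- The Riemann–Stieltjes sums approximating `∫_0^1 g dB`. -/
noncomputable def incrementSum (B : ℝ≥0 → Ω → ℝ) (g : ℝ → ℝ) (N : ℕ) (ω : Ω) : ℝ :=
  ∑ i : Fin N, g ((i : ℕ) / N) * (B (((i : ℕ) + 1 : ℕ) / N) ω - B ((i : ℕ) / N) ω)

omit [MeasurableSpace Ω] in
lemma continuous_pathOf {ω : Ω} (hω : Continuous (B · ω)) : Continuous (pathOf B ω) :=
  hω.comp unitInterval.toNNReal_continuous

omit [MeasurableSpace Ω] in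
lemma tendsto_incrementSum {g : ℝ → ℝ} (hg : ContDiffOn ℝ 1 g (Icc 0 1)) {ω : Ω}
    (hω : Continuous (B · ω)) :
    Tendsto (fun N => incrementSum B g N ω) atTop (nhds (wiener B g ω)) := by
  have hb : Continuous fun x : ℝ => B x.toNNReal ω := hω.comp continuous_real_toNNReal
  have hz : ∀ t : unitInterval, pathOf B ω t = B (t : ℝ).toNNReal ω := fun t => by
    unfold pathOf
    congr 1
    ext
    simp [t.2.1]
  refine (tendsto_sum_increments hg hb.continuousOn hz).congr fun N => ?_
  rw [Finset.sum_range]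
  unfold incrementSum
  refine Finset.sum_congr rfl fun i _ => ?_
  have e1 : ∀ m : ℕ, ((m : ℝ) / N).toNNReal = (m : ℝ≥0) / N := fun m => by
    rw [Real.toNNReal_div' (by positivity)]; simp
  rw [e1, e1]

lemma memLp_brownian (hB : IsPreBrownianReal B P) (t : ℝ≥0) : MemLp (B t) 2 P :=
  (hB.isGaussianProcess.hasGaussianLaw_eval t).memLp_two

lemma memLp_smul_increment (hB : IsPreBrownianReal B P) (c : ℝ) (a b : ℝ≥0) :
    MemLp (fun ω => c * (B b ω - B a ω)) 2 P :=
  ((memLp_brownian hB b).sub (memLp_brownian hB a)).const_mul c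

/-- The overlap of a grid cell with `[0,t]`. -/
lemma min_sub_min_eq_integral {a b t : ℝ} (hab : a ≤ b) :
    min b t - min a t = ∫ x in a..b, (Iic t).indicator (fun _ => (1 : ℝ)) x := by
  rw [intervalIntegral.integral_of_le hab, setIntegral_indicator measurableSet_Iic,
    Ioc_inter_Iic]
  simp only [integral_const, smul_eq_mul, mul_one, measureReal_restrict_apply_univ,
    Real.volume_real_Ioc]
  rcases le_total a t with h | h
  · rw [max_eq_left (by simp [hab, h]), min_eq_left h]
  · rw [max_eq_right (by simp [h]), min_eq_right h, min_eq_right (h.trans hab), sub_self]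

/-- Riemann–Stieltjes sums of `g` against `min · t`, the covariance function of `B`. -/
lemma tendsto_sum_min {g : ℝ → ℝ} (hg : ContinuousOn g (Icc 0 1)) {t : ℝ}
    (ht : t ∈ Icc (0 : ℝ) 1) :
    Tendsto (fun N : ℕ => ∑ i ∈ Finset.range N,
        g ((i : ℝ) / N) * (min (((i + 1 : ℕ) : ℝ) / N) t - min ((i : ℝ) / N) t))
      atTop (nhds (∫ x in (0 : ℝ)..t, g x)) := by
  have h1 : IntegrableOn ((Iic t).indicator fun _ => (1 : ℝ)) (Icc 0 1) :=
    (integrableOn_const (by simp)).indicator measurableSet_Iic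
  have h := tendsto_tagged_sum (K := 1) hg h1 (fun x _ => by
    by_cases hx : x ∈ Iic t <;> simp [hx])
    (τ := fun N i => (i : ℝ) / N) (fun N i hi => ⟨le_rfl, (grid_le hi).2.1⟩)
  have e : ∫ x in (0 : ℝ)..1, g x * (Iic t).indicator (fun _ => (1 : ℝ)) x
      = ∫ x in (0 : ℝ)..t, g x := by
    have e1 : ∀ x, g x * (Iic t).indicator (fun _ => (1 : ℝ)) x = (Iic t).indicator g x :=
      fun x => by by_cases hx : x ∈ Iic t <;> simp [hx]
    simp_rw [e1]
    rw [intervalIntegral.integral_of_le zero_le_one, setIntegral_indicator measurableSet_Iic,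
      Ioc_inter_Iic, min_eq_right ht.2, intervalIntegral.integral_of_le ht.1]
  rw [e] at h
  refine h.congr fun N => Finset.sum_congr rfl fun i hi => ?_
  rw [min_sub_min_eq_integral (grid_le (Finset.mem_range.1 hi)).2.1]

lemma covariance_increment [IsProbabilityMeasure P] (hB : IsPreBrownianReal B P)
    (a b t : ℝ≥0) : cov[fun ω => B b ω - B a ω, B t; P] = min (b : ℝ) t - min (a : ℝ) t := by
  rw [covariance_fun_sub_left (memLp_brownian hB b) (memLp_brownian hB a)
    (memLp_brownian hB t), hB.covariance_eval, hB.covariance_eval]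
  simp

lemma covariance_incrementSum [IsProbabilityMeasure P] (hB : IsPreBrownianReal B P) (g : ℝ → ℝ)
    (N : ℕ) (t : ℝ≥0) :
    cov[incrementSum B g N, B t; P] = ∑ i ∈ Finset.range N,
      g ((i : ℝ) / N) * (min (((i + 1 : ℕ) : ℝ) / N) t - min ((i : ℝ) / N) t) := by
  unfold incrementSum
  rw [covariance_fun_sum_left (fun i => memLp_smul_increment hB _ _ _)
    (memLp_brownian hB t), Finset.sum_range]
  refine Finset.sum_congr rfl fun i _ => ?_
  rw [covariance_const_mul_left]
  congr 1
  exact (covariance_increment hB _ _ t).trans (by simp)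

lemma memLp_incrementSum (hB : IsPreBrownianReal B P) (g : ℝ → ℝ) (N : ℕ) :
    MemLp (incrementSum B g N) 2 P :=
  memLp_finsetSum _ fun _ _ => memLp_smul_increment hB _ _ _

lemma covariance_incrementSum_incrementSum [IsProbabilityMeasure P] (hB : IsPreBrownianReal B P)
    (g h : ℝ → ℝ) (N : ℕ) :
    cov[incrementSum B g N, incrementSum B h N; P] = ∑ i ∈ Finset.range N,
      (g ((i : ℝ) / N) * h ((i : ℝ) / N)) *
        (min (((i + 1 : ℕ) : ℝ) / N) 1 - min ((i : ℝ) / N) 1) := by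
  rw [covariance_comm]
  have e : cov[incrementSum B h N, incrementSum B g N; P] = ∑ i ∈ Finset.range N,
      h ((i : ℝ) / N) * (cov[B (((i + 1 : ℕ) : ℝ≥0) / N), incrementSum B g N; P]
        - cov[B ((i : ℝ≥0) / N), incrementSum B g N; P]) := by
    conv_lhs => enter [1]; unfold incrementSum
    rw [covariance_fun_sum_left (fun i => memLp_smul_increment hB _ _ _)
      (memLp_incrementSum hB g N), Finset.sum_range]
    refine Finset.sum_congr rfl fun i _ => ?_
    rw [covariance_const_mul_left]
    congr 1
    exact covariance_fun_sub_left (memLp_brownian hB _) (memLp_brownian hB _)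
      (memLp_incrementSum hB g N)
  rw [e]
  refine Finset.sum_congr rfl fun i hi => ?_
  have hi' := Finset.mem_range.1 hi
  have hN : (0 : ℝ) < N := by exact_mod_cast (Nat.zero_le i).trans_lt hi'
  -- increments over different grid cells are uncorrelated: only the term `l = i` survives
  rw [covariance_comm, covariance_incrementSum hB, covariance_comm, covariance_incrementSum hB,
    ← Finset.sum_sub_distrib, Finset.sum_eq_single i]
  · have h3 := (grid_le hi').2.2
    have h2 := (grid_le hi').2.1
    push_cast at h2 h3 ⊢
    rw [min_self, min_eq_left h2, min_eq_right h2, min_self, min_eq_left h3,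
      min_eq_left (h2.trans h3)]
    ring
  · intro l hl hne
    push_cast
    have hmono : ∀ {a b : ℝ}, a ≤ b → a / N ≤ b / N := fun hab => by gcongr
    rcases Nat.lt_or_gt_of_ne hne with hlt | hlt
    · have h1 : (l : ℝ) + 1 ≤ i := by exact_mod_cast hlt
      have h2 := hmono h1
      have h3 := hmono (show (i : ℝ) ≤ i + 1 by linarith)
      have h4 := hmono (show (l : ℝ) ≤ l + 1 by linarith)
      rw [min_eq_left h2, min_eq_left (h4.trans h2), min_eq_left (h2.trans h3),
        min_eq_left (h4.trans (h2.trans h3))]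
      ring
    · have h1 : (i : ℝ) + 1 ≤ l := by exact_mod_cast hlt
      have h2 := hmono h1
      have h3 := hmono (show (i : ℝ) ≤ i + 1 by linarith)
      have h4 := hmono (show (l : ℝ) ≤ l + 1 by linarith)
      rw [min_eq_right h2, min_eq_right (h2.trans h4), min_eq_right (h3.trans h2),
        min_eq_right (h3.trans (h2.trans h4))]
      ring
  · exact fun h => absurd hi h

/-- Wiener integrals of `C¹` functions and the Brownian path are jointly Gaussian and centred,
with `Cov(∫g dB, ∫h dB) = ∫gh` and `Cov(∫g dB, B_t) = ∫_0^t g`. -/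
theorem wienerProcess_gaussian (hB : IsBrownianReal B P) :
    IsGaussianProcess (wienerProcess B) P ∧ (∀ s, ∫ ω, wienerProcess B s ω ∂P = 0) ∧
      ∀ s t, cov[wienerProcess B s, wienerProcess B t; P] = wienerCov s t := by
  classical
  have hP : IsProbabilityMeasure P := hB.isGaussianProcess.isProbabilityMeasure
  have hB' := hB.toIsPreBrownianReal
  refine gaussianProcess_of_tendsto
    (Z := fun N => Sum.elim (fun g => incrementSum B g.1 N)
      (fun t => B (unitInterval.toNNReal t))) (fun N => ?_) (fun N s => ?_) (fun s => ?_)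
      (fun s t => ?_)
  · refine hB.isGaussianProcess.of_isGaussianProcess fun s => ?_
    rcases s with g | t
    · refine ⟨(Finset.range (N + 1)).image fun i : ℕ => (i : ℝ≥0) / N,
        ∑ i : Fin N, g.1 ((i : ℕ) / N) • (ContinuousLinearMap.proj
          (⟨(((i : ℕ) + 1 : ℕ) : ℝ≥0) / N, Finset.mem_image.2 ⟨i + 1, by
            have := i.2; simp, rfl⟩⟩)
          - ContinuousLinearMap.proj
          (⟨((i : ℕ) : ℝ≥0) / N, Finset.mem_image.2 ⟨i, by
            have := i.2; simp, rfl⟩⟩)), fun ω => ?_⟩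
      simp [incrementSum]
    · exact ⟨{unitInterval.toNNReal t}, ContinuousLinearMap.proj ⟨unitInterval.toNNReal t, by simp⟩,
        fun ω => by simp⟩
  · rcases s with g | t
    · simp only [Sum.elim_inl, incrementSum]
      rw [integral_finsetSum]
      · refine Finset.sum_eq_zero fun i _ => ?_
        rw [integral_const_mul, integral_sub (hB'.integrable_eval _) (hB'.integrable_eval _),
          hB'.integral_eval, hB'.integral_eval, sub_self, mul_zero]
      · intro i _
        exact ((hB'.integrable_eval _).sub (hB'.integrable_eval _)).const_mul _
    · exact hB'.integral_eval _
  · rcases s with g | t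
    · filter_upwards [hB.cont] with ω hω
      exact tendsto_incrementSum g.2 hω
    · exact ae_of_all _ fun ω => tendsto_const_nhds
  · rcases s with g | s <;> rcases t with h | t
    · simp only [Sum.elim_inl, wienerCov, covariance_incrementSum_incrementSum hB']
      rw [integral_Icc_eq_integral_Ioc, ← intervalIntegral.integral_of_le zero_le_one]
      exact tendsto_sum_min (g.2.continuousOn.mul h.2.continuousOn) (t := 1) (by simp)
    · simp only [Sum.elim_inl, Sum.elim_inr, wienerCov, covariance_incrementSum hB']
      exact tendsto_sum_min g.2.continuousOn t.2
    · simp only [Sum.elim_inl, Sum.elim_inr, wienerCov]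
      simp_rw [covariance_comm (B _), covariance_incrementSum hB']
      exact tendsto_sum_min h.2.continuousOn s.2
    · simp only [Sum.elim_inr, wienerCov, hB'.covariance_eval]
      simp

lemma hasGaussianLaw_wiener (hB : IsBrownianReal B P) {g : ℝ → ℝ}
    (hg : ContDiffOn ℝ 1 g (Icc 0 1)) : HasGaussianLaw (wiener B g) P :=
  (wienerProcess_gaussian hB).1.hasGaussianLaw_eval (Sum.inl ⟨g, hg⟩)

lemma map_wiener (hB : IsBrownianReal B P) {g : ℝ → ℝ} (hg : ContDiffOn ℝ 1 g (Icc 0 1)) :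
    P.map (wiener B g) = gaussianReal 0 (∫ x in Icc (0 : ℝ) 1, g x ^ 2).toNNReal := by
  obtain ⟨h1, h2, h3⟩ := wienerProcess_gaussian hB
  have hG := hasGaussianLaw_wiener hB hg
  rw [hG.map_eq_gaussianReal]
  congr 1
  · exact h2 (Sum.inl ⟨g, hg⟩)
  · rw [← covariance_self hG.aemeasurable]
    have := h3 (Sum.inl ⟨g, hg⟩) (Sum.inl ⟨g, hg⟩)
    simp only [wienerProcess, Sum.elim_inl, wienerCov] at this
    simp_rw [this, sq]

/-- Wiener integrals of orthogonal functions are independent. -/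
lemma iIndepFun_wiener (hB : IsBrownianReal B P) {ι : Type} [Finite ι] {g : ι → ℝ → ℝ}
    (hg : ∀ i, ContDiffOn ℝ 1 (g i) (Icc 0 1))
    (ho : ∀ i i', i ≠ i' → ∫ x in Icc (0 : ℝ) 1, g i x * g i' x = 0) :
    iIndepFun (fun i => wiener B (g i)) P := by
  obtain ⟨h1, h2, h3⟩ := wienerProcess_gaussian hB
  have hGP : IsGaussianProcess (fun i => wiener B (g i)) P :=
    h1.comp_right fun i => Sum.inl ⟨g i, hg i⟩
  have := Fintype.ofFinite ι
  have hGL : HasGaussianLaw (fun ω i => wiener B (g i) ω) P := by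
    have hu := hGP.hasGaussianLaw Finset.univ
    exact hu.map (ContinuousLinearMap.pi fun i : ι =>
      ContinuousLinearMap.proj (⟨i, Finset.mem_univ i⟩ : (Finset.univ : Finset ι)))
  refine hGL.iIndepFun_of_covariance_eq_zero fun i i' hne => ?_
  exact (h3 (Sum.inl ⟨g i, hg i⟩) (Sum.inl ⟨g i', hg i'⟩)).trans (ho i i' hne)

end Wiener

/-! ### Deterministic shrinkage inequalities -/

section Shrink

variable {E : Type*} [NormedAddCommGroup E] [NormedSpace ℝ E]

/-- James–Stein shrinkage is at most twice the excess of `‖y‖` over the threshold `√T`. At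
`y = 0` the quotient is a junk value, but the shrunken vector is `0` all the same. -/
lemma norm_shrink_le {T : ℝ} (hT : 0 ≤ T) (y : E) :
    ‖max (1 - T / ‖y‖ ^ 2) 0 • y‖ ≤ 2 * max (‖y‖ - √T) 0 := by
  rw [norm_smul, Real.norm_of_nonneg (le_max_right _ _)]
  rcases (norm_nonneg y).eq_or_lt with h | h
  · rw [← h]; simp
  · have hsq := Real.sq_sqrt hT
    have hs := Real.sqrt_nonneg T
    rw [max_mul_of_nonneg _ _ h.le, zero_mul]
    refine max_le ?_ (by positivity)
    have e : (1 - T / ‖y‖ ^ 2) * ‖y‖ = (‖y‖ - √T) * (1 + √T / ‖y‖) := by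
      field_simp
      nlinarith
    rw [e]
    rcases le_total (√T) ‖y‖ with h1 | h1
    · rw [max_eq_left (by linarith)]
      have : √T / ‖y‖ ≤ 1 := (div_le_one h).2 h1
      nlinarith
    · rw [max_eq_right (by linarith), mul_zero]
      exact mul_nonpos_of_nonpos_of_nonneg (by linarith) (by positivity)

/-- Shrinkage loses at most a multiple of the signal plus the noise above the threshold. -/
lemma norm_shrink_sub_le_signal {T : ℝ} (hT : 0 ≤ T) (θ z : E) :
    ‖max (1 - T / ‖θ + z‖ ^ 2) 0 • (θ + z) - θ‖ ≤ 3 * ‖θ‖ + 2 * max (‖z‖ - √T) 0 := by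
  have h1 := norm_shrink_le hT (θ + z)
  have h2 : max (‖θ + z‖ - √T) 0 ≤ ‖θ‖ + max (‖z‖ - √T) 0 := by
    refine max_le ?_ (by positivity)
    have := norm_add_le θ z
    have := le_max_left (‖z‖ - √T) 0
    linarith
  have := norm_sub_le (max (1 - T / ‖θ + z‖ ^ 2) 0 • (θ + z)) θ
  linarith

/-- Shrinkage moves an observation by at most the threshold. -/
lemma norm_shrink_sub_le_threshold {T : ℝ} (hT : 0 ≤ T) (θ z : E) :
    ‖max (1 - T / ‖θ + z‖ ^ 2) 0 • (θ + z) - θ‖ ≤ √T + ‖z‖ := by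
  set y := θ + z with hy
  have h1 : ‖max (1 - T / ‖y‖ ^ 2) 0 • y - y‖ ≤ √T := by
    rcases (norm_nonneg y).eq_or_lt with h | h
    · rw [norm_eq_zero.1 h.symm]; simp
    · have hsq := Real.sq_sqrt hT
      have hs := Real.sqrt_nonneg T
      have e : max (1 - T / ‖y‖ ^ 2) 0 • y - y = (max (1 - T / ‖y‖ ^ 2) 0 - 1) • y := by
        rw [sub_smul, one_smul]
      rw [e, norm_smul, Real.norm_eq_abs]
      rcases le_total T (‖y‖ ^ 2) with h2 | h2
      · have h3 : T / ‖y‖ ^ 2 ≤ 1 := (div_le_one (by positivity)).2 h2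
        rw [max_eq_left (by linarith), abs_sub_comm, sub_sub_cancel,
          abs_of_nonneg (by positivity)]
        have h4 : √T ≤ ‖y‖ := Real.sqrt_le_iff.2 ⟨h.le, h2⟩
        rw [div_mul_eq_mul_div, div_le_iff₀ (by positivity)]
        calc T * ‖y‖ = √T * (√T * ‖y‖) := by rw [← mul_assoc, ← sq, hsq]
          _ ≤ √T * (‖y‖ * ‖y‖) := by gcongr
          _ = √T * ‖y‖ ^ 2 := by ring
      · have h3 : 1 ≤ T / ‖y‖ ^ 2 := (one_le_div (by positivity)).2 h2
        rw [max_eq_right (by linarith)]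
        simpa using Real.le_sqrt_of_sq_le h2
  have h2 : max (1 - T / ‖y‖ ^ 2) 0 • y - θ = (max (1 - T / ‖y‖ ^ 2) 0 • y - y) + z := by
    rw [hy]; abel
  rw [h2]
  exact (norm_add_le _ _).trans (by linarith)

/-- The two bounds for the squared error of James–Stein shrinkage: one is small when the signal `θ`
is, the other does not depend on the signal. -/
lemma norm_shrink_sub_sq_le {T : ℝ} (hT : 0 ≤ T) (θ z : E) :
    ‖max (1 - T / ‖θ + z‖ ^ 2) 0 • (θ + z) - θ‖ ^ 2
      ≤ 18 * ‖θ‖ ^ 2 + 8 * max (‖z‖ ^ 2 - T) 0 ∧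
    ‖max (1 - T / ‖θ + z‖ ^ 2) 0 • (θ + z) - θ‖ ^ 2 ≤ 2 * T + 2 * ‖z‖ ^ 2 := by
  have h1 := norm_shrink_sub_le_signal hT θ z
  have h2 := norm_shrink_sub_le_threshold hT θ z
  have n0 := norm_nonneg (max (1 - T / ‖θ + z‖ ^ 2) 0 • (θ + z) - θ)
  set a := ‖max (1 - T / ‖θ + z‖ ^ 2) 0 • (θ + z) - θ‖
  have hsq := Real.sq_sqrt hT
  have hs := Real.sqrt_nonneg T
  have n1 := norm_nonneg z
  have n2 := norm_nonneg θ
  constructor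
  · have h3 : max (‖z‖ - √T) 0 ^ 2 ≤ max (‖z‖ ^ 2 - T) 0 := by
      rcases le_total (‖z‖) (√T) with h | h
      · rw [max_eq_right (by linarith)]; simp
      · rw [max_eq_left (by linarith)]
        refine le_trans ?_ (le_max_left _ _)
        nlinarith [mul_le_mul_of_nonneg_left h hs]
    calc a ^ 2 ≤ (3 * ‖θ‖ + 2 * max (‖z‖ - √T) 0) ^ 2 := by gcongr
      _ ≤ 18 * ‖θ‖ ^ 2 + 8 * max (‖z‖ - √T) 0 ^ 2 := by
        nlinarith [sq_nonneg (3 * ‖θ‖ - 2 * max (‖z‖ - √T) 0)]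
      _ ≤ _ := by gcongr
  · calc a ^ 2 ≤ (√T + ‖z‖) ^ 2 := by gcongr
      _ ≤ _ := by nlinarith [sq_nonneg (√T - ‖z‖)]

end Shrink

/-- `norm_shrink_sub_sq_le` in coordinates. -/
lemma sum_shrink_sub_sq_le {ι : Type*} (F : Finset ι) {T : ℝ} (hT : 0 ≤ T) (θ z : ι → ℝ) :
    ∑ p ∈ F, (max (1 - T / ∑ q ∈ F, (θ q + z q) ^ 2) 0 * (θ p + z p) - θ p) ^ 2
      ≤ 18 * ∑ p ∈ F, θ p ^ 2 + 8 * max (∑ p ∈ F, z p ^ 2 - T) 0 ∧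
    ∑ p ∈ F, (max (1 - T / ∑ q ∈ F, (θ q + z q) ^ 2) 0 * (θ p + z p) - θ p) ^ 2
      ≤ 2 * T + 2 * ∑ p ∈ F, z p ^ 2 := by
  have h := norm_shrink_sub_sq_le hT (WithLp.toLp 2 fun p : F => θ p : EuclideanSpace ℝ F)
    (WithLp.toLp 2 fun p : F => z p)
  simp only [EuclideanSpace.real_norm_sq_eq, PiLp.sub_apply, PiLp.add_apply, PiLp.smul_apply,
    smul_eq_mul] at h
  simp only [← Finset.sum_coe_sort F]
  exact h

lemma abs_sign_mul_max {y t : ℝ} (ht : 0 ≤ t) :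
    |(SignType.sign y : ℝ) * max (|y| - t) 0| = max (|y| - t) 0 := by
  rcases eq_or_ne y 0 with rfl | hy
  · simp [ht]
  · rw [abs_mul, abs_of_nonneg (le_max_right (|y| - t) 0)]
    rcases lt_or_gt_of_ne hy with h | h
    · simp [sign_neg h]
    · simp [sign_pos h]

lemma abs_sign_mul_max_sub_le {y t : ℝ} (ht : 0 ≤ t) :
    |(SignType.sign y : ℝ) * max (|y| - t) 0 - y| ≤ t := by
  rcases lt_trichotomy y 0 with h | rfl | h
  · rw [sign_neg h, abs_of_neg h, SignType.coe_neg_one]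
    rcases le_total (-y) t with h1 | h1
    · rw [max_eq_right (by linarith), abs_le]; constructor <;> linarith
    · rw [max_eq_left (by linarith), abs_le]; constructor <;> linarith
  · simp [ht]
  · rw [sign_pos h, abs_of_pos h, SignType.coe_one]
    rcases le_total y t with h1 | h1
    · rw [max_eq_right (by linarith), abs_le]; constructor <;> linarith
    · rw [max_eq_left (by linarith), abs_le]; constructor <;> linarith

/-- The two bounds for the squared error of soft thresholding, in the pattern of
`norm_shrink_sub_sq_le`. -/
lemma soft_sq_le {t : ℝ} (ht : 0 ≤ t) (θ z : ℝ) :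
    ((SignType.sign (θ + z) : ℝ) * max (|θ + z| - t) 0 - θ) ^ 2
      ≤ 8 * θ ^ 2 + 2 * max (|z| - t) 0 ^ 2 ∧
    ((SignType.sign (θ + z) : ℝ) * max (|θ + z| - t) 0 - θ) ^ 2 ≤ 2 * t ^ 2 + 2 * z ^ 2 := by
  set s := (SignType.sign (θ + z) : ℝ) * max (|θ + z| - t) 0 with hs
  have h1 : |s| ≤ |θ| + max (|z| - t) 0 := by
    rw [hs, abs_sign_mul_max ht]
    refine max_le ?_ (by positivity)
    have := abs_add_le θ z
    have := le_max_left (|z| - t) 0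
    linarith
  have h2 : |s - (θ + z)| ≤ t := abs_sign_mul_max_sub_le ht
  rw [← sq_abs (s - θ), ← sq_abs θ, ← sq_abs z]
  have hm : 0 ≤ max (|z| - t) 0 := le_max_right _ _
  constructor
  · have h3 : |s - θ| ≤ 2 * |θ| + max (|z| - t) 0 := by
      have := abs_sub s θ
      linarith
    calc |s - θ| ^ 2 ≤ (2 * |θ| + max (|z| - t) 0) ^ 2 := by gcongr
      _ ≤ _ := by nlinarith [sq_nonneg (2 * |θ| - max (|z| - t) 0)]
  · have h3 : |s - θ| ≤ t + |z| := by
      have e : s - θ = (s - (θ + z)) + z := by ring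
      rw [e]
      exact (abs_add_le _ _).trans (by linarith)
    calc |s - θ| ^ 2 ≤ (t + |z|) ^ 2 := by gcongr
      _ ≤ _ := by nlinarith [sq_nonneg (t - |z|)]

/-! ### Upper expectations -/

section UpperExp

variable {Ω : Type*} [MeasurableSpace Ω] {P : Measure Ω}

/-- The upper expectation of `h` is at most `b`: an integrable majorant has integral at most `b`.
No measurability of `h` is asked for, so that the error of the estimator can be handled without
a discussion of its measurability in `ω`. -/
def UpperExpLE (P : Measure Ω) (h : Ω → ℝ) (b : ℝ) : Prop :=
  ∃ g, Integrable g P ∧ h ≤ᵐ[P] g ∧ ∫ ω, g ω ∂P ≤ b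

namespace UpperExpLE

lemma mono {h h' : Ω → ℝ} {b b' : ℝ} (H : UpperExpLE P h b) (hh : h' ≤ᵐ[P] h) (hb : b ≤ b') :
    UpperExpLE P h' b' := by
  obtain ⟨g, h1, h2, h3⟩ := H
  exact ⟨g, h1, hh.trans h2, h3.trans hb⟩

lemma of_integrable {h : Ω → ℝ} {b : ℝ} (hh : Integrable h P) (hb : ∫ ω, h ω ∂P ≤ b) :
    UpperExpLE P h b := ⟨h, hh, EventuallyLE.refl _ _, hb⟩

lemma const [IsProbabilityMeasure P] (c : ℝ) : UpperExpLE P (fun _ => c) c :=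
  of_integrable (integrable_const _) (by simp)

lemma add {h h' : Ω → ℝ} {b b' : ℝ} (H : UpperExpLE P h b) (H' : UpperExpLE P h' b') :
    UpperExpLE P (fun ω => h ω + h' ω) (b + b') := by
  obtain ⟨g, h1, h2, h3⟩ := H
  obtain ⟨g', h1', h2', h3'⟩ := H'
  refine ⟨fun ω => g ω + g' ω, h1.add h1', ?_, ?_⟩
  · filter_upwards [h2, h2'] with ω a a' using add_le_add a a'
  · rw [integral_add h1 h1']
    exact add_le_add h3 h3'

lemma const_mul {h : Ω → ℝ} {b : ℝ} (H : UpperExpLE P h b) {c : ℝ} (hc : 0 ≤ c) :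
    UpperExpLE P (fun ω => c * h ω) (c * b) := by
  obtain ⟨g, h1, h2, h3⟩ := H
  refine ⟨fun ω => c * g ω, h1.const_mul c, ?_, ?_⟩
  · filter_upwards [h2] with ω a using mul_le_mul_of_nonneg_left a hc
  · rw [integral_const_mul]
    exact mul_le_mul_of_nonneg_left h3 hc

lemma sum {κ : Type*} (s : Finset κ) {h : κ → Ω → ℝ} {b : κ → ℝ}
    (H : ∀ i ∈ s, UpperExpLE P (h i) (b i)) :
    UpperExpLE P (fun ω => ∑ i ∈ s, h i ω) (∑ i ∈ s, b i) := by
  classical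
  induction s using Finset.induction_on with
  | empty => exact ⟨fun _ => 0, integrable_zero _ _ _, by simp [EventuallyLE], by simp⟩
  | insert i s hi ih =>
    simp_rw [Finset.sum_insert hi]
    exact (H i (Finset.mem_insert_self i s)).add
      (ih fun j hj => H j (Finset.mem_insert_of_mem hj))

lemma lintegral_le {h : Ω → ℝ} {b : ℝ} (H : UpperExpLE P h b) (h0 : ∀ ω, 0 ≤ h ω) :
    ∫⁻ ω, ENNReal.ofReal (h ω) ∂P ≤ ENNReal.ofReal b := by
  obtain ⟨g, h1, h2, h3⟩ := H
  calc ∫⁻ ω, ENNReal.ofReal (h ω) ∂P ≤ ∫⁻ ω, ENNReal.ofReal (g ω) ∂P :=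
        lintegral_mono_ae (h2.mono fun ω h => ENNReal.ofReal_le_ofReal h)
    _ = ENNReal.ofReal (∫ ω, g ω ∂P) :=
        (ofReal_integral_eq_lintegral_ofReal h1 (h2.mono fun ω h => (h0 ω).trans h)).symm
    _ ≤ _ := ENNReal.ofReal_le_ofReal h3

/-- Minkowski's inequality for a weighted sum of random variables whose second moments are at
most `τ i ^ 2`. -/
lemma weighted_sum_sq {κ : Type*} (s : Finset κ) {d : κ → Ω → ℝ} {w τ : κ → ℝ}
    (hw : ∀ i ∈ s, 0 ≤ w i) (hτ : ∀ i ∈ s, 0 < τ i)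
    (H : ∀ i ∈ s, UpperExpLE P (fun ω => d i ω ^ 2) (τ i ^ 2)) :
    UpperExpLE P (fun ω => (∑ i ∈ s, w i * |d i ω|) ^ 2) ((∑ i ∈ s, w i * τ i) ^ 2) := by
  have h1 : UpperExpLE P (fun ω => (∑ i ∈ s, w i * τ i) * ∑ i ∈ s, w i / τ i * d i ω ^ 2)
      ((∑ i ∈ s, w i * τ i) * ∑ i ∈ s, w i / τ i * τ i ^ 2) :=
    (sum s fun i hi => (H i hi).const_mul (div_nonneg (hw i hi) (hτ i hi).le)).const_mul
      (Finset.sum_nonneg fun i hi => mul_nonneg (hw i hi) (hτ i hi).le)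
  refine h1.mono (ae_of_all _ fun ω => ?_) (le_of_eq ?_)
  · refine Finset.sum_sq_le_sum_mul_sum_of_sq_le_mul s
      (fun i hi => mul_nonneg (hw i hi) (hτ i hi).le)
      (fun i hi => mul_nonneg (div_nonneg (hw i hi) (hτ i hi).le) (sq_nonneg _))
      (fun i hi => le_of_eq ?_)
    have := (hτ i hi).ne'
    rw [mul_pow, sq_abs]
    field_simp
  · rw [sq]
    congr 1
    refine Finset.sum_congr rfl fun i hi => ?_
    have := (hτ i hi).ne'
    field_simp

end UpperExpLE

/-! ### Gaussian tail expectations -/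

lemma integral_sq_of_map_eq {ξ : Ω → ℝ} (hξ : P.map ξ = gaussianReal 0 1) :
    Integrable (fun ω => ξ ω ^ 2) P ∧ ∫ ω, ξ ω ^ 2 ∂P = 1 := by
  have hG : HasGaussianLaw ξ P := ⟨by rw [hξ]; infer_instance⟩
  have := hG.isProbabilityMeasure
  refine ⟨hG.memLp_two.integrable_sq, ?_⟩
  have h1 : ∫ ω, ξ ω ∂P = 0 := by
    rw [← integral_map (f := fun x : ℝ => x) hG.aemeasurable (by fun_prop), hξ,
      integral_id_gaussianReal]
  have h2 : Var[ξ; P] = 1 := by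
    rw [← variance_id_map hG.aemeasurable, hξ, variance_id_gaussianReal]; simp
  rw [← h2, variance_of_integral_eq_zero hG.aemeasurable h1]

/-- Second moment of the excess of a standard Gaussian over `t`: the square is dominated by
`exp (t (|ξ| - t))`, whose expectation is explicit. -/
lemma upperExp_excess_sq {ξ : Ω → ℝ} (hξ : P.map ξ = gaussianReal 0 1) {t : ℝ} (ht : 0 < t) :
    UpperExpLE P (fun ω => max (|ξ ω| - t) 0 ^ 2) (4 / t ^ 2 * Real.exp (-(t ^ 2 / 2))) := by
  have hmgf : ∀ s : ℝ, mgf ξ P s = Real.exp (s ^ 2 / 2) := fun s => by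
    rw [mgf_gaussianReal hξ]; simp
  have hG : HasGaussianLaw ξ P := ⟨by rw [hξ]; infer_instance⟩
  have := hG.isProbabilityMeasure
  have hint : ∀ s : ℝ, Integrable (fun ω => Real.exp (s * ξ ω)) P := fun s => by
    rw [← mgf_pos_iff, hmgf]; exact Real.exp_pos _
  have h1 : UpperExpLE P (fun ω => 2 / t ^ 2 * Real.exp (-t ^ 2) *
      (Real.exp (t * ξ ω) + Real.exp (-t * ξ ω)))
      (2 / t ^ 2 * Real.exp (-t ^ 2) * (Real.exp (t ^ 2 / 2) + Real.exp ((-t) ^ 2 / 2))) :=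
    ((UpperExpLE.of_integrable (hint t) (hmgf t).le).add
      (UpperExpLE.of_integrable (hint (-t)) (hmgf (-t)).le)).const_mul (by positivity)
  refine h1.mono (ae_of_all _ fun ω => ?_) (le_of_eq ?_)
  · set u := max (|ξ ω| - t) 0 with hu
    have hu0 : 0 ≤ u := le_max_right _ _
    have h2 : Real.exp (t * |ξ ω|) ≤ Real.exp (t * ξ ω) + Real.exp (-t * ξ ω) := by
      rcases abs_cases (ξ ω) with ⟨h, -⟩ | ⟨h, -⟩ <;> rw [h]
      · linarith [Real.exp_pos (-t * ξ ω)]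
      · rw [show t * -ξ ω = -t * ξ ω by ring]
        linarith [Real.exp_pos (t * ξ ω)]
    change u ^ 2 ≤ 2 / t ^ 2 * Real.exp (-t ^ 2) * (Real.exp (t * ξ ω) + Real.exp (-t * ξ ω))
    rcases le_total (|ξ ω|) t with h | h
    · rw [hu, max_eq_right (by linarith)]
      simp only [ne_eq, OfNat.ofNat_ne_zero, not_false_eq_true, zero_pow]
      positivity
    · have hu' : u = |ξ ω| - t := max_eq_left (by linarith)
      have h3 : (t * u) ^ 2 / 2 ≤ Real.exp (t * u) := by
        have := Real.quadratic_le_exp_of_nonneg (mul_nonneg ht.le hu0)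
        nlinarith [mul_nonneg ht.le hu0]
      have h4 : Real.exp (t * u) = Real.exp (-t ^ 2) * Real.exp (t * |ξ ω|) := by
        rw [← Real.exp_add, hu']; congr 1; ring
      calc u ^ 2 = 2 / t ^ 2 * ((t * u) ^ 2 / 2) := by field_simp
        _ ≤ 2 / t ^ 2 * Real.exp (t * u) := by gcongr
        _ = 2 / t ^ 2 * Real.exp (-t ^ 2) * Real.exp (t * |ξ ω|) := by rw [h4]; ring
        _ ≤ _ := by gcongr
  · have h5 : Real.exp (-t ^ 2) * Real.exp (t ^ 2 / 2) = Real.exp (-(t ^ 2 / 2)) := by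
      rw [← Real.exp_add]; congr 1; ring
    rw [neg_sq, ← h5]
    ring

/-- The exponential moments of a `χ²` variable with one degree of freedom. -/
lemma mgf_sq_of_map_eq {ξ : Ω → ℝ} (hξ : P.map ξ = gaussianReal 0 1) {s : ℝ} (hs : s < 1 / 2) :
    mgf (fun ω => ξ ω ^ 2) P s = (√(1 - 2 * s))⁻¹ := by
  have hG : HasGaussianLaw ξ P := ⟨by rw [hξ]; infer_instance⟩
  have hb : 0 < 1 / 2 - s := by linarith
  unfold mgf
  have h1 : ∫ ω, Real.exp (s * ξ ω ^ 2) ∂P = ∫ x, Real.exp (s * x ^ 2) ∂gaussianReal 0 1 := by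
    rw [← hξ, integral_map hG.aemeasurable (by fun_prop)]
  have h2 : ∀ x : ℝ, gaussianPDFReal 0 1 x • Real.exp (s * x ^ 2)
      = (√(2 * Real.pi))⁻¹ * Real.exp (-(1 / 2 - s) * x ^ 2) := fun x => by
    rw [gaussianPDFReal_def, smul_eq_mul]
    simp only [NNReal.coe_one, mul_one, sub_zero]
    rw [mul_assoc, ← Real.exp_add]
    congr 2
    ring
  rw [h1, integral_gaussianReal_eq_integral_smul one_ne_zero]
  simp_rw [h2]
  rw [integral_const_mul, integral_gaussian, ← Real.sqrt_inv, ← Real.sqrt_mul (by positivity),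
    ← Real.sqrt_inv]
  congr 1
  have hpi := Real.pi_pos.ne'
  have : 1 - 2 * s ≠ 0 := by linarith
  field_simp

/-- Chernoff bound for the excess of a `χ²` variable over `lam * L`; the choice of `lam` makes the
exponential rate equal to one. -/
lemma upperExp_chiSq_excess {κ : Type*} [Fintype κ] {ξ : κ → Ω → ℝ}
    (hind : iIndepFun ξ P) (hξ : ∀ i, P.map (ξ i) = gaussianReal 0 1)
    {lam : ℝ} (hlam : 1 < lam) (hlam_eq : lam - Real.log lam - 1 = 2) {L : ℕ}
    (hL : Fintype.card κ ≤ L) :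
    UpperExpLE P (fun ω => max (∑ i, ξ i ω ^ 2 - lam * L) 0)
      (2 * lam / (lam - 1) * Real.exp (-(L : ℝ))) := by
  have hl0 : 0 < lam := by linarith
  -- the optimal exponent in Chernoff's bound: `E exp (s ξ²) = √lam` for this `s`
  set s : ℝ := (1 - 1 / lam) / 2 with hs
  have h1l : 1 / lam < 1 := (div_lt_one hl0).2 hlam
  have h1l' : 0 < 1 / lam := by positivity
  have hs0 : 0 < s := by rw [hs]; linarith
  have hs2 : s < 1 / 2 := by rw [hs]; linarith
  have hP := hind.isProbabilityMeasure
  have hm : ∀ i, AEMeasurable (ξ i) P := fun i =>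
    (⟨by rw [hξ i]; infer_instance⟩ : HasGaussianLaw (ξ i) P).aemeasurable
  have hind2 : iIndepFun (fun i ω => ξ i ω ^ 2) P :=
    hind.comp (fun _ x => x ^ 2) fun _ => by fun_prop
  have hmgf : mgf (∑ i, fun ω => ξ i ω ^ 2) P s = √lam ^ Fintype.card κ := by
    rw [hind2.mgf_sum₀ (fun i => (hm i).pow_const 2), Finset.prod_congr rfl fun i _ =>
      mgf_sq_of_map_eq (hξ i) hs2, Finset.prod_const, Finset.card_univ, ← Real.sqrt_inv]
    congr 2
    rw [hs]
    field_simp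
    ring
  have hint : Integrable (fun ω => Real.exp (s * (∑ i, fun ω => ξ i ω ^ 2) ω)) P := by
    rw [← mgf_pos_iff, hmgf]
    have := Real.sqrt_pos.2 hl0
    positivity
  have H := (UpperExpLE.of_integrable hint (b := √lam ^ L) (by
    rw [mgf] at hmgf
    rw [hmgf]
    exact pow_le_pow_right₀ (Real.one_le_sqrt.2 hlam.le) hL)).const_mul
    (c := 1 / s * Real.exp (-(s * (lam * L)))) (by positivity)
  refine H.mono (ae_of_all _ fun ω => ?_) (le_of_eq ?_)
  · simp only [Finset.sum_apply]
    set x := ∑ i, ξ i ω ^ 2 with hx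
    have e : 1 / s * Real.exp (-(s * (lam * L))) * Real.exp (s * x)
        = 1 / s * Real.exp (s * (x - lam * L)) := by
      rw [mul_assoc, ← Real.exp_add]; congr 2; ring
    rw [e]
    refine max_le ?_ (by positivity)
    have := Real.add_one_le_exp (s * (x - lam * L))
    calc x - lam * L = 1 / s * (s * (x - lam * L)) := by field_simp
      _ ≤ _ := by gcongr; linarith
  -- the exponent is `- L (lam - log lam - 1) / 2 = - L`
  · have h2 : √lam ^ L = Real.exp (L * (Real.log lam / 2)) := by
      rw [Real.exp_nat_mul, Real.exp_half, Real.exp_log hl0]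
    have h3 : 1 / s = 2 * lam / (lam - 1) := by
      have : lam - 1 ≠ 0 := by linarith
      rw [hs]; field_simp
    rw [h2, h3, mul_assoc, ← Real.exp_add]
    congr 2
    have h4 : s * lam = (lam - 1) / 2 := by rw [hs]; field_simp
    have h5 : Real.log lam = lam - 3 := by linarith
    rw [h5, ← mul_assoc, h4]
    ring

end UpperExp

/-! ### Counting wavelets near the window -/

lemma card_le_of_forall_mem_Icc {s : Finset ℕ} {u v : ℝ} (huv : 0 ≤ v - u)
    (h : ∀ k ∈ s, u ≤ (k : ℝ) ∧ (k : ℝ) ≤ v) : (s.card : ℝ) ≤ v - u + 1 := by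
  rcases s.eq_empty_or_nonempty with rfl | hne
  · simp; linarith
  · have hmin := h _ (s.min'_mem hne)
    have hmax := h _ (s.max'_mem hne)
    have hsub : s ⊆ Finset.Icc (s.min' hne) (s.max' hne) := fun k hk =>
      Finset.mem_Icc.2 ⟨s.min'_le k hk, s.le_max' k hk⟩
    have hle : s.min' hne ≤ s.max' hne := s.min'_le_max' hne
    have h1 := Finset.card_le_card hsub
    rw [Nat.card_Icc] at h1
    have h2 : (s.card : ℝ) ≤ (s.max' hne : ℝ) + 1 - s.min' hne := by
      have : s.card + s.min' hne ≤ s.max' hne + 1 := by omega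
      have : ((s.card + s.min' hne : ℕ) : ℝ) ≤ ((s.max' hne + 1 : ℕ) : ℝ) := by exact_mod_cast this
      push_cast at this
      linarith
    linarith [hmin.1, hmax.2]

lemma memLp_two_of_continuousOn {f : ℝ → ℝ} (hf : ContinuousOn f (Icc 0 1)) :
    MemLp f 2 (volume.restrict (Icc 0 1)) :=
  (memLp_two_iff_integrable_sq (hf.aestronglyMeasurable measurableSet_Icc)).2
    (hf.pow 2).integrableOn_Icc

namespace IntervalWaveletBasis

variable {r : ℕ} (W : IntervalWaveletBasis r)

lemma mem_nearIndices {x0 c : ℝ} {j : ℕ} {k : Fin (2 ^ j)} :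
    k ∈ W.nearIndices x0 c j ↔ (tsupport (W.mother j k) ∩ Icc (x0 - c) (x0 + c)).Nonempty := by
  simp [nearIndices]

lemma mem_nearIndices_of_ne_zero {x0 c : ℝ} {j : ℕ} {k : Fin (2 ^ j)} {x : ℝ}
    (hx : x ∈ Icc (x0 - c) (x0 + c)) (h : W.mother j k x ≠ 0) : k ∈ W.nearIndices x0 c j :=
  W.mem_nearIndices.2 ⟨x, subset_tsupport _ h, hx⟩

lemma nearIndices_bounds {x0 c : ℝ} {j : ℕ} (hj : W.j0 ≤ j) {k : Fin (2 ^ j)}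
    (hk : k ∈ W.nearIndices x0 c j) :
    2 ^ j * (x0 - c) - W.reach ≤ ((k : ℕ) : ℝ) ∧ ((k : ℕ) : ℝ) ≤ 2 ^ j * (x0 + c) + W.reach := by
  obtain ⟨x, hx, hxI⟩ := W.mem_nearIndices.1 hk
  have h1 := (W.mother_tsupport hj k hx).2
  rw [mem_ofPred_eq, abs_le] at h1
  have h2 : (0 : ℝ) < 2 ^ j := by positivity
  have h3 := mul_le_mul_of_nonneg_left hxI.1 h2.le
  have h4 := mul_le_mul_of_nonneg_left hxI.2 h2.le
  constructor <;> linarith [h1.1, h1.2]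

lemma card_nearIndices_le {x0 c : ℝ} (hc : 0 ≤ c) {j : ℕ} (hj : W.j0 ≤ j) :
    ((W.nearIndices x0 c j).card : ℝ) ≤ 2 * (2 ^ j * c) + 2 * W.reach + 1 := by
  have h0 := W.one_le_reach
  have h2 : (0 : ℝ) ≤ 2 ^ j * c := by positivity
  have hinj : Function.Injective (fun k : Fin (2 ^ j) => (k : ℕ)) := Fin.val_injective
  rw [← Finset.card_image_of_injective _ hinj]
  refine (card_le_of_forall_mem_Icc (u := 2 ^ j * (x0 - c) - W.reach)
    (v := 2 ^ j * (x0 + c) + W.reach) (by linarith) fun k hk => ?_).trans (by linarith)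
  obtain ⟨k', hk', rfl⟩ := Finset.mem_image.1 hk
  exact W.nearIndices_bounds hj hk'

/-- Number of horizontal blocks of length `L` with an index near the window. -/
lemma card_nearBlocks_le {x0 c : ℝ} (hc : 0 ≤ c) {j : ℕ} (hj : W.j0 ≤ j) {L : ℕ} (hL : 0 < L) :
    ((((W.nearIndices x0 c j).image fun k : Fin (2 ^ j) => (k : ℕ) / L).card : ℕ) : ℝ)
      ≤ (2 * (2 ^ j * c) + 2 * W.reach) / L + 2 := by
  have h0 := W.one_le_reach
  have h2 : (0 : ℝ) ≤ 2 ^ j * c := by positivity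
  have hL' : (0 : ℝ) < L := by exact_mod_cast hL
  have e : (2 ^ j * (x0 + c) + W.reach) / L - ((2 ^ j * (x0 - c) - W.reach) / L - 1) + 1
      = (2 * (2 ^ j * c) + 2 * W.reach) / L + 2 := by field_simp; ring
  refine (card_le_of_forall_mem_Icc (u := (2 ^ j * (x0 - c) - W.reach) / L - 1)
    (v := (2 ^ j * (x0 + c) + W.reach) / L) ?_ fun b hb => ?_).trans e.le
  · have : 0 ≤ (2 * (2 ^ j * c) + 2 * W.reach) / L := by positivity
    linarith
  · obtain ⟨k, hk, rfl⟩ := Finset.mem_image.1 hb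
    obtain ⟨h3, h4⟩ := W.nearIndices_bounds hj hk
    have h5 : (((k : ℕ) / L : ℕ) : ℝ) ≤ (k : ℕ) / L := Nat.cast_div_le
    have h6 : ((k : ℕ) : ℝ) / L ≤ (((k : ℕ) / L : ℕ) : ℝ) + 1 := by
      rw [div_le_iff₀ hL']
      have := Nat.div_add_mod (k : ℕ) L
      have h7 := Nat.mod_lt (k : ℕ) hL
      have h8 : (k : ℕ) ≤ ((k : ℕ) / L + 1) * L := by
        calc (k : ℕ) = L * ((k : ℕ) / L) + (k : ℕ) % L := this.symm
          _ ≤ L * ((k : ℕ) / L) + L := by omega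
          _ = _ := by ring
      exact_mod_cast h8
    have h9 : (2 ^ j * (x0 - c) - W.reach) / L ≤ ((k : ℕ) : ℝ) / L := by gcongr
    have h10 : ((k : ℕ) : ℝ) / L ≤ (2 ^ j * (x0 + c) + W.reach) / L := by gcongr
    constructor <;> linarith

lemma exists_mother_ne_zero : ∃ s : ℝ, W.ψ s ≠ 0 := by
  by_contra! h
  have := W.pair.basis.norm_one (Sum.inr (0, 0))
  simp [dilate, h] at this

/-- Interior translates already supply about `2^j · 2c` wavelets near the window. -/
lemma exists_card_nearIndices_ge {x0 : ℝ} (hx0 : x0 ∈ Ioo (0 : ℝ) 1) :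
    ∃ A : ℝ, ∀ (c : ℝ) (j : ℕ), 0 ≤ c → c ≤ x0 / 2 → c ≤ (1 - x0) / 2 → A ≤ (2 : ℝ) ^ j →
      2 ^ j * (2 * c) - 1 ≤ ((W.nearIndices x0 c j).card : ℝ) := by
  obtain ⟨s, hs⟩ := W.exists_mother_ne_zero
  have h1 : 0 < x0 := hx0.1
  have h2 : 0 < 1 - x0 := sub_pos.2 hx0.2
  refine ⟨2 * (W.m + 1 + |s|) / x0 + 2 * (W.m + 1 + |s|) / (1 - x0), fun c j hc hc1 hc2 hA => ?_⟩
  set X : ℝ := 2 ^ j with hX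
  have hm : (0 : ℝ) ≤ W.m := by positivity
  have hX0 : 0 < X := by positivity
  have q1 : 2 * (W.m + 1 + |s|) ≤ X * x0 := by
    have : 0 ≤ 2 * (W.m + 1 + |s|) / (1 - x0) := by positivity
    rw [← div_le_iff₀ h1]; linarith
  have q2 : 2 * (W.m + 1 + |s|) ≤ X * (1 - x0) := by
    have : 0 ≤ 2 * (W.m + 1 + |s|) / x0 := by positivity
    rw [← div_le_iff₀ h2]; linarith
  have hsl := neg_abs_le s
  have hsu := le_abs_self s
  set lo : ℝ := X * (x0 - c) - s with hlo
  set hi : ℝ := X * (x0 + c) - s with hhi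
  have c1 := mul_le_mul_of_nonneg_left hc1 hX0.le
  have c2 := mul_le_mul_of_nonneg_left hc2 hX0.le
  have hlo_m : (W.m : ℝ) ≤ lo := by rw [hlo]; nlinarith
  have hhi_m : hi + W.m < X := by rw [hhi]; nlinarith
  have hhi0 : 0 ≤ hi := by
    have := mul_nonneg hX0.le hc
    rw [hhi]; rw [hlo] at hlo_m; nlinarith
  -- every integer of `[lo, hi]` is the index of an interior wavelet with `s` in the window
  have hmem : ∀ k ∈ Finset.Icc ⌈lo⌉₊ ⌊hi⌋₊, ∃ k' ∈ W.nearIndices x0 c j, (k' : ℕ) = k := by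
    intro k hk
    obtain ⟨hk1, hk2⟩ := Finset.mem_Icc.1 hk
    have hk1' : lo ≤ k := Nat.ceil_le.1 hk1
    have hk2' : (k : ℝ) ≤ hi := (Nat.le_floor_iff hhi0).1 hk2
    have hmk : W.m ≤ k := by exact_mod_cast hlo_m.trans hk1'
    have hkm : k + W.m < 2 ^ j := by
      have : ((k + W.m : ℕ) : ℝ) < ((2 ^ j : ℕ) : ℝ) := by push_cast; linarith
      exact_mod_cast this
    refine ⟨⟨k, by omega⟩, W.mem_nearIndices_of_ne_zero (x := (s + k) / X) ⟨?_, ?_⟩ ?_, rfl⟩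
    · rw [le_div_iff₀ hX0]; linarith
    · rw [div_le_iff₀ hX0]; linarith
    · have h3 : ¬ (k < W.m) := by omega
      simp only [mother, levelFun, h3, if_false, hkm, if_true, dilate]
      rw [← hX, mul_div_cancel₀ _ hX0.ne']
      refine mul_ne_zero (Real.sqrt_pos.2 hX0).ne' ?_
      simpa using hs
  have hcard : (Finset.Icc ⌈lo⌉₊ ⌊hi⌋₊).card ≤ (W.nearIndices x0 c j).card := by
    rw [← Finset.card_image_of_injective (W.nearIndices x0 c j)
      (Fin.val_injective : Function.Injective fun k : Fin (2 ^ j) => (k : ℕ))]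
    refine Finset.card_le_card fun k hk => ?_
    obtain ⟨k', h3, h4⟩ := hmem k hk
    exact Finset.mem_image.2 ⟨k', h3, h4⟩
  have hcard' : hi - lo - 1 ≤ ((Finset.Icc ⌈lo⌉₊ ⌊hi⌋₊).card : ℝ) := by
    rw [Nat.card_Icc]
    have h5 : ((⌊hi⌋₊ + 1 : ℕ) : ℝ) - (⌈lo⌉₊ : ℕ) ≤ ((⌊hi⌋₊ + 1 - ⌈lo⌉₊ : ℕ) : ℝ) := by
      rw [sub_le_iff_le_add]
      have : ⌊hi⌋₊ + 1 ≤ (⌊hi⌋₊ + 1 - ⌈lo⌉₊) + ⌈lo⌉₊ := by omega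
      exact_mod_cast this
    have h6 := Nat.lt_floor_add_one hi
    have h7 := Nat.ceil_lt_add_one (hm.trans hlo_m)
    push_cast at h5
    linarith
  have : (((Finset.Icc ⌈lo⌉₊ ⌊hi⌋₊).card : ℕ) : ℝ) ≤ ((W.nearIndices x0 c j).card : ℝ) := by
    exact_mod_cast hcard
  have e : hi - lo = X * (2 * c) := by rw [hhi, hlo]; ring
  linarith

/-! ### Orthonormality and localisation -/

lemma integral_mother_mul_mother {p q : Σ j : ℕ, Fin (2 ^ j)} (hp : W.j0 ≤ p.1)
    (hq : W.j0 ≤ q.1) (hpq : p ≠ q) :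
    ∫ x in Icc (0 : ℝ) 1, W.mother p.1 p.2 x * W.mother q.1 q.2 x = 0 := by
  obtain ⟨j, k⟩ := p
  obtain ⟨j', k'⟩ := q
  obtain ⟨i, rfl⟩ := Nat.exists_eq_add_of_le hp
  obtain ⟨i', rfl⟩ := Nat.exists_eq_add_of_le hq
  refine W.basis.orthogonal (Sum.inr ⟨i, k⟩) (Sum.inr ⟨i', k'⟩) fun h => hpq ?_
  have h1 := Sum.inr.inj h
  have h2 : i = i' := congrArg Sigma.fst h1
  subst h2
  have h3 : k = k' := eq_of_heq (Sigma.mk.inj h1).2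
  rw [h3]

lemma integral_mother_sq {j : ℕ} (hj : W.j0 ≤ j) (k : Fin (2 ^ j)) :
    ∫ x in Icc (0 : ℝ) 1, W.mother j k x ^ 2 = 1 := by
  obtain ⟨i, rfl⟩ := Nat.exists_eq_add_of_le hj
  simp_rw [sq]
  exact W.basis.norm_one (Sum.inr ⟨i, k⟩)

lemma integral_father_sq (k : Fin (2 ^ W.j0)) :
    ∫ x in Icc (0 : ℝ) 1, W.father k x ^ 2 = 1 := by
  simp_rw [sq]
  exact W.basis.norm_one (Sum.inl k)

lemma memLp_mother (j : ℕ) (k : Fin (2 ^ j)) :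
    MemLp (W.mother j k) 2 (volume.restrict (Icc 0 1)) :=
  memLp_two_of_continuousOn (W.mother_contDiffOn j k).continuousOn

/-- Parseval's identity for finite sums of detail functions. -/
lemma integral_sum_mother_sq (F : Finset (Σ j : ℕ, Fin (2 ^ j))) (hF : ∀ p ∈ F, W.j0 ≤ p.1)
    (d : (Σ j : ℕ, Fin (2 ^ j)) → ℝ) :
    ∫ x in Icc (0 : ℝ) 1, (∑ p ∈ F, d p * W.mother p.1 p.2 x) ^ 2 = ∑ p ∈ F, d p ^ 2 := by
  have hint : ∀ p q : Σ j : ℕ, Fin (2 ^ j), Integrable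
      (fun x => W.mother p.1 p.2 x * W.mother q.1 q.2 x) (volume.restrict (Icc 0 1)) :=
    fun p q => (W.memLp_mother p.1 p.2).integrable_mul (W.memLp_mother q.1 q.2)
  have e : ∀ x, (∑ p ∈ F, d p * W.mother p.1 p.2 x) ^ 2 =
      ∑ p ∈ F, ∑ q ∈ F, d p * d q * (W.mother p.1 p.2 x * W.mother q.1 q.2 x) := fun x => by
    rw [sq, Finset.sum_mul_sum]
    refine Finset.sum_congr rfl fun i _ => Finset.sum_congr rfl fun i' _ => ?_
    ring
  simp_rw [e]
  rw [integral_finsetSum _ fun p _ => integrable_finsetSum _ fun q _ => (hint p q).const_mul _]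
  refine Finset.sum_congr rfl fun p hp => ?_
  rw [integral_finsetSum _ fun q _ => (hint p q).const_mul _, Finset.sum_eq_single p]
  · have := W.integral_mother_sq (hF p hp) p.2
    simp_rw [sq] at this
    rw [integral_const_mul, this, mul_one, sq]
  · intro q hq hne
    rw [integral_const_mul, W.integral_mother_mul_mother (hF p hp) (hF q hq) hne.symm, mul_zero]
  · exact fun h => absurd hp h

/-- The indices `(j,k)` near the window with `a ≤ j < b`. -/
noncomputable def nearSigma (x0 c : ℝ) (a b : ℕ) : Finset (Σ j : ℕ, Fin (2 ^ j)) :=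
  (Finset.Ico a b).sigma fun j => W.nearIndices x0 c j

/-- The finite wavelet sum with coarse coefficients `a` and detail coefficients `d` below
level `N`. -/
noncomputable def synth (N : ℕ) (a : Fin (2 ^ W.j0) → ℝ) (d : ∀ j : ℕ, Fin (2 ^ j) → ℝ)
    (x : ℝ) : ℝ :=
  ∑ k, a k * W.father k x + ∑ j ∈ Finset.Ico W.j0 N, ∑ k, d j k * W.mother j k x

lemma continuousOn_synth (N : ℕ) (a : Fin (2 ^ W.j0) → ℝ) (d : ∀ j : ℕ, Fin (2 ^ j) → ℝ) :
    ContinuousOn (W.synth N a d) (Icc 0 1) :=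
  (continuousOn_finsetSum _ fun k _ =>
    continuousOn_const.mul (W.father_contDiffOn k).continuousOn).add
  (continuousOn_finsetSum _ fun j _ => continuousOn_finsetSum _ fun k _ =>
    continuousOn_const.mul (W.mother_contDiffOn j k).continuousOn)

/-- The local `L²` norm of a wavelet sum: the levels below `Js` are bounded in sup norm, the others
by orthonormality; only wavelets near the window matter. -/
lemma integral_synth_sq_le {Kφ Kψ : ℝ} (hφ : ∀ k t, |W.father k t| ≤ Kφ)
    (hψ : ∀ (j : ℕ) (k : Fin (2 ^ j)) (t : ℝ), |W.mother j k t| ≤ Kψ * √((2 : ℝ) ^ j))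
    {x0 c : ℝ} (hc : 0 < c) (hI : Icc (x0 - c) (x0 + c) ⊆ Icc 0 1) {Js N : ℕ} (hJs : W.j0 ≤ Js)
    (hN : Js ≤ N) (a : Fin (2 ^ W.j0) → ℝ) (d : ∀ j : ℕ, Fin (2 ^ j) → ℝ) :
    ∫ x in Icc (x0 - c) (x0 + c), W.synth N a d x ^ 2 ≤
      4 * c * (∑ k, Kφ * |a k| + ∑ p ∈ W.nearSigma x0 c W.j0 Js,
        Kψ * √((2 : ℝ) ^ p.1) * |d p.1 p.2|) ^ 2
      + 2 * ∑ p ∈ W.nearSigma x0 c Js N, d p.1 p.2 ^ 2 := by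
  set I := Icc (x0 - c) (x0 + c) with hIdef
  set A := ∑ k, Kφ * |a k| + ∑ p ∈ W.nearSigma x0 c W.j0 Js, Kψ * √((2 : ℝ) ^ p.1) * |d p.1 p.2|
    with hA
  set G2 : ℝ → ℝ := fun x => ∑ p ∈ W.nearSigma x0 c Js N, d p.1 p.2 * W.mother p.1 p.2 x with hG2
  have hloc : ∀ x ∈ I, ∀ j, ∑ k, d j k * W.mother j k x
      = ∑ k ∈ W.nearIndices x0 c j, d j k * W.mother j k x := fun x hx j => by
    refine (Finset.sum_subset (Finset.subset_univ _) fun k _ hk => ?_).symm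
    have : W.mother j k x = 0 := by
      by_contra h0
      exact hk (W.mem_nearIndices_of_ne_zero hx h0)
    rw [this, mul_zero]
  have hdec : ∀ x ∈ I, W.synth N a d x = (∑ k, a k * W.father k x
      + ∑ p ∈ W.nearSigma x0 c W.j0 Js, d p.1 p.2 * W.mother p.1 p.2 x) + G2 x := fun x hx => by
    rw [synth, ← Finset.sum_Ico_consecutive _ hJs hN, hG2, ← add_assoc]
    simp only [nearSigma, Finset.sum_sigma]
    rw [Finset.sum_congr rfl fun j _ => hloc x hx j, Finset.sum_congr rfl fun j _ => hloc x hx j]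
  have hpt : ∀ x ∈ I, W.synth N a d x ^ 2 ≤ 2 * A ^ 2 + 2 * G2 x ^ 2 := fun x hx => by
    rw [hdec x hx]
    set u := ∑ k, a k * W.father k x
      + ∑ p ∈ W.nearSigma x0 c W.j0 Js, d p.1 p.2 * W.mother p.1 p.2 x with hu
    have h1 : |u| ≤ A := by
      refine (abs_add_le _ _).trans (add_le_add ?_ ?_)
      · refine (Finset.abs_sum_le_sum_abs _ _).trans (Finset.sum_le_sum fun k _ => ?_)
        rw [abs_mul, mul_comm]
        exact mul_le_mul_of_nonneg_right (hφ k x) (abs_nonneg _)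
      · refine (Finset.abs_sum_le_sum_abs _ _).trans (Finset.sum_le_sum fun p _ => ?_)
        rw [abs_mul, mul_comm]
        exact mul_le_mul_of_nonneg_right (hψ p.1 p.2 x) (abs_nonneg _)
    have h2 : u ^ 2 ≤ A ^ 2 := by
      rw [← sq_abs u]; gcongr
    nlinarith [sq_nonneg (u - G2 x)]
  have hG2c : ContinuousOn G2 (Icc 0 1) := continuousOn_finsetSum _ fun p _ =>
    continuousOn_const.mul (W.mother_contDiffOn p.1 p.2).continuousOn
  have hG2i : IntegrableOn (fun x => G2 x ^ 2) (Icc 0 1) := (hG2c.pow 2).integrableOn_Icc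
  calc ∫ x in I, W.synth N a d x ^ 2
      ≤ ∫ x in I, (2 * A ^ 2 + 2 * G2 x ^ 2) := by
        refine setIntegral_mono_on ?_ ?_ measurableSet_Icc hpt
        · exact (((W.continuousOn_synth N a d).mono hI).pow 2).integrableOn_Icc
        · exact (continuousOn_const.add (continuousOn_const.mul
            ((hG2c.mono hI).pow 2))).integrableOn_Icc
    _ = 4 * c * A ^ 2 + 2 * ∫ x in I, G2 x ^ 2 := by
        have hci : Integrable (fun _ : ℝ => 2 * A ^ 2) (volume.restrict I) :=
          integrableOn_const (by simp [hIdef])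
        rw [integral_add hci ((hG2i.mono_set hI).const_mul 2),
          integral_const_mul (2 : ℝ) fun x => G2 x ^ 2]
        congr 1
        simp only [integral_const, measureReal_restrict_apply_univ, hIdef, Real.volume_real_Icc,
          smul_eq_mul]
        rw [max_eq_left (by linarith)]
        ring
    _ ≤ 4 * c * A ^ 2 + 2 * ∫ x in Icc (0 : ℝ) 1, G2 x ^ 2 := by
        have := setIntegral_mono_set hG2i (ae_of_all _ fun x => sq_nonneg (G2 x))
          (LE.le.eventuallyLE hI)
        linarith
    _ = _ := by
        rw [hG2, W.integral_sum_mother_sq _ (fun p hp => ?_) fun p => d p.1 p.2]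
        exact hJs.trans (Finset.mem_Ico.1 (Finset.mem_sigma.1 hp).1).1

/-- Partial wavelet sums converge in `L²[0,1]`. -/
lemma exists_synth_approx {f : ℝ → ℝ} (hf : ContinuousOn f (Icc 0 1)) {ε : ℝ} (hε : 0 < ε) :
    ∃ N0 : ℕ, ∀ N ≥ N0,
      ∫ x in Icc (0 : ℝ) 1, (f x - W.synth N (W.coarse f) (W.coeff f) x) ^ 2 ≤ ε := by
  classical
  obtain ⟨s0, hs0⟩ := W.basis.exists_expansion (memLp_two_of_continuousOn hf) hε
  refine ⟨W.j0 + (s0.sup (Sum.elim (fun _ => 0) fun p => p.1) + 1), fun N hN => ?_⟩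
  obtain ⟨M, rfl⟩ : ∃ M, N = W.j0 + M := Nat.exists_eq_add_of_le (by omega)
  have hsub : s0 ⊆ (Finset.univ : Finset (Fin (2 ^ W.j0))).disjSum
      ((Finset.range M).sigma fun i : ℕ => (Finset.univ : Finset (Fin (2 ^ (W.j0 + i))))) := by
    intro p hp
    have := Finset.le_sup (f := Sum.elim (fun _ => 0) fun p => p.1) hp
    rcases p with k | ⟨i, k⟩
    · simp
    · simp only [Sum.elim_inr] at this
      simp only [Finset.inr_mem_disjSum, Finset.mem_sigma, Finset.mem_range, Finset.mem_univ,
        and_true]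
      omega
  have h := hs0 _ hsub
  simp only [Finset.sum_disjSum, Sum.elim_inl, Sum.elim_inr, Finset.sum_sigma] at h
  convert h using 6 with x
  unfold synth
  congr 1
  rw [Finset.sum_Ico_eq_sum_range, Nat.add_sub_cancel_left]
  rfl

end IntervalWaveletBasis

/-! ### Risk of the shrinkage rules in the white noise model -/

section Rules

variable {Ω : Type*} [MeasurableSpace Ω] {P : Measure Ω} {B : ℝ≥0 → Ω → ℝ}

/-- Risk of soft thresholding at the threshold `√(2 log n / n)`, at which the noise exceeds the
threshold with probability about `1 / n`. -/
lemma upperExp_soft [IsProbabilityMeasure P] {ξ : Ω → ℝ} (hξ : P.map ξ = gaussianReal 0 1)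
    {n : ℕ} (hn : 3 ≤ n) (θ : ℝ) :
    UpperExpLE P (fun ω => ((SignType.sign (θ + (√(n : ℝ))⁻¹ * ξ ω) : ℝ) *
      max (|θ + (√(n : ℝ))⁻¹ * ξ ω| - √(2 * (n : ℝ)⁻¹ * Real.log n)) 0 - θ) ^ 2)
      (8 * θ ^ 2 + 4 / (n : ℝ) ^ 2) ∧
    UpperExpLE P (fun ω => ((SignType.sign (θ + (√(n : ℝ))⁻¹ * ξ ω) : ℝ) *
      max (|θ + (√(n : ℝ))⁻¹ * ξ ω| - √(2 * (n : ℝ)⁻¹ * Real.log n)) 0 - θ) ^ 2)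
      (6 * (Real.log n / n)) := by
  have hn3 : (3 : ℝ) ≤ n := by exact_mod_cast hn
  have hn0 : (0 : ℝ) < n := by linarith
  have hlog : 1 ≤ Real.log n := by
    rw [Real.le_log_iff_exp_le hn0]
    exact (Real.exp_one_lt_d9.le.trans (by norm_num)).trans hn3
  set σ : ℝ := (√(n : ℝ))⁻¹ with hσ
  have hσ0 : 0 < σ := by positivity
  have hσ2 : σ ^ 2 = (n : ℝ)⁻¹ := by rw [hσ, inv_pow, Real.sq_sqrt hn0.le]
  set t0 : ℝ := √(2 * Real.log n) with ht0
  have ht00 : 0 < t0 := Real.sqrt_pos.2 (by linarith)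
  have ht02 : t0 ^ 2 = 2 * Real.log n := Real.sq_sqrt (by linarith)
  set t : ℝ := √(2 * (n : ℝ)⁻¹ * Real.log n) with ht
  have htσ : t = σ * t0 := by
    rw [ht, show 2 * (n : ℝ)⁻¹ * Real.log n = (n : ℝ)⁻¹ * (2 * Real.log n) by ring,
      Real.sqrt_mul (by positivity), Real.sqrt_inv]
  have hex := upperExp_excess_sq hξ ht00
  obtain ⟨hi, hi1⟩ := integral_sq_of_map_eq hξ
  constructor
  · refine (((UpperExpLE.const (P := P) (8 * θ ^ 2)).add
      (hex.const_mul (c := 2 * σ ^ 2) (by positivity)))).mono (ae_of_all _ fun ω => ?_) ?_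
    · refine (soft_sq_le (Real.sqrt_nonneg _) θ (σ * ξ ω)).1.trans (le_of_eq ?_)
      rw [← ht, htσ, abs_mul, abs_of_pos hσ0, ← mul_sub]
      have : max (σ * (|ξ ω| - t0)) 0 = σ * max (|ξ ω| - t0) 0 := by
        rw [mul_max_of_nonneg _ _ hσ0.le, mul_zero]
      rw [this]
      ring
    · have e1 : Real.exp (-(t0 ^ 2 / 2)) = (n : ℝ)⁻¹ := by
        rw [ht02, mul_div_cancel_left₀ _ two_ne_zero, Real.exp_neg, Real.exp_log hn0]
      rw [e1, hσ2, ht02]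
      have e2 : 2 * (n : ℝ)⁻¹ * (4 / (2 * Real.log n) * (n : ℝ)⁻¹)
          = 4 / (n : ℝ) ^ 2 * (1 / Real.log n) := by
        field_simp
      rw [e2]
      have : 1 / Real.log n ≤ 1 := by rw [div_le_one (by linarith)]; exact hlog
      have h4 : (0 : ℝ) ≤ 4 / (n : ℝ) ^ 2 := by positivity
      nlinarith
  · refine (((UpperExpLE.const (P := P) (2 * t ^ 2)).add
      ((UpperExpLE.of_integrable hi hi1.le).const_mul (c := 2 * σ ^ 2) (by positivity)))).mono
      (ae_of_all _ fun ω => ?_) ?_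
    · refine (soft_sq_le (Real.sqrt_nonneg _) θ (σ * ξ ω)).2.trans (le_of_eq ?_)
      ring
    · rw [htσ, mul_pow, hσ2, ht02, mul_one]
      have : 6 * (Real.log n / n) = 2 * ((n : ℝ)⁻¹ * (2 * Real.log n)) + 2 * (n : ℝ)⁻¹
          + 2 * (n : ℝ)⁻¹ * (Real.log n - 1) := by field_simp; ring
      have h5 : (0 : ℝ) ≤ 2 * (n : ℝ)⁻¹ * (Real.log n - 1) :=
        mul_nonneg (by positivity) (by linarith)
      linarith

/-- The constant in front of the noise term of a James–Stein block. -/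
noncomputable def blockConst (lam : ℝ) : ℝ := 16 * lam / (lam - 1)

/-- Risk of James–Stein shrinkage of a block of at most `L` coefficients. The length `L` in the rule
may exceed the number of coefficients, as it does for the last block of a level. -/
lemma upperExp_block {κ : Type} {ξ : κ → Ω → ℝ} (F : Finset κ)
    (hind : iIndepFun (fun i : F => ξ i) P) (hξ : ∀ i ∈ F, P.map (ξ i) = gaussianReal 0 1)
    {lam : ℝ} (hlam : 1 < lam) (hlam_eq : lam - Real.log lam - 1 = 2) {L : ℕ}
    (hL : F.card ≤ L) {n : ℕ} (hn : 0 < n) (θ : κ → ℝ) :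
    UpperExpLE P (fun ω => ∑ p ∈ F, (jamesStein lam L n
        (∑ q ∈ F, (θ q + (√(n : ℝ))⁻¹ * ξ q ω) ^ 2) * (θ p + (√(n : ℝ))⁻¹ * ξ p ω) - θ p) ^ 2)
      (18 * ∑ p ∈ F, θ p ^ 2 + blockConst lam * Real.exp (-(L : ℝ)) / n) ∧
    UpperExpLE P (fun ω => ∑ p ∈ F, (jamesStein lam L n
        (∑ q ∈ F, (θ q + (√(n : ℝ))⁻¹ * ξ q ω) ^ 2) * (θ p + (√(n : ℝ))⁻¹ * ξ p ω) - θ p) ^ 2)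
      ((2 * lam + 2) * (L / n)) := by
  have hP := hind.isProbabilityMeasure
  have hn0 : (0 : ℝ) < n := by exact_mod_cast hn
  set σ : ℝ := (√(n : ℝ))⁻¹ with hσ
  have hσ2 : σ ^ 2 = (n : ℝ)⁻¹ := by rw [hσ, inv_pow, Real.sq_sqrt hn0.le]
  have hT : 0 ≤ lam * L * (n : ℝ)⁻¹ := by positivity
  have hsq : ∀ ω, ∑ p ∈ F, (σ * ξ p ω) ^ 2 = (n : ℝ)⁻¹ * ∑ p ∈ F, ξ p ω ^ 2 := fun ω => by
    rw [Finset.mul_sum]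
    refine Finset.sum_congr rfl fun p _ => ?_
    rw [mul_pow, hσ2]
  constructor
  · have hchi := upperExp_chiSq_excess hind (fun i => hξ i i.2) hlam hlam_eq
      (by simpa using hL)
    refine ((UpperExpLE.const (P := P) (18 * ∑ p ∈ F, θ p ^ 2)).add
      (hchi.const_mul (c := 8 * (n : ℝ)⁻¹) (by positivity))).mono
      (ae_of_all _ fun ω => ?_) (le_of_eq ?_)
    · refine (sum_shrink_sub_sq_le F hT θ fun p => σ * ξ p ω).1.trans (le_of_eq ?_)
      have e := Finset.sum_coe_sort F fun i => ξ i ω ^ 2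
      have e2 : max (∑ p ∈ F, (σ * ξ p ω) ^ 2 - lam * L * (n : ℝ)⁻¹) 0
          = (n : ℝ)⁻¹ * max (∑ i : F, ξ i ω ^ 2 - lam * L) 0 := by
        rw [hsq, e, mul_max_of_nonneg _ _ (by positivity), mul_zero]
        congr 1
        ring
      rw [e2]
      ring
    · rw [blockConst]
      field_simp
      ring
  · have hs : UpperExpLE P (fun ω => ∑ p ∈ F, ξ p ω ^ 2) (∑ p ∈ F, (1 : ℝ)) :=
      UpperExpLE.sum F fun p hp => by
        obtain ⟨h1, h2⟩ := integral_sq_of_map_eq (hξ p hp)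
        exact UpperExpLE.of_integrable h1 h2.le
    refine ((UpperExpLE.const (P := P) (2 * (lam * L * (n : ℝ)⁻¹))).add
      (hs.const_mul (c := 2 * (n : ℝ)⁻¹) (by positivity))).mono
      (ae_of_all _ fun ω => ?_) ?_
    · refine (sum_shrink_sub_sq_le F hT θ fun p => σ * ξ p ω).2.trans (le_of_eq ?_)
      rw [hsq]
      ring
    · have h3 : (F.card : ℝ) ≤ L := by exact_mod_cast hL
      rw [Finset.sum_const, nsmul_eq_mul, mul_one]
      have : (2 * lam + 2) * ((L : ℝ) / n)
          = 2 * (lam * L * (n : ℝ)⁻¹) + 2 * (n : ℝ)⁻¹ * L := by ring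
      rw [this]
      gcongr

lemma continuous_primitive {f : ℝ → ℝ} (hf : ContinuousOn f (Icc 0 1)) :
    Continuous fun t : unitInterval => ∫ x in (0 : ℝ)..t, f x := by
  have hpc : ContinuousOn (fun t => ∫ x in (0 : ℝ)..t, f x) (Icc 0 1) :=
    intervalIntegral.continuousOn_primitive_interval'
      ((intervalIntegrable_iff_integrableOn_Icc_of_le zero_le_one).2 hf.integrableOn_Icc)
      left_mem_uIcc |>.mono (by rw [uIcc_of_le zero_le_one])
  exact continuousOn_iff_continuous_domRestrict.1 hpc

omit [MeasurableSpace Ω] in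
/-- An empirical coefficient is the coefficient of the signal plus a Wiener integral. -/
lemma pathIntegral_observedPath {f g : ℝ → ℝ} (hf : ContinuousOn f (Icc 0 1))
    (hg : ContDiffOn ℝ 1 g (Icc 0 1)) (n : ℕ) {ω : Ω} (hω : Continuous (B · ω)) :
    pathIntegral g (observedPath B f n ω)
      = (∫ x in Icc (0 : ℝ) 1, f x * g x) + (√(n : ℝ))⁻¹ * wiener B g ω := by
  rw [← pathIntegral_primitive hf hg]
  exact pathIntegral_add_smul hg (continuous_primitive hf) (continuous_pathOf hω) _

end Rules

namespace IntervalWaveletBasis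

variable {r : ℕ} (W : IntervalWaveletBasis r) {Ω : Type*} [MeasurableSpace Ω] {P : Measure Ω}
  {B : ℝ≥0 → Ω → ℝ}

lemma mother_contDiffOn_one (hr : 1 ≤ r) (j : ℕ) (k : Fin (2 ^ j)) :
    ContDiffOn ℝ 1 (W.mother j k) (Icc 0 1) :=
  (W.mother_contDiffOn j k).of_le (by exact_mod_cast hr)

lemma father_contDiffOn_one (hr : 1 ≤ r) (k : Fin (2 ^ W.j0)) :
    ContDiffOn ℝ 1 (W.father k) (Icc 0 1) :=
  (W.father_contDiffOn k).of_le (by exact_mod_cast hr)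

lemma map_wiener_mother (hr : 1 ≤ r) (hB : IsBrownianReal B P) {j : ℕ} (hj : W.j0 ≤ j)
    (k : Fin (2 ^ j)) : P.map (wiener B (W.mother j k)) = gaussianReal 0 1 := by
  rw [map_wiener hB (W.mother_contDiffOn_one hr j k), W.integral_mother_sq hj, Real.toNNReal_one]

lemma map_wiener_father (hr : 1 ≤ r) (hB : IsBrownianReal B P) (k : Fin (2 ^ W.j0)) :
    P.map (wiener B (W.father k)) = gaussianReal 0 1 := by
  rw [map_wiener hB (W.father_contDiffOn_one hr k), W.integral_father_sq, Real.toNNReal_one]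

lemma iIndepFun_wiener_mother (hr : 1 ≤ r) (hB : IsBrownianReal B P)
    (F : Finset (Σ j : ℕ, Fin (2 ^ j))) (hF : ∀ p ∈ F, W.j0 ≤ p.1) :
    iIndepFun (fun p : F => wiener B (W.mother p.1.1 p.1.2)) P :=
  iIndepFun_wiener hB (fun p => W.mother_contDiffOn_one hr p.1.1 p.1.2) fun p q hne =>
    W.integral_mother_mul_mother (hF p p.2) (hF q q.2) fun h => hne (Subtype.ext h)

omit [MeasurableSpace Ω] in
lemma detailCoeff_observedPath (hr : 1 ≤ r) {f : ℝ → ℝ} (hf : ContinuousOn f (Icc 0 1)) (n : ℕ)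
    {ω : Ω} (hω : Continuous (B · ω)) (j : ℕ) (k : Fin (2 ^ j)) :
    W.detailCoeff (observedPath B f n ω) j k
      = W.coeff f j k + (√(n : ℝ))⁻¹ * wiener B (W.mother j k) ω :=
  pathIntegral_observedPath hf (W.mother_contDiffOn_one hr j k) n hω

/-- The error of the estimated coefficient `θ̂_{j,k}`. -/
noncomputable def coeffError (B : ℝ≥0 → Ω → ℝ) (lam x0 c : ℝ) (n : ℕ) (f : ℝ → ℝ) (j : ℕ)
    (k : Fin (2 ^ j)) (ω : Ω) : ℝ :=
  W.thetaHat lam x0 c n (observedPath B f n ω) j k - W.coeff f j k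

variable {lam x0 c : ℝ} {n : ℕ} {f : ℝ → ℝ}

/-- Below the level `J_*` the estimator thresholds each coefficient separately. -/
lemma upperExp_coeffError_low (hr : 1 ≤ r) (hB : IsBrownianReal B P)
    (hf : ContinuousOn f (Icc 0 1)) (hn : 3 ≤ n) (hJ : W.lowLevel c ≤ highLevel c n) {j : ℕ}
    (hj : W.j0 ≤ j) (hjl : j < W.lowLevel c) (k : Fin (2 ^ j)) :
    UpperExpLE P (fun ω => W.coeffError B lam x0 c n f j k ω ^ 2)
      (8 * W.coeff f j k ^ 2 + 4 / (n : ℝ) ^ 2) ∧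
    UpperExpLE P (fun ω => W.coeffError B lam x0 c n f j k ω ^ 2) (6 * (Real.log n / n)) := by
  have hP : IsProbabilityMeasure P := hB.isGaussianProcess.isProbabilityMeasure
  have h := upperExp_soft (W.map_wiener_mother hr hB hj k) hn (W.coeff f j k)
  have hae : (fun ω => W.coeffError B lam x0 c n f j k ω ^ 2) ≤ᵐ[P] fun ω =>
      ((SignType.sign (W.coeff f j k + (√(n : ℝ))⁻¹ * wiener B (W.mother j k) ω) : ℝ) *
      max (|W.coeff f j k + (√(n : ℝ))⁻¹ * wiener B (W.mother j k) ω|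
        - √(2 * (n : ℝ)⁻¹ * Real.log n)) 0 - W.coeff f j k) ^ 2 := by
    filter_upwards [hB.cont] with ω hω
    have h1 : ¬ (W.lowLevel c ≤ j ∧ j < highLevel c n ∧ k ∈ W.nearIndices x0 c j) := by
      rintro ⟨h, -⟩; omega
    have h2 : j < highLevel c n := hjl.trans_le hJ
    refine le_of_eq ?_
    rw [coeffError, thetaHat, if_neg h1, if_pos h2, W.detailCoeff_observedPath hr hf n hω]
  exact ⟨h.1.mono hae le_rfl, h.2.mono hae le_rfl⟩

/-- The vertical block consists of independent observations shrunk together, so that it has both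
James–Stein bounds with its own cardinality as block length. -/
lemma upperExp_coeffError_vertical (hr : 1 ≤ r) (hB : IsBrownianReal B P)
    (hlam : 1 < lam) (hlam_eq : lam - Real.log lam - 1 = 2)
    (hf : ContinuousOn f (Icc 0 1)) (hn : 3 ≤ n) :
    UpperExpLE P (fun ω => ∑ p ∈ W.nearSigma x0 c (W.lowLevel c) (highLevel c n),
        W.coeffError B lam x0 c n f p.1 p.2 ω ^ 2)
      (18 * ∑ p ∈ W.nearSigma x0 c (W.lowLevel c) (highLevel c n), W.coeff f p.1 p.2 ^ 2
        + blockConst lam * Real.exp (-(W.verticalCard x0 c n : ℝ)) / n) ∧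
    UpperExpLE P (fun ω => ∑ p ∈ W.nearSigma x0 c (W.lowLevel c) (highLevel c n),
        W.coeffError B lam x0 c n f p.1 p.2 ω ^ 2)
      ((2 * lam + 2) * (W.verticalCard x0 c n / n)) := by
  set F := W.nearSigma x0 c (W.lowLevel c) (highLevel c n) with hF
  have hF0 : ∀ p ∈ F, W.j0 ≤ p.1 := fun p hp =>
    (le_max_right _ _).trans (Finset.mem_Ico.1 (Finset.mem_sigma.1 hp).1).1
  have hcard : F.card = W.verticalCard x0 c n := by
    rw [hF, nearSigma, Finset.card_sigma, verticalCard]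
  have h := upperExp_block (ξ := fun p : Σ j : ℕ, Fin (2 ^ j) => wiener B (W.mother p.1 p.2)) F
    (W.iIndepFun_wiener_mother hr hB F hF0)
    (fun p hp => W.map_wiener_mother hr hB (hF0 p hp) p.2) hlam hlam_eq hcard.le
    (by omega : 0 < n) (fun p => W.coeff f p.1 p.2)
  have hae : (fun ω => ∑ p ∈ F, W.coeffError B lam x0 c n f p.1 p.2 ω ^ 2) ≤ᵐ[P] fun ω =>
      ∑ p ∈ F, (jamesStein lam (W.verticalCard x0 c n) n
        (∑ q ∈ F, (W.coeff f q.1 q.2 + (√(n : ℝ))⁻¹ * wiener B (W.mother q.1 q.2) ω) ^ 2) *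
        (W.coeff f p.1 p.2 + (√(n : ℝ))⁻¹ * wiener B (W.mother p.1 p.2) ω)
          - W.coeff f p.1 p.2) ^ 2 := by
    filter_upwards [hB.cont] with ω hω
    refine le_of_eq (Finset.sum_congr rfl fun p hp => ?_)
    obtain ⟨h1, h2⟩ := Finset.mem_sigma.1 hp
    obtain ⟨h3, h4⟩ := Finset.mem_Ico.1 h1
    have hS : W.verticalSq x0 c n (observedPath B f n ω)
        = ∑ q ∈ F, (W.coeff f q.1 q.2 + (√(n : ℝ))⁻¹ * wiener B (W.mother q.1 q.2) ω) ^ 2 := by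
      rw [hF, nearSigma, Finset.sum_sigma, verticalSq]
      simp only [W.detailCoeff_observedPath hr hf n hω]
    have hcond : W.lowLevel c ≤ p.1 ∧ p.1 < highLevel c n ∧ p.2 ∈ W.nearIndices x0 c p.1 :=
      ⟨h3, h4, h2⟩
    rw [coeffError, thetaHat, if_pos hcond, hS, W.detailCoeff_observedPath hr hf n hω]
  exact ⟨h.1.mono hae le_rfl, h.2.mono hae le_rfl⟩

/-- The horizontal blocks: the indices near the window are covered by few blocks, and each block
has the better of the two James–Stein bounds. -/
lemma upperExp_coeffError_horizontal (hr : 1 ≤ r) (hB : IsBrownianReal B P)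
    (hlam : 1 < lam) (hlam_eq : lam - Real.log lam - 1 = 2)
    (hf : ContinuousOn f (Icc 0 1)) (hn : 3 ≤ n) {j : ℕ} (hj : W.j0 ≤ j)
    (hjh : highLevel c n ≤ j) (hjn : j < dyadicLevel n) {b : ℝ}
    (hb : ∀ k, W.coeff f j k ^ 2 ≤ b) :
    UpperExpLE P (fun ω => ∑ k ∈ W.nearIndices x0 c j, W.coeffError B lam x0 c n f j k ω ^ 2)
      (((W.nearIndices x0 c j).image fun k : Fin (2 ^ j) => (k : ℕ) / blockLength n).card *
        (18 * (blockLength n * b) + blockConst lam * Real.exp (-(blockLength n : ℝ)) / n)) ∧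
    UpperExpLE P (fun ω => ∑ k ∈ W.nearIndices x0 c j, W.coeffError B lam x0 c n f j k ω ^ 2)
      (((W.nearIndices x0 c j).image fun k : Fin (2 ^ j) => (k : ℕ) / blockLength n).card *
        ((2 * lam + 2) * (blockLength n / n))) := by
  have hb0 : 0 ≤ b := (sq_nonneg _).trans (hb ⟨0, by positivity⟩)
  have hn0 : (1 : ℝ) < n := by exact_mod_cast (by omega : 1 < n)
  have hL : 0 < blockLength n := Nat.ceil_pos.2 (Real.log_pos hn0)
  set L := blockLength n with hLdef
  set blk : ℕ → Finset (Fin (2 ^ j)) := fun b =>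
    Finset.univ.filter fun k' : Fin (2 ^ j) => (k' : ℕ) / L = b with hblk
  set F : ℕ → Finset (Σ j : ℕ, Fin (2 ^ j)) := fun b => (blk b).map
    ⟨fun k => (⟨j, k⟩ : Σ j : ℕ, Fin (2 ^ j)), fun _ _ h => eq_of_heq (Sigma.mk.inj h).2⟩ with hF
  have hcard : ∀ b, (blk b).card ≤ L := fun b => by
    have : (blk b).card ≤ (Finset.range L).card := by
      refine Finset.card_le_card_of_injOn (fun k => (k : ℕ) % L)
        (fun k _ => by simpa using Nat.mod_lt _ hL) ?_
      intro k hk k' hk' h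
      have h1 : (k : ℕ) / L = b := (Finset.mem_filter.1 hk).2
      have h2 : (k' : ℕ) / L = b := (Finset.mem_filter.1 hk').2
      have h3 : (k : ℕ) % L = (k' : ℕ) % L := h
      refine Fin.ext ?_
      rw [← Nat.div_add_mod (k : ℕ) L, ← Nat.div_add_mod (k' : ℕ) L, h1, h2, h3]
    simpa using this
  have hFcard : ∀ b, (F b).card ≤ L := fun b => by
    rw [hF]; simpa using hcard b
  have hF0 : ∀ b, ∀ p ∈ F b, W.j0 ≤ p.1 := fun b p hp => by
    obtain ⟨k, -, rfl⟩ := Finset.mem_map.1 hp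
    exact hj
  have hsumF : ∀ (b : ℕ) (u : (Σ j : ℕ, Fin (2 ^ j)) → ℝ),
      ∑ p ∈ F b, u p = ∑ k ∈ blk b, u ⟨j, k⟩ := fun b u => by rw [hF, Finset.sum_map]; rfl
  have h := fun b => upperExp_block
    (ξ := fun p : Σ j : ℕ, Fin (2 ^ j) => wiener B (W.mother p.1 p.2)) (F b)
    (W.iIndepFun_wiener_mother hr hB (F b) (hF0 b))
    (fun p hp => W.map_wiener_mother hr hB (hF0 b p hp) p.2) hlam hlam_eq (hFcard b)
    (by omega : 0 < n) (fun p => W.coeff f p.1 p.2)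
  have hae : ∀ b, (fun ω => ∑ k ∈ blk b, W.coeffError B lam x0 c n f j k ω ^ 2) ≤ᵐ[P] fun ω =>
      ∑ p ∈ F b, (jamesStein lam L n
        (∑ q ∈ F b, (W.coeff f q.1 q.2 + (√(n : ℝ))⁻¹ * wiener B (W.mother q.1 q.2) ω) ^ 2) *
        (W.coeff f p.1 p.2 + (√(n : ℝ))⁻¹ * wiener B (W.mother p.1 p.2) ω)
          - W.coeff f p.1 p.2) ^ 2 := fun b => by
    filter_upwards [hB.cont] with ω hω
    rw [hsumF]
    refine le_of_eq (Finset.sum_congr rfl fun k hk => ?_)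
    have hkb : (k : ℕ) / L = b := (Finset.mem_filter.1 hk).2
    have hS : W.blockSq n (observedPath B f n ω) j k
        = ∑ q ∈ F b, (W.coeff f q.1 q.2 + (√(n : ℝ))⁻¹ * wiener B (W.mother q.1 q.2) ω) ^ 2 := by
      rw [hsumF, blockSq, hkb]
      simp only [W.detailCoeff_observedPath hr hf n hω]
      rfl
    have h1 : ¬ (W.lowLevel c ≤ j ∧ j < highLevel c n ∧ k ∈ W.nearIndices x0 c j) := by
      rintro ⟨-, h, -⟩; omega
    have h2 : ¬ j < highLevel c n := by omega
    rw [coeffError, thetaHat, if_neg h1, if_neg h2, if_pos hjn, hS,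
      W.detailCoeff_observedPath hr hf n hω]
  have hcover : ∀ ω, ∑ k ∈ W.nearIndices x0 c j, W.coeffError B lam x0 c n f j k ω ^ 2
      ≤ ∑ b ∈ (W.nearIndices x0 c j).image (fun k : Fin (2 ^ j) => (k : ℕ) / L),
        ∑ k ∈ blk b, W.coeffError B lam x0 c n f j k ω ^ 2 := fun ω => by
    rw [← Finset.sum_fiberwise_of_maps_to (s := W.nearIndices x0 c j)
      (t := (W.nearIndices x0 c j).image fun k : Fin (2 ^ j) => (k : ℕ) / L)
      (g := fun k => (k : ℕ) / L) (fun k hk => Finset.mem_image_of_mem _ hk)]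
    refine Finset.sum_le_sum fun b _ => ?_
    refine Finset.sum_le_sum_of_subset_of_nonneg (fun k hk => ?_) fun _ _ _ => sq_nonneg _
    exact Finset.mem_filter.2 ⟨Finset.mem_univ _, (Finset.mem_filter.1 hk).2⟩
  constructor
  · have hsumb : ∀ b', ∑ p ∈ F b', W.coeff f p.1 p.2 ^ 2 ≤ L * b := fun b' => by
      rw [hsumF]
      calc ∑ k ∈ blk b', W.coeff f j k ^ 2 ≤ ∑ k ∈ blk b', b :=
            Finset.sum_le_sum fun k _ => hb k
        _ = (blk b').card * b := by rw [Finset.sum_const, nsmul_eq_mul]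
        _ ≤ L * b := by
          gcongr
          exact_mod_cast hcard _
    refine (UpperExpLE.sum _ fun b' _ => (h b').1.mono (hae b')
      (b' := 18 * (L * b) + blockConst lam * Real.exp (-(L : ℝ)) / n) ?_).mono
      (ae_of_all _ hcover) ?_
    · gcongr
      exact hsumb b'
    · rw [Finset.sum_const, nsmul_eq_mul]
  · refine (UpperExpLE.sum _ fun b _ => (h b).2.mono (hae b) le_rfl).mono (ae_of_all _ hcover) ?_
    rw [Finset.sum_const, nsmul_eq_mul]

omit [MeasurableSpace Ω] in
/-- At the highest levels nothing is estimated. -/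
lemma coeffError_high {j : ℕ} (hjh : highLevel c n ≤ j) (hjn : dyadicLevel n ≤ j)
    (k : Fin (2 ^ j)) (ω : Ω) : W.coeffError B lam x0 c n f j k ω = - W.coeff f j k := by
  have h1 : ¬ (W.lowLevel c ≤ j ∧ j < highLevel c n ∧ k ∈ W.nearIndices x0 c j) := by
    rintro ⟨-, h, -⟩; omega
  have h2 : ¬ j < highLevel c n := by omega
  have h3 : ¬ j < dyadicLevel n := by omega
  rw [coeffError, thetaHat, if_neg h1, if_neg h2, if_neg h3, zero_sub]

end IntervalWaveletBasis

/-! ### The risk of the estimator at a fixed sample size -/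

namespace IntervalWaveletBasis

variable {r : ℕ} (W : IntervalWaveletBasis r)

lemma estimator_eq_synth {lam x0 c : ℝ} {n N : ℕ} (hj0 : W.j0 ≤ N) (hh : highLevel c n ≤ N)
    (hn : dyadicLevel n ≤ N) (z : unitInterval → ℝ) (x : ℝ) :
    W.estimator lam x0 c n z x = W.synth N (W.coarseCoeff z) (W.thetaHat lam x0 c n z) x := by
  rw [estimator, synth, Finset.sum_Ico_eq_sum_range]
  congr 1
  refine tsum_eq_sum fun i hi => Finset.sum_eq_zero fun k _ => ?_
  have hi' : N ≤ W.j0 + i := by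
    rw [Finset.mem_range, not_lt] at hi; omega
  have h1 : ¬ (W.lowLevel c ≤ W.j0 + i ∧ W.j0 + i < highLevel c n
      ∧ k ∈ W.nearIndices x0 c (W.j0 + i)) := by
    rintro ⟨-, h, -⟩; omega
  rw [thetaHat, if_neg h1, if_neg (by omega), if_neg (by omega), zero_mul]

lemma synth_sub (N : ℕ) (a a' : Fin (2 ^ W.j0) → ℝ) (d d' : ∀ j : ℕ, Fin (2 ^ j) → ℝ) (x : ℝ) :
    W.synth N (fun k => a k - a' k) (fun j k => d j k - d' j k) x
      = W.synth N a d x - W.synth N a' d' x := by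
  simp only [synth, sub_mul, Finset.sum_sub_distrib]
  ring

variable {Ω : Type*} [MeasurableSpace Ω] {P : Measure Ω} {B : ℝ≥0 → Ω → ℝ}
  {lam x0 c : ℝ} {n : ℕ} {f : ℝ → ℝ}

lemma upperExp_coarse (hr : 1 ≤ r) (hB : IsBrownianReal B P) (hf : ContinuousOn f (Icc 0 1))
    (k : Fin (2 ^ W.j0)) :
    UpperExpLE P (fun ω => (W.coarseCoeff (observedPath B f n ω) k - W.coarse f k) ^ 2)
      ((√(n : ℝ))⁻¹ ^ 2) := by
  obtain ⟨h1, h2⟩ := integral_sq_of_map_eq (W.map_wiener_father hr hB k)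
  refine ((UpperExpLE.of_integrable h1 h2.le).const_mul
    (c := (√(n : ℝ))⁻¹ ^ 2) (by positivity)).mono ?_ (by rw [mul_one])
  filter_upwards [hB.cont] with ω hω
  refine le_of_eq ?_
  rw [coarseCoeff, pathIntegral_observedPath hf (W.father_contDiffOn_one hr k) n hω, coarse]
  ring

/-- The risk is controlled by the errors of the individual coefficients near the window: below the
level `J_*` through the sup norm, above it through orthonormality. -/
lemma risk_le (hr : 1 ≤ r) (hB : IsBrownianReal B P) (hf : ContinuousOn f (Icc 0 1)) (hn : 0 < n)
    {Kφ Kψ : ℝ} (hφ0 : 0 ≤ Kφ) (hφ : ∀ k t, |W.father k t| ≤ Kφ) (hψ0 : 0 ≤ Kψ)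
    (hψ : ∀ (j : ℕ) (k : Fin (2 ^ j)) (t : ℝ), |W.mother j k t| ≤ Kψ * √((2 : ℝ) ^ j))
    (hc : 0 < c) (hI : Icc (x0 - c) (x0 + c) ⊆ Icc 0 1) {τ : ℕ → ℝ} (hτ : ∀ j, 0 < τ j) {U : ℝ}
    (hlow : ∀ p ∈ W.nearSigma x0 c W.j0 (W.lowLevel c),
      UpperExpLE P (fun ω => W.coeffError B lam x0 c n f p.1 p.2 ω ^ 2) (τ p.1 ^ 2))
    (hhigh : ∀ N, UpperExpLE P (fun ω => ∑ p ∈ W.nearSigma x0 c (W.lowLevel c) N,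
      W.coeffError B lam x0 c n f p.1 p.2 ω ^ 2) U) :
    risk P B (W.estimator lam x0 c n) n x0 c f ≤
      ENNReal.ofReal (8 * ((2 : ℝ) ^ W.j0 * Kφ) ^ 2 / n
        + 8 * (∑ p ∈ W.nearSigma x0 c W.j0 (W.lowLevel c), Kψ * √((2 : ℝ) ^ p.1) * τ p.1) ^ 2
        + 2 * U / c + 1 / n) := by
  have hP : IsProbabilityMeasure P := hB.isGaussianProcess.isProbabilityMeasure
  have hn0 : (0 : ℝ) < n := by exact_mod_cast hn
  -- truncate the expansion of `f` so that the remainder costs at most `1 / n` after averaging over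
  -- the window
  obtain ⟨N0, hN0⟩ := W.exists_synth_approx hf (ε := c / n) (by positivity)
  set Js := W.lowLevel c with hJs
  have hj0Js : W.j0 ≤ Js := le_max_right _ _
  set N := max N0 (max Js (max (highLevel c n) (dyadicLevel n))) with hN
  have hNa : N0 ≤ N := le_max_left _ _
  have hNb : Js ≤ N := (le_max_left _ _).trans (le_max_right _ _)
  have hNc : highLevel c n ≤ N :=
    (le_max_left _ _).trans ((le_max_right _ _).trans (le_max_right _ _))
  have hNd : dyadicLevel n ≤ N :=
    (le_max_right _ _).trans ((le_max_right _ _).trans (le_max_right _ _))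
  set I := Icc (x0 - c) (x0 + c) with hIdef
  set a : Ω → Fin (2 ^ W.j0) → ℝ := fun ω k =>
    W.coarseCoeff (observedPath B f n ω) k - W.coarse f k with ha
  set e : Ω → ∀ j : ℕ, Fin (2 ^ j) → ℝ := fun ω j k => W.coeffError B lam x0 c n f j k ω with he
  set S1 : Ω → ℝ := fun ω => ∑ k, Kφ * |a ω k| with hS1
  set S2 : Ω → ℝ := fun ω => ∑ p ∈ W.nearSigma x0 c W.j0 Js,
    Kψ * √((2 : ℝ) ^ p.1) * |e ω p.1 p.2| with hS2
  set S3 : Ω → ℝ := fun ω => ∑ p ∈ W.nearSigma x0 c Js N, e ω p.1 p.2 ^ 2 with hS3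
  set Q : Ω → ℝ := fun ω => 16 * c * S1 ω ^ 2 + 16 * c * S2 ω ^ 2 + 4 * S3 ω + 2 * (c / n)
    with hQ
  have hQ0 : ∀ ω, 0 ≤ Q ω := fun ω => by
    have : 0 ≤ S3 ω := Finset.sum_nonneg fun _ _ => sq_nonneg _
    positivity
  have hfI : ContinuousOn f I := hf.mono hI
  have hcF := (W.continuousOn_synth N (W.coarse f) (W.coeff f))
  have hinner : ∀ ω, ∫⁻ x in I, ENNReal.ofReal
      ((W.estimator lam x0 c n (observedPath B f n ω) x - f x) ^ 2) ≤ ENNReal.ofReal (Q ω) := by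
    intro ω
    have hcG := W.continuousOn_synth N (a ω) (e ω)
    have hE : ∀ x, W.estimator lam x0 c n (observedPath B f n ω) x - f x
        = W.synth N (a ω) (e ω) x - (f x - W.synth N (W.coarse f) (W.coeff f) x) := fun x => by
      rw [W.estimator_eq_synth (hj0Js.trans hNb) hNc hNd]
      have := W.synth_sub N (W.coarseCoeff (observedPath B f n ω)) (W.coarse f)
        (W.thetaHat lam x0 c n (observedPath B f n ω)) (W.coeff f) x
      change W.synth N (a ω) (e ω) x = _ at this
      rw [this]; ring
    simp_rw [hE]
    have hG2 : IntegrableOn (fun x => W.synth N (a ω) (e ω) x ^ 2) I :=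
      ((hcG.mono hI).pow 2).integrableOn_Icc
    have hR2 : IntegrableOn (fun x => (f x - W.synth N (W.coarse f) (W.coeff f) x) ^ 2)
        (Icc 0 1) := ((hf.sub hcF).pow 2).integrableOn_Icc
    have hD2 : IntegrableOn (fun x => (W.synth N (a ω) (e ω) x
        - (f x - W.synth N (W.coarse f) (W.coeff f) x)) ^ 2) I :=
      (((hcG.mono hI).sub (hfI.sub (hcF.mono hI))).pow 2).integrableOn_Icc
    rw [← ofReal_integral_eq_lintegral_ofReal hD2 (ae_of_all _ fun x => sq_nonneg _)]
    refine ENNReal.ofReal_le_ofReal ?_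
    calc ∫ x in I, (W.synth N (a ω) (e ω) x - (f x - W.synth N (W.coarse f) (W.coeff f) x)) ^ 2
        ≤ ∫ x in I, (2 * W.synth N (a ω) (e ω) x ^ 2
          + 2 * (f x - W.synth N (W.coarse f) (W.coeff f) x) ^ 2) := by
          refine setIntegral_mono_on hD2
            ((hG2.const_mul 2).add ((hR2.mono_set hI).const_mul 2)) measurableSet_Icc
            fun x _ => ?_
          nlinarith [sq_nonneg (W.synth N (a ω) (e ω) x
            + (f x - W.synth N (W.coarse f) (W.coeff f) x))]
      _ = 2 * (∫ x in I, W.synth N (a ω) (e ω) x ^ 2)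
          + 2 * ∫ x in I, (f x - W.synth N (W.coarse f) (W.coeff f) x) ^ 2 := by
          rw [integral_add (hG2.const_mul 2) ((hR2.mono_set hI).const_mul 2), integral_const_mul,
            integral_const_mul]
      _ ≤ 2 * (4 * c * (S1 ω + S2 ω) ^ 2 + 2 * S3 ω) + 2 * (c / n) := by
          have h1 := W.integral_synth_sq_le hφ hψ hc hI hj0Js hNb (a ω) (e ω)
          have h2 := setIntegral_mono_set hR2
            (ae_of_all _ fun x => sq_nonneg (f x - W.synth N (W.coarse f) (W.coeff f) x))
            (LE.le.eventuallyLE hI)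
          have h3 := hN0 N hNa
          exact add_le_add (mul_le_mul_of_nonneg_left h1 zero_le_two)
            (mul_le_mul_of_nonneg_left (h2.trans h3) zero_le_two)
      _ ≤ Q ω := by
          have : (S1 ω + S2 ω) ^ 2 ≤ 2 * S1 ω ^ 2 + 2 * S2 ω ^ 2 := by
            nlinarith [sq_nonneg (S1 ω - S2 ω)]
          have := mul_le_mul_of_nonneg_left this hc.le
          simp only [hQ]
          nlinarith
  have hs := Real.sqrt_pos.2 hn0
  have u1 : UpperExpLE P (fun ω => S1 ω ^ 2)
      ((∑ _k : Fin (2 ^ W.j0), Kφ * (√(n : ℝ))⁻¹) ^ 2) :=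
    UpperExpLE.weighted_sum_sq Finset.univ (d := fun k ω => a ω k) (w := fun _ => Kφ)
      (τ := fun _ => (√(n : ℝ))⁻¹) (fun _ _ => hφ0) (fun _ _ => by positivity)
      fun k _ => W.upperExp_coarse hr hB hf k
  have u2 : UpperExpLE P (fun ω => S2 ω ^ 2)
      ((∑ p ∈ W.nearSigma x0 c W.j0 Js, Kψ * √((2 : ℝ) ^ p.1) * τ p.1) ^ 2) :=
    UpperExpLE.weighted_sum_sq _ (d := fun p ω => e ω p.1 p.2)
      (w := fun p : Σ j : ℕ, Fin (2 ^ j) => Kψ * √((2 : ℝ) ^ p.1))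
      (τ := fun p : Σ j : ℕ, Fin (2 ^ j) => τ p.1)
      (fun p _ => mul_nonneg hψ0 (Real.sqrt_nonneg _)) (fun p _ => hτ p.1) hlow
  have uQ := (((u1.const_mul (c := 16 * c) (by positivity)).add
    (u2.const_mul (c := 16 * c) (by positivity))).add
    ((hhigh N).const_mul (c := 4) (by norm_num))).add (UpperExpLE.const (P := P) (2 * (c / n)))
  have uQ2 := uQ.lintegral_le hQ0
  rw [risk]
  refine (mul_le_mul_right ((lintegral_mono hinner).trans uQ2) _).trans ?_
  rw [← ENNReal.ofReal_mul (by positivity)]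
  refine ENNReal.ofReal_le_ofReal (le_of_eq ?_)
  rw [Finset.sum_const, Finset.card_univ, Fintype.card_fin, nsmul_eq_mul]
  push_cast
  have : ((2 : ℝ) ^ W.j0 * (Kφ * (√(n : ℝ))⁻¹)) ^ 2 = ((2 : ℝ) ^ W.j0 * Kφ) ^ 2 / n := by
    rw [← mul_assoc, mul_pow _ (√(n : ℝ))⁻¹, inv_pow, Real.sq_sqrt hn0.le]
    rfl
  rw [this]
  field_simp
  ring

end IntervalWaveletBasis

/-! ### Geometric sums over dyadic levels -/

/-- A geometric sum with growing terms is of the order of its last term. -/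
lemma exists_sum_dyadic_le {s : ℝ} (hs : 0 < s) :
    ∃ C : ℝ, 0 < C ∧ ∀ (S : Finset ℕ) (T : ℝ), 0 < T → (∀ j ∈ S, (2 : ℝ) ^ j ≤ T) →
      ∑ j ∈ S, ((2 : ℝ) ^ j) ^ s ≤ C * T ^ s := by
  have hq1 : (1 : ℝ) < 2 ^ s := Real.one_lt_rpow one_lt_two hs
  set q : ℝ := 2 ^ s with hq
  have hpow : ∀ j : ℕ, ((2 : ℝ) ^ j) ^ s = q ^ j := fun j => by
    rw [hq, ← Real.rpow_natCast, ← Real.rpow_natCast, ← Real.rpow_mul zero_le_two,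
      ← Real.rpow_mul zero_le_two, mul_comm]
  refine ⟨q / (q - 1), div_pos (by linarith) (by linarith), fun S T hT hS => ?_⟩
  simp_rw [hpow]
  rcases S.eq_empty_or_nonempty with rfl | hne
  · rw [Finset.sum_empty]
    have : 0 ≤ q / (q - 1) := (div_pos (by linarith) (by linarith)).le
    positivity
  · have hmax := S.max'_mem hne
    set N := S.max' hne with hN
    calc ∑ j ∈ S, q ^ j ≤ ∑ j ∈ Finset.range (N + 1), q ^ j := by
          refine Finset.sum_le_sum_of_subset_of_nonneg (fun j hj => ?_) fun j _ _ => by positivity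
          exact Finset.mem_range.2 (Nat.lt_succ_of_le (S.le_max' j hj))
      _ = (q ^ (N + 1) - 1) / (q - 1) := geom_sum_eq hq1.ne' _
      _ ≤ q ^ (N + 1) / (q - 1) := by
          have : 0 < q - 1 := by linarith
          gcongr
          linarith
      _ = q / (q - 1) * q ^ N := by ring
      _ ≤ q / (q - 1) * T ^ s := by
          have : 0 ≤ q / (q - 1) := (div_pos (by linarith) (by linarith)).le
          gcongr
          rw [← hpow]
          exact Real.rpow_le_rpow (by positivity) (hS N hmax) hs.le

/-- A geometric sum with decreasing terms is of the order of its first term. -/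
lemma exists_sum_dyadic_neg_le {s : ℝ} (hs : 0 < s) :
    ∃ C : ℝ, 0 < C ∧ ∀ (S : Finset ℕ) (T : ℝ), 0 < T → (∀ j ∈ S, T ≤ (2 : ℝ) ^ j) →
      ∑ j ∈ S, ((2 : ℝ) ^ j) ^ (-s) ≤ C * T ^ (-s) := by
  have hq1 : (2 : ℝ) ^ (-s) < 1 := Real.rpow_lt_one_of_one_lt_of_neg one_lt_two (by linarith)
  have hq0 : (0 : ℝ) < 2 ^ (-s) := by positivity
  set q : ℝ := 2 ^ (-s) with hq
  have hpow : ∀ j : ℕ, ((2 : ℝ) ^ j) ^ (-s) = q ^ j := fun j => by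
    rw [hq, ← Real.rpow_natCast, ← Real.rpow_natCast, ← Real.rpow_mul zero_le_two,
      ← Real.rpow_mul zero_le_two, mul_comm]
  have hC : 0 < 1 / (1 - q) := div_pos one_pos (by linarith)
  refine ⟨1 / (1 - q), hC, fun S T hT hS => ?_⟩
  simp_rw [hpow]
  rcases S.eq_empty_or_nonempty with rfl | hne
  · rw [Finset.sum_empty]
    positivity
  · have hmin := S.min'_mem hne
    set N := S.min' hne with hN
    have hsum := hasSum_geometric_of_lt_one hq0.le hq1
    calc ∑ j ∈ S, q ^ j = ∑ j ∈ S, q ^ N * q ^ (j - N) := by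
          refine Finset.sum_congr rfl fun j hj => ?_
          rw [← pow_add, Nat.add_sub_cancel' (S.min'_le j hj)]
      _ = q ^ N * ∑ i ∈ S.image (· - N), q ^ i := by
          rw [← Finset.mul_sum, Finset.sum_image]
          intro i hi j hj h
          have h1 := S.min'_le i hi
          have h2 := S.min'_le j hj
          have h3 : i - N = j - N := h
          omega
      _ ≤ q ^ N * (1 - q)⁻¹ := by
          gcongr
          rw [← hsum.tsum_eq]
          exact hsum.summable.sum_le_tsum _ fun i _ => by positivity
      _ = 1 / (1 - q) * q ^ N := by ring
      _ ≤ 1 / (1 - q) * T ^ (-s) := by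
          gcongr
          rw [← hpow]
          exact Real.rpow_le_rpow_of_nonpos hT (hS N hmin) (by linarith)

lemma le_two_pow_dyadicLevel (a : ℝ) : a ≤ (2 : ℝ) ^ dyadicLevel a :=
  Nat.sInf_mem (s := {j : ℕ | a ≤ (2 : ℝ) ^ j})
    ((pow_unbounded_of_one_lt a one_lt_two).imp fun _ h => h.le)

lemma two_pow_lt_of_lt_dyadicLevel {a : ℝ} {j : ℕ} (h : j < dyadicLevel a) : (2 : ℝ) ^ j < a :=
  not_le.1 fun h' => Nat.notMem_of_lt_sInf h h'

lemma two_pow_dyadicLevel_lt {a : ℝ} (ha : 1 < a) : (2 : ℝ) ^ dyadicLevel a < 2 * a := by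
  have h0 : dyadicLevel a ≠ 0 := fun h => by
    have := le_two_pow_dyadicLevel a
    rw [h, pow_zero] at this
    linarith
  obtain ⟨m, hm⟩ := Nat.exists_eq_succ_of_ne_zero h0
  have := two_pow_lt_of_lt_dyadicLevel (a := a) (j := m) (by omega)
  rw [hm, pow_succ]
  linarith

/-! ### Sums of the error bounds over the levels -/

lemma UpperExpLE.min {Ω : Type*} [MeasurableSpace Ω] {P : Measure Ω} {h : Ω → ℝ} {b b' : ℝ}
    (H : UpperExpLE P h b) (H' : UpperExpLE P h b') : UpperExpLE P h (min b b') := by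
  rcases min_choice b b' with e | e <;> rw [e] <;> assumption

/-- The sum of the root mean squared errors below the level `J_*`, in sup norm normalisation:
each coefficient contributes the smaller of the noise level and of its own size. The first bound
uses the noise level throughout; the second switches at the level where the two are equal. -/
lemma exists_sum_low_le {α Cθ : ℝ} (hα : 0 < α) (hC : 0 ≤ Cθ) :
    ∃ C : ℝ, 0 < C ∧ ∀ n : ℕ, 3 ≤ n → ∀ c : ℝ, (n : ℝ)⁻¹ ≤ c → ∀ S : Finset ℕ,
      (∀ j ∈ S, (2 : ℝ) ^ j ≤ c⁻¹) →
      ∑ j ∈ S, √((2 : ℝ) ^ j) * √(min (6 * (Real.log n / n))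
          (8 * (Cθ * ((2 : ℝ) ^ j) ^ (-(2 * α + 1))) + 4 / (n : ℝ) ^ 2))
        ≤ C * √(c⁻¹ * (Real.log n / n)) ∧
      ∑ j ∈ S, √((2 : ℝ) ^ j) * √(min (6 * (Real.log n / n))
          (8 * (Cθ * ((2 : ℝ) ^ j) ^ (-(2 * α + 1))) + 4 / (n : ℝ) ^ 2))
        ≤ C * (Real.log n / n) ^ (α / (1 + 2 * α)) := by
  obtain ⟨C1, hC1, h1⟩ := exists_sum_dyadic_le (s := 1 / 2) (by norm_num)
  obtain ⟨C2, hC2, h2⟩ := exists_sum_dyadic_neg_le hα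
  refine ⟨3 * C1 + √(8 * Cθ) * C2 + 2 * C1, by positivity, fun n hn c hcn S hS => ?_⟩
  have hn3 : (3 : ℝ) ≤ n := by exact_mod_cast hn
  have hn0 : (0 : ℝ) < n := by linarith
  have hlog : 1 ≤ Real.log n := by
    rw [Real.le_log_iff_exp_le hn0]
    exact (Real.exp_one_lt_d9.le.trans (by norm_num)).trans hn3
  have hc : 0 < c := (inv_pos.2 hn0).trans_le hcn
  set l : ℝ := Real.log n / n with hl
  have hl0 : 0 < l := by positivity
  have hl1 : l ≤ 1 := by
    rw [hl, div_le_one hn0]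
    exact (Real.log_le_sub_one_of_pos hn0).trans (by linarith)
  have hnl : 1 / (n : ℝ) ≤ l := by rw [hl]; gcongr
  have hX : ∀ j : ℕ, (0 : ℝ) < 2 ^ j := fun j => by positivity
  set t : ℕ → ℝ := fun j => √((2 : ℝ) ^ j) * √(min (6 * l)
    (8 * (Cθ * ((2 : ℝ) ^ j) ^ (-(2 * α + 1))) + 4 / (n : ℝ) ^ 2)) with ht
  have hsix : √(6 * l) ≤ 3 * √l := by
    rw [Real.sqrt_mul (by norm_num)]
    gcongr
    rw [Real.sqrt_le_left (by norm_num)]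
    norm_num
  have hterm1 : ∀ j, t j ≤ 3 * √l * ((2 : ℝ) ^ j) ^ (1 / 2 : ℝ) := fun j => by
    rw [← Real.sqrt_eq_rpow, mul_comm _ (√((2 : ℝ) ^ j))]
    refine mul_le_mul_of_nonneg_left ((Real.sqrt_le_sqrt (min_le_left _ _)).trans hsix)
      (Real.sqrt_nonneg _)
  have hterm2 : ∀ j, t j ≤ √(8 * Cθ) * ((2 : ℝ) ^ j) ^ (-α)
      + 2 / n * ((2 : ℝ) ^ j) ^ (1 / 2 : ℝ) := fun j => by
    rw [ht]
    simp only
    rw [← Real.sqrt_mul (hX j).le]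
    have hA : 0 ≤ √(8 * Cθ) * ((2 : ℝ) ^ j) ^ (-α) := by positivity
    have hB : 0 ≤ 2 / n * ((2 : ℝ) ^ j) ^ (1 / 2 : ℝ) := by positivity
    refine Real.sqrt_le_iff.2 ⟨by positivity, ?_⟩
    have e1 : (√(8 * Cθ) * ((2 : ℝ) ^ j) ^ (-α)) ^ 2
        = (2 : ℝ) ^ j * (8 * (Cθ * ((2 : ℝ) ^ j) ^ (-(2 * α + 1)))) := by
      rw [mul_pow, Real.sq_sqrt (by positivity), ← Real.rpow_natCast, ← Real.rpow_mul (hX j).le]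
      have : (2 : ℝ) ^ j * ((2 : ℝ) ^ j) ^ (-(2 * α + 1)) = ((2 : ℝ) ^ j) ^ (-α * (2 : ℕ)) := by
        rw [← Real.rpow_one_add' (hX j).le (by ring_nf; linarith)]
        congr 1
        push_cast
        ring
      rw [← this]
      ring
    have e2 : (2 / n * ((2 : ℝ) ^ j) ^ (1 / 2 : ℝ)) ^ 2 = (2 : ℝ) ^ j * (4 / (n : ℝ) ^ 2) := by
      rw [mul_pow, ← Real.sqrt_eq_rpow, Real.sq_sqrt (hX j).le]
      ring
    calc (2 : ℝ) ^ j * min (6 * l) (8 * (Cθ * ((2 : ℝ) ^ j) ^ (-(2 * α + 1))) + 4 / (n : ℝ) ^ 2)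
        ≤ (2 : ℝ) ^ j * (8 * (Cθ * ((2 : ℝ) ^ j) ^ (-(2 * α + 1))) + 4 / (n : ℝ) ^ 2) :=
          mul_le_mul_of_nonneg_left (min_le_right _ _) (hX j).le
      _ = _ + _ := mul_add _ _ _
      _ ≤ _ := by
          rw [← e1, ← e2]
          nlinarith [mul_nonneg hA hB]
  have hsq : ∀ x : ℝ, x ^ (1 / 2 : ℝ) = √x := fun x => (Real.sqrt_eq_rpow x).symm
  constructor
  · calc ∑ j ∈ S, t j ≤ ∑ j ∈ S, 3 * √l * ((2 : ℝ) ^ j) ^ (1 / 2 : ℝ) :=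
          Finset.sum_le_sum fun j _ => hterm1 j
      _ ≤ 3 * √l * (C1 * c⁻¹ ^ (1 / 2 : ℝ)) := by
          rw [← Finset.mul_sum]
          gcongr
          exact h1 S _ (inv_pos.2 hc) hS
      _ = 3 * C1 * √(c⁻¹ * l) := by
          rw [hsq, Real.sqrt_mul (inv_pos.2 hc).le]
          ring
      _ ≤ _ := by
          have : 0 ≤ √(8 * Cθ) * C2 + 2 * C1 := by positivity
          gcongr
          linarith
  -- noise level and size of the coefficients are of the same order where `2 ^ j = T`
  · set T : ℝ := l ^ (-(1 / (1 + 2 * α))) with hT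
    have hT0 : 0 < T := by positivity
    have hT1 : √l * T ^ (1 / 2 : ℝ) = l ^ (α / (1 + 2 * α)) := by
      rw [Real.sqrt_eq_rpow, hT, ← Real.rpow_mul hl0.le, ← Real.rpow_add hl0]
      congr 1
      field_simp
      ring
    have hT2 : T ^ (-α) = l ^ (α / (1 + 2 * α)) := by
      rw [hT, ← Real.rpow_mul hl0.le]
      congr 1
      ring
    have hT3 : 2 / n * c⁻¹ ^ (1 / 2 : ℝ) ≤ 2 * l ^ (α / (1 + 2 * α)) := by
      have hcn' : c⁻¹ ≤ n := inv_le_of_inv_le₀ hn0 hcn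
      calc 2 / n * c⁻¹ ^ (1 / 2 : ℝ) ≤ 2 / n * √n := by
            rw [hsq]
            gcongr
        _ = 2 * √(1 / n) := by
            rw [Real.sqrt_div zero_le_one, Real.sqrt_one]
            have : √(n : ℝ) * √(n : ℝ) = n := Real.mul_self_sqrt hn0.le
            have h0 := Real.sqrt_pos.2 hn0
            field_simp
            rw [sq, this]
        _ ≤ 2 * √l := by gcongr
        _ ≤ 2 * l ^ (α / (1 + 2 * α)) := by
            rw [Real.sqrt_eq_rpow]
            refine mul_le_mul_of_nonneg_left
              (Real.rpow_le_rpow_of_exponent_ge hl0 hl1 ?_) zero_le_two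
            rw [div_le_div_iff₀ (by linarith) (by norm_num)]
            linarith
    rw [← Finset.sum_filter_add_sum_filter_not S fun j => (2 : ℝ) ^ j ≤ T]
    have hs1 : ∑ j ∈ S with (2 : ℝ) ^ j ≤ T, t j ≤ 3 * C1 * l ^ (α / (1 + 2 * α)) := by
      calc ∑ j ∈ S with (2 : ℝ) ^ j ≤ T, t j
          ≤ ∑ j ∈ S with (2 : ℝ) ^ j ≤ T, 3 * √l * ((2 : ℝ) ^ j) ^ (1 / 2 : ℝ) :=
            Finset.sum_le_sum fun j _ => hterm1 j
        _ ≤ 3 * √l * (C1 * T ^ (1 / 2 : ℝ)) := by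
            rw [← Finset.mul_sum]
            gcongr
            exact h1 _ _ hT0 fun j hj => (Finset.mem_filter.1 hj).2
        _ = _ := by rw [← hT1]; ring
    have hs2 : ∑ j ∈ S with ¬ (2 : ℝ) ^ j ≤ T, t j
        ≤ (√(8 * Cθ) * C2 + 2 * C1) * l ^ (α / (1 + 2 * α)) := by
      calc ∑ j ∈ S with ¬ (2 : ℝ) ^ j ≤ T, t j
          ≤ ∑ j ∈ S with ¬ (2 : ℝ) ^ j ≤ T, (√(8 * Cθ) * ((2 : ℝ) ^ j) ^ (-α)
            + 2 / n * ((2 : ℝ) ^ j) ^ (1 / 2 : ℝ)) := Finset.sum_le_sum fun j _ => hterm2 j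
        _ ≤ √(8 * Cθ) * (C2 * T ^ (-α)) + 2 / n * (C1 * c⁻¹ ^ (1 / 2 : ℝ)) := by
            rw [Finset.sum_add_distrib, ← Finset.mul_sum, ← Finset.mul_sum]
            gcongr
            · exact h2 _ _ hT0 fun j hj => (not_le.1 (Finset.mem_filter.1 hj).2).le
            · exact h1 _ _ (inv_pos.2 hc) fun j hj => hS j (Finset.mem_filter.1 hj).1
        _ ≤ _ := by
            rw [hT2]
            have := mul_le_mul_of_nonneg_left hT3 hC1.le
            linarith
    exact (add_le_add hs1 hs2).trans (le_of_eq (by ring))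

/-- The sum over the levels of the horizontal blocks, balanced at `2 ^ j = n ^ (1 / (1 + 2α))`. -/
lemma exists_sum_high_le {α : ℝ} (hα : 0 < α) :
    ∃ C : ℝ, 0 < C ∧ ∀ n : ℕ, 1 ≤ n → ∀ S : Finset ℕ, (∀ j ∈ S, (2 : ℝ) ^ j ≤ n) →
      ∑ j ∈ S, (2 : ℝ) ^ j * min (1 / (n : ℝ))
          (((2 : ℝ) ^ j) ^ (-(2 * α + 1)) + 1 / (n : ℝ) ^ 2)
        ≤ C * (n : ℝ) ^ (-(2 * α / (1 + 2 * α))) := by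
  obtain ⟨C1, hC1, h1⟩ := exists_sum_dyadic_le (s := 1) one_pos
  obtain ⟨C2, hC2, h2⟩ := exists_sum_dyadic_neg_le (s := 2 * α) (by linarith)
  refine ⟨C1 + C2 + C1, by positivity, fun n hn S hS => ?_⟩
  have hn1 : (1 : ℝ) ≤ n := by exact_mod_cast hn
  have hn0 : (0 : ℝ) < n := by linarith
  simp only [Real.rpow_one] at h1
  set R := (n : ℝ) ^ (-(2 * α / (1 + 2 * α))) with hR
  set T : ℝ := (n : ℝ) ^ (1 / (1 + 2 * α)) with hT
  have hT0 : 0 < T := by positivity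
  have hT1 : T * (1 / n) = R := by
    rw [hT, hR, one_div (n : ℝ), ← Real.rpow_neg_one, ← Real.rpow_add hn0]
    congr 1
    field_simp
    ring
  have hT2 : T ^ (-(2 * α)) = R := by
    rw [hT, ← Real.rpow_mul hn0.le]
    congr 1
    ring
  have hT3 : (n : ℝ) * (1 / (n : ℝ) ^ 2) ≤ R := by
    have e : (n : ℝ) * (1 / (n : ℝ) ^ 2) = (n : ℝ) ^ (-1 : ℝ) := by
      rw [Real.rpow_neg_one]; field_simp
    rw [e]
    refine Real.rpow_le_rpow_of_exponent_le hn1 ?_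
    rw [neg_le_neg_iff, div_le_one (by linarith)]
    linarith
  have hX : ∀ j : ℕ, (0 : ℝ) < 2 ^ j := fun j => by positivity
  rw [← Finset.sum_filter_add_sum_filter_not S fun j => (2 : ℝ) ^ j ≤ T]
  have hs1 : ∑ j ∈ S with (2 : ℝ) ^ j ≤ T, (2 : ℝ) ^ j * min (1 / (n : ℝ))
      (((2 : ℝ) ^ j) ^ (-(2 * α + 1)) + 1 / (n : ℝ) ^ 2) ≤ C1 * R := by
    calc _ ≤ ∑ j ∈ S with (2 : ℝ) ^ j ≤ T, (2 : ℝ) ^ j * (1 / (n : ℝ)) :=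
          Finset.sum_le_sum fun j _ => mul_le_mul_of_nonneg_left (min_le_left _ _) (hX j).le
      _ ≤ C1 * T * (1 / n) := by
          rw [← Finset.sum_mul]
          gcongr
          exact h1 _ _ hT0 fun j hj => (Finset.mem_filter.1 hj).2
      _ = _ := by rw [mul_assoc, hT1]
  have hs2 : ∑ j ∈ S with ¬ (2 : ℝ) ^ j ≤ T, (2 : ℝ) ^ j * min (1 / (n : ℝ))
      (((2 : ℝ) ^ j) ^ (-(2 * α + 1)) + 1 / (n : ℝ) ^ 2) ≤ C2 * R + C1 * R := by
    calc _ ≤ ∑ j ∈ S with ¬ (2 : ℝ) ^ j ≤ T, (((2 : ℝ) ^ j) ^ (-(2 * α))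
            + (2 : ℝ) ^ j * (1 / (n : ℝ) ^ 2)) := Finset.sum_le_sum fun j _ => by
          have : (2 : ℝ) ^ j * ((2 : ℝ) ^ j) ^ (-(2 * α + 1)) = ((2 : ℝ) ^ j) ^ (-(2 * α)) := by
            rw [← Real.rpow_one_add' (hX j).le (by ring_nf; linarith)]
            congr 1
            ring
          rw [← this, ← mul_add]
          exact mul_le_mul_of_nonneg_left (min_le_right _ _) (hX j).le
      _ ≤ C2 * T ^ (-(2 * α)) + C1 * n * (1 / (n : ℝ) ^ 2) := by
          rw [Finset.sum_add_distrib, ← Finset.sum_mul]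
          gcongr
          · exact h2 _ _ hT0 fun j hj => (not_le.1 (Finset.mem_filter.1 hj).2).le
          · exact h1 _ _ hn0 fun j hj => hS j (Finset.mem_filter.1 hj).1
      _ ≤ _ := by
          rw [hT2, mul_assoc]
          gcongr
  exact (add_le_add hs1 hs2).trans (le_of_eq (by ring))

namespace IntervalWaveletBasis

variable {r : ℕ} (W : IntervalWaveletBasis r)

lemma card_nearIndices_le_of_le_one {x0 c : ℝ} (hc : 0 < c) {j : ℕ} (hj : W.j0 ≤ j)
    (h : (2 : ℝ) ^ j ≤ c⁻¹) : ((W.nearIndices x0 c j).card : ℝ) ≤ 2 * W.reach + 3 := by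
  have h1 := W.card_nearIndices_le (x0 := x0) hc.le hj
  have h2 : (2 : ℝ) ^ j * c ≤ 1 := by
    have := mul_le_mul_of_nonneg_right h hc.le
    rwa [inv_mul_cancel₀ hc.ne'] at this
  linarith

lemma card_nearIndices_le_mul {x0 c : ℝ} (hc : 0 < c) {j : ℕ} (hj : W.j0 ≤ j)
    (h : c⁻¹ ≤ (2 : ℝ) ^ j) :
    ((W.nearIndices x0 c j).card : ℝ) ≤ (2 * W.reach + 3) * ((2 : ℝ) ^ j * c) := by
  have h1 := W.card_nearIndices_le (x0 := x0) hc.le hj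
  have h2 : 1 ≤ (2 : ℝ) ^ j * c := by
    rwa [inv_le_iff_one_le_mul₀ hc] at h
  have h3 := W.one_le_reach
  nlinarith

lemma two_pow_of_lowLevel_le {c : ℝ} {j : ℕ} (h : W.lowLevel c ≤ j) : c⁻¹ ≤ (2 : ℝ) ^ j :=
  (le_two_pow_dyadicLevel _).trans
    (pow_le_pow_right₀ one_le_two ((le_max_left _ _).trans h))

lemma lowLevel_eq {c : ℝ} (h : (2 : ℝ) ^ W.j0 ≤ c⁻¹) : W.lowLevel c = dyadicLevel c⁻¹ := by
  refine max_eq_left ?_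
  have := h.trans (le_two_pow_dyadicLevel _)
  exact (pow_le_pow_iff_right₀ one_lt_two).1 this

/-- Squared coefficients of size `2 ^ (-j (2α + 1))` near a window of width `c`, from the level
where `2 ^ j ≥ c⁻¹` on. -/
lemma exists_sum_sq_near_le {α Cθ : ℝ} (hα : 0 < α) (hC : 0 ≤ Cθ) :
    ∃ C : ℝ, 0 < C ∧ ∀ x0 c T : ℝ, 0 < c → c⁻¹ ≤ T → ∀ a b : ℕ, W.j0 ≤ a → T ≤ (2 : ℝ) ^ a →
      ∀ d : ∀ j : ℕ, Fin (2 ^ j) → ℝ,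
      (∀ j, W.j0 ≤ j → ∀ k, d j k ^ 2 ≤ Cθ * ((2 : ℝ) ^ j) ^ (-(2 * α + 1))) →
      ∑ p ∈ W.nearSigma x0 c a b, d p.1 p.2 ^ 2 ≤ C * (c * T ^ (-(2 * α))) := by
  obtain ⟨C2, hC2, h2⟩ := exists_sum_dyadic_neg_le (s := 2 * α) (by linarith)
  have hD := W.one_le_reach
  refine ⟨(2 * W.reach + 3) * (Cθ + 1) * C2, by positivity,
    fun x0 c T hc hcT a b ha hTa d hd => ?_⟩
  have hT : 0 < T := (inv_pos.2 hc).trans_le hcT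
  have hTj : ∀ j ∈ Finset.Ico a b, T ≤ (2 : ℝ) ^ j := fun j hj =>
    hTa.trans (pow_le_pow_right₀ one_le_two (Finset.mem_Ico.1 hj).1)
  rw [nearSigma, Finset.sum_sigma]
  calc ∑ j ∈ Finset.Ico a b, ∑ k ∈ W.nearIndices x0 c j, d j k ^ 2
      ≤ ∑ j ∈ Finset.Ico a b, (2 * W.reach + 3) * (Cθ + 1) * c * ((2 : ℝ) ^ j) ^ (-(2 * α)) := by
        refine Finset.sum_le_sum fun j hj => ?_
        have hj0 : W.j0 ≤ j := ha.trans (Finset.mem_Ico.1 hj).1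
        have hX : (0 : ℝ) < 2 ^ j := by positivity
        have e : (2 : ℝ) ^ j * ((2 : ℝ) ^ j) ^ (-(2 * α + 1)) = ((2 : ℝ) ^ j) ^ (-(2 * α)) := by
          rw [← Real.rpow_one_add' hX.le (by ring_nf; linarith)]
          congr 1
          ring
        calc ∑ k ∈ W.nearIndices x0 c j, d j k ^ 2
            ≤ (W.nearIndices x0 c j).card • (Cθ * ((2 : ℝ) ^ j) ^ (-(2 * α + 1))) :=
              Finset.sum_le_card_nsmul _ _ _ fun k _ => hd j hj0 k
          _ ≤ (2 * W.reach + 3) * ((2 : ℝ) ^ j * c)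
              * ((Cθ + 1) * ((2 : ℝ) ^ j) ^ (-(2 * α + 1))) := by
              rw [nsmul_eq_mul]
              gcongr
              · exact W.card_nearIndices_le_mul hc hj0 (hcT.trans (hTj j hj))
              · linarith
          _ = _ := by rw [← e]; ring
    _ ≤ (2 * W.reach + 3) * (Cθ + 1) * c * (C2 * T ^ (-(2 * α))) := by
        rw [← Finset.mul_sum]
        gcongr
        exact h2 _ _ hT hTj
    _ = _ := by ring

end IntervalWaveletBasis

/-! ### Risk over a Hölder class -/

lemma two_le_log_of_eight_le {n : ℕ} (hn : 8 ≤ n) : 2 ≤ Real.log n := by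
  have h8 : (8 : ℝ) ≤ n := by exact_mod_cast hn
  rw [Real.le_log_iff_exp_le (by linarith)]
  refine le_trans ?_ h8
  have h1 := Real.exp_one_lt_d9
  have h0 := Real.exp_pos 1
  have : Real.exp 2 = Real.exp 1 ^ 2 := by rw [← Real.exp_nat_mul]; norm_num
  rw [this]
  nlinarith

namespace IntervalWaveletBasis

variable {r : ℕ} (W : IntervalWaveletBasis r)

lemma lowLevel_lt_highLevel {c : ℝ} {n : ℕ} (hc : 0 < c) (hc1 : c < 1)
    (hj0 : (2 : ℝ) ^ W.j0 ≤ c⁻¹) (hn : 8 ≤ n) : W.lowLevel c < highLevel c n := by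
  have h1 : (2 : ℝ) ^ dyadicLevel c⁻¹ < 2 * c⁻¹ :=
    two_pow_dyadicLevel_lt (one_lt_inv₀ hc |>.2 hc1)
  have h2 : c⁻¹ * Real.log n ≤ (2 : ℝ) ^ highLevel c n := le_two_pow_dyadicLevel _
  have h3 := two_le_log_of_eight_le hn
  have h4 : 2 * c⁻¹ ≤ c⁻¹ * Real.log n := by
    have := inv_pos.2 hc
    nlinarith
  rw [W.lowLevel_eq hj0]
  exact (pow_lt_pow_iff_right₀ one_lt_two).1 (h1.trans_le (h4.trans h2))

lemma exists_verticalCard_le :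
    ∃ C : ℝ, 0 < C ∧ ∀ (x0 c : ℝ) (n : ℕ), 0 < c → 8 ≤ n →
      (W.verticalCard x0 c n : ℝ) ≤ C * Real.log n := by
  obtain ⟨C1, hC1, h1⟩ := exists_sum_dyadic_le (s := 1) one_pos
  simp only [Real.rpow_one] at h1
  have hD := W.one_le_reach
  refine ⟨(2 * W.reach + 3) * C1, by positivity, fun x0 c n hc hn => ?_⟩
  have hl := two_le_log_of_eight_le hn
  have hci := inv_pos.2 hc
  rw [verticalCard]
  push_cast
  calc ∑ j ∈ Finset.Ico (W.lowLevel c) (highLevel c n), ((W.nearIndices x0 c j).card : ℝ)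
      ≤ ∑ j ∈ Finset.Ico (W.lowLevel c) (highLevel c n), (2 * W.reach + 3) * ((2 : ℝ) ^ j * c) :=
        Finset.sum_le_sum fun j hj => W.card_nearIndices_le_mul hc
          ((le_max_right _ _).trans (Finset.mem_Ico.1 hj).1)
          (W.two_pow_of_lowLevel_le (Finset.mem_Ico.1 hj).1)
    _ ≤ (2 * W.reach + 3) * (C1 * (c⁻¹ * Real.log n) * c) := by
        rw [← Finset.mul_sum, ← Finset.sum_mul]
        gcongr
        exact h1 _ _ (by positivity) fun j hj =>
          (two_pow_lt_of_lt_dyadicLevel (Finset.mem_Ico.1 hj).2).le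
    _ = _ := by field_simp

/-- The vertical block is long enough for the James–Stein rule: its top level alone contains
`log n` indices near the window. -/
lemma exists_le_verticalCard {x0 : ℝ} (hx0 : x0 ∈ Ioo (0 : ℝ) 1) :
    ∃ c0 : ℝ, 0 < c0 ∧ ∀ (c : ℝ) (n : ℕ), 0 < c → c ≤ c0 → 8 ≤ n →
      (2 : ℝ) ^ W.j0 ≤ c⁻¹ ∧ c < 1 ∧ Icc (x0 - c) (x0 + c) ⊆ Icc 0 1 ∧
      Real.log n - 1 ≤ (W.verticalCard x0 c n : ℝ) := by
  obtain ⟨A, hA⟩ := W.exists_card_nearIndices_ge hx0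
  have hx1 := hx0.1
  have hx2 : 0 < 1 - x0 := sub_pos.2 hx0.2
  refine ⟨min (min (x0 / 2) ((1 - x0) / 2)) (min (((2 : ℝ) ^ W.j0)⁻¹) (|A| + 1)⁻¹),
    by positivity, fun c n hc hc0 hn => ?_⟩
  have g1 : c ≤ x0 / 2 := hc0.trans ((min_le_left _ _).trans (min_le_left _ _))
  have g2 : c ≤ (1 - x0) / 2 := hc0.trans ((min_le_left _ _).trans (min_le_right _ _))
  have g3 : c ≤ ((2 : ℝ) ^ W.j0)⁻¹ := hc0.trans ((min_le_right _ _).trans (min_le_left _ _))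
  have g4 : c ≤ (|A| + 1)⁻¹ := hc0.trans ((min_le_right _ _).trans (min_le_right _ _))
  have hc1 : c < 1 := by linarith
  have hj0 : (2 : ℝ) ^ W.j0 ≤ c⁻¹ := (le_inv_comm₀ hc (by positivity)).1 g3
  have hA1 : |A| + 1 ≤ c⁻¹ := (le_inv_comm₀ hc (by positivity)).1 g4
  refine ⟨hj0, hc1, Icc_subset_Icc (by linarith) (by linarith), ?_⟩
  have hlt := W.lowLevel_lt_highLevel hc hc1 hj0 hn
  obtain ⟨J, hJ⟩ : ∃ J, highLevel c n = J + 1 := ⟨highLevel c n - 1, by omega⟩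
  have hJl : W.lowLevel c ≤ J := by omega
  have hcJ := W.two_pow_of_lowLevel_le hJl
  have h1 := hA c J hc.le g1 g2 (by linarith [le_abs_self A])
  have h2 : c⁻¹ * Real.log n ≤ (2 : ℝ) ^ (J + 1) := hJ ▸ le_two_pow_dyadicLevel _
  have h3 : Real.log n ≤ 2 ^ J * (2 * c) := by
    have := mul_le_mul_of_nonneg_right h2 hc.le
    rw [mul_right_comm, inv_mul_cancel₀ hc.ne', one_mul, pow_succ] at this
    linarith
  have h4 : ((W.nearIndices x0 c J).card : ℝ) ≤ W.verticalCard x0 c n := by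
    rw [verticalCard]
    exact_mod_cast Finset.single_le_sum
      (f := fun j => (W.nearIndices x0 c j).card) (fun _ _ => Nat.zero_le _)
      (Finset.mem_Ico.2 ⟨hJl, by omega⟩)
  linarith

/-- From the level `J^*` on a block is no longer than the window, so that the blocks which meet the
indices near the window contain about `2 ^ j c` indices. -/
lemma card_nearBlocks_mul_le {x0 c : ℝ} (hc : 0 < c) {j n : ℕ} (hj : W.j0 ≤ j) (hn : 8 ≤ n)
    (hjh : highLevel c n ≤ j) :
    (((W.nearIndices x0 c j).image fun k : Fin (2 ^ j) => (k : ℕ) / blockLength n).card : ℝ)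
      * blockLength n ≤ (2 * W.reach + 6) * ((2 : ℝ) ^ j * c) := by
  have hlog := two_le_log_of_eight_le hn
  have hL0 : 0 < blockLength n := Nat.ceil_pos.2 (by linarith)
  have hL0' : (0 : ℝ) < blockLength n := by exact_mod_cast hL0
  have hL : (blockLength n : ℝ) ≤ 2 * Real.log n := by
    have := Nat.ceil_lt_add_one (a := Real.log n) (by linarith)
    rw [blockLength]
    linarith
  have hX : Real.log n ≤ (2 : ℝ) ^ j * c := by
    have h2 : c⁻¹ * Real.log n ≤ (2 : ℝ) ^ j :=
      (le_two_pow_dyadicLevel _).trans (pow_le_pow_right₀ one_le_two hjh)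
    have := mul_le_mul_of_nonneg_right h2 hc.le
    rwa [mul_right_comm, inv_mul_cancel₀ hc.ne', one_mul] at this
  have h1 := mul_le_mul_of_nonneg_right (W.card_nearBlocks_le (x0 := x0) hc.le hj hL0) hL0'.le
  refine h1.trans ?_
  rw [add_mul, div_mul_cancel₀ _ hL0'.ne']
  have hD := W.one_le_reach
  nlinarith

variable {Ω : Type*} [MeasurableSpace Ω] {P : Measure Ω} {B : ℝ≥0 → Ω → ℝ}

/-- The levels from `J_*` on split into the vertical block, the horizontal blocks and the levels
where nothing is estimated. -/
lemma upperExp_coeffError_split {lam x0 c : ℝ} {n : ℕ} {f : ℝ → ℝ} {uv ub : ℝ} {uh : ℕ → ℝ}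
    (hv : UpperExpLE P (fun ω => ∑ p ∈ W.nearSigma x0 c (W.lowLevel c) (highLevel c n),
      W.coeffError B lam x0 c n f p.1 p.2 ω ^ 2) uv)
    (hh : ∀ j ∈ Finset.Ico (highLevel c n) (dyadicLevel n), UpperExpLE P
      (fun ω => ∑ k ∈ W.nearIndices x0 c j, W.coeffError B lam x0 c n f j k ω ^ 2) (uh j))
    (N : ℕ) (hb : ∑ p ∈ W.nearSigma x0 c (max (highLevel c n) (dyadicLevel n)) N,
      W.coeff f p.1 p.2 ^ 2 ≤ ub) [IsProbabilityMeasure P] :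
    UpperExpLE P (fun ω => ∑ p ∈ W.nearSigma x0 c (W.lowLevel c) N,
      W.coeffError B lam x0 c n f p.1 p.2 ω ^ 2)
      (uv + ∑ j ∈ Finset.Ico (highLevel c n) (dyadicLevel n), uh j + ub) := by
  refine ((hv.add (UpperExpLE.sum _ hh)).add (UpperExpLE.const ub)).mono
    (ae_of_all _ fun ω => ?_) le_rfl
  set g : ℕ → ℝ := fun j => ∑ k ∈ W.nearIndices x0 c j, W.coeffError B lam x0 c n f j k ω ^ 2
    with hg
  have hg0 : ∀ j, 0 ≤ g j := fun j => Finset.sum_nonneg fun _ _ => sq_nonneg _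
  set m := max (highLevel c n) (dyadicLevel n) with hm
  have hb' : ∑ j ∈ Finset.Ico m N, g j ≤ ub := by
    refine le_trans (le_of_eq ?_) hb
    rw [nearSigma, Finset.sum_sigma]
    refine Finset.sum_congr rfl fun j hj => Finset.sum_congr rfl fun k _ => ?_
    have h1 := (Finset.mem_Ico.1 hj).1
    rw [W.coeffError_high ((le_max_left _ _).trans h1) ((le_max_right _ _).trans h1), neg_sq]
  simp only [nearSigma, Finset.sum_sigma]
  change ∑ j ∈ Finset.Ico (W.lowLevel c) N, g j
    ≤ ∑ j ∈ Finset.Ico (W.lowLevel c) (highLevel c n), g j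
      + ∑ j ∈ Finset.Ico (highLevel c n) (dyadicLevel n), g j + ub
  have hun : ∀ s t : Finset ℕ, ∑ j ∈ s ∪ t, g j ≤ ∑ j ∈ s, g j + ∑ j ∈ t, g j := fun s t => by
    rw [← Finset.sum_union_inter]
    exact le_add_of_nonneg_right (Finset.sum_nonneg fun j _ => hg0 j)
  have hsub : Finset.Ico (W.lowLevel c) N ⊆ (Finset.Ico (W.lowLevel c) (highLevel c n)
      ∪ Finset.Ico (highLevel c n) (dyadicLevel n)) ∪ Finset.Ico m N := fun j hj => by
    simp only [Finset.mem_union, Finset.mem_Ico] at hj ⊢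
    omega
  refine (Finset.sum_le_sum_of_subset_of_nonneg hsub fun j _ _ => hg0 j).trans
    ((hun _ _).trans (add_le_add (hun _ _) hb'))

set_option maxHeartbeats 800000 in
/-- Total squared error of the coefficients near the window from the level `J_*` on. The two bounds
come from the two bounds for the vertical block: the noise in its `≈ log n` coefficients, or the
sum `≈ c ^ (2α + 1)` of their squares. -/
lemma exists_upperExp_high (hr : 1 ≤ r) (hB : IsBrownianReal B P) {lam x0 : ℝ}
    (hlam : 1 < lam) (hlam_eq : lam - Real.log lam - 1 = 2) (hx0 : x0 ∈ Ioo (0 : ℝ) 1)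
    {α M : ℝ} (hα : 0 < α) (hαr : α < r) (hM : 0 < M) :
    ∃ C : ℝ, 0 < C ∧ ∃ c0 : ℝ, 0 < c0 ∧ ∀ f ∈ holderClass α M, ∀ n : ℕ, 8 ≤ n → ∀ c : ℝ,
      (n : ℝ)⁻¹ ≤ c → c ≤ c0 → ∀ N,
      UpperExpLE P (fun ω => ∑ p ∈ W.nearSigma x0 c (W.lowLevel c) N,
        W.coeffError B lam x0 c n f p.1 p.2 ω ^ 2)
        (C * c * ((n : ℝ) ^ (-(2 * α / (1 + 2 * α))) + c⁻¹ * (Real.log n / n))) ∧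
      UpperExpLE P (fun ω => ∑ p ∈ W.nearSigma x0 c (W.lowLevel c) N,
        W.coeffError B lam x0 c n f p.1 p.2 ω ^ 2)
        (C * c * ((n : ℝ) ^ (-(2 * α / (1 + 2 * α))) + c ^ (2 * α))) := by
  have hP : IsProbabilityMeasure P := hB.isGaussianProcess.isProbabilityMeasure
  obtain ⟨Cθ, hCθ, hcoeff⟩ := W.exists_coeff_sq_le hα hαr hM
  obtain ⟨Cs, hCs, hsq⟩ := W.exists_sum_sq_near_le hα hCθ.le
  obtain ⟨Cv, hCv, hvert⟩ := W.exists_verticalCard_le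
  obtain ⟨Ch, hCh, hhor⟩ := exists_sum_high_le hα
  obtain ⟨c0, hc0, hlow⟩ := W.exists_le_verticalCard hx0
  have hbC : 0 < blockConst lam := by
    rw [blockConst]; exact div_pos (by linarith) (by linarith)
  have hD := W.one_le_reach
  set K : ℝ := (2 * W.reach + 6) * (18 * Cθ + blockConst lam + (2 * lam + 2)) with hK
  have hK0 : 0 < K := by positivity
  refine ⟨(2 * lam + 2) * Cv + 18 * Cs + 3 * blockConst lam + K * Ch + Cs, by positivity, c0, hc0,
    fun f hf n hn c hcn hcc0 N => ?_⟩
  have hf' := continuousOn_of_mem_holderClass hf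
  have hn8 : (8 : ℝ) ≤ n := by exact_mod_cast hn
  have hn0 : (0 : ℝ) < n := by linarith
  have hc : 0 < c := (inv_pos.2 hn0).trans_le hcn
  obtain ⟨hj0, hc1, -, hLv⟩ := hlow c n hc hcc0 hn
  have hlog := two_le_log_of_eight_le hn
  have hnc : 1 / (n : ℝ) ≤ c := by rwa [one_div]
  set R := (n : ℝ) ^ (-(2 * α / (1 + 2 * α))) with hR
  have hR1 : 1 / (n : ℝ) ≤ R := by
    rw [one_div, ← Real.rpow_neg_one]
    refine Real.rpow_le_rpow_of_exponent_le (by linarith) ?_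
    rw [neg_le_neg_iff, div_le_one (by linarith)]
    linarith
  have hR0 : 0 < R := by positivity
  have hJs := W.lowLevel_lt_highLevel hc hc1 hj0 hn
  have hJ0 : W.j0 ≤ W.lowLevel c := le_max_right _ _
  -- the horizontal blocks
  set uh : ℕ → ℝ := fun j => K * c * ((2 : ℝ) ^ j * min (1 / (n : ℝ))
    (((2 : ℝ) ^ j) ^ (-(2 * α + 1)) + 1 / (n : ℝ) ^ 2)) with huh
  have hh : ∀ j ∈ Finset.Ico (highLevel c n) (dyadicLevel n), UpperExpLE P
      (fun ω => ∑ k ∈ W.nearIndices x0 c j, W.coeffError B lam x0 c n f j k ω ^ 2) (uh j) := by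
    intro j hj
    obtain ⟨hj1, hj2⟩ := Finset.mem_Ico.1 hj
    have hjj0 : W.j0 ≤ j := hJ0.trans (hJs.le.trans hj1)
    have hX : (0 : ℝ) < 2 ^ j := by positivity
    have hnb := W.card_nearBlocks_mul_le (x0 := x0) hc hjj0 hn hj1
    obtain ⟨b1, b2⟩ := W.upperExp_coeffError_horizontal (x0 := x0) hr hB hlam hlam_eq hf'
      (by omega) hjj0 hj1 hj2 (hcoeff f hf j hjj0)
    set nb : ℝ := (((W.nearIndices x0 c j).image
      fun k : Fin (2 ^ j) => (k : ℕ) / blockLength n).card : ℝ) with hnbdef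
    have hnb0 : 0 ≤ nb := by positivity
    have hL1 : (1 : ℝ) ≤ blockLength n := by
      exact_mod_cast Nat.ceil_pos.2 (by linarith : 0 < Real.log n)
    have hexp : Real.exp (-(blockLength n : ℝ)) ≤ 1 / n := by
      have : Real.exp (-(blockLength n : ℝ)) ≤ Real.exp (-Real.log n) :=
        Real.exp_le_exp.2 (neg_le_neg (Nat.le_ceil _))
      rwa [Real.exp_neg (Real.log n), Real.exp_log hn0, ← one_div] at this
    set Y := (2 * W.reach + 6) * ((2 : ℝ) ^ j * c) with hY
    have hY0 : 0 ≤ Y := by positivity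
    have hnbY : nb ≤ Y := (le_mul_of_one_le_right hnb0 hL1).trans hnb
    set x := ((2 : ℝ) ^ j) ^ (-(2 * α + 1)) with hx
    have hx' : 0 < x := by positivity
    have e : uh j = min (K * c * (2 : ℝ) ^ j * (1 / (n : ℝ)))
        (K * c * (2 : ℝ) ^ j * (x + 1 / (n : ℝ) ^ 2)) := by
      rw [huh, ← mul_min_of_nonneg _ _ (by positivity : 0 ≤ K * c * (2 : ℝ) ^ j)]
      ring
    rw [e]
    refine (b2.mono (EventuallyLE.refl _ _) ?_).min (b1.mono (EventuallyLE.refl _ _) ?_)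
    · calc nb * ((2 * lam + 2) * (blockLength n / n))
          = (2 * lam + 2) * (nb * blockLength n) * (1 / n) := by ring
        _ ≤ (18 * Cθ + blockConst lam + (2 * lam + 2)) * Y * (1 / n) := by
            refine mul_le_mul_of_nonneg_right (mul_le_mul (by linarith) hnb (by positivity)
              (by positivity)) (by positivity)
        _ = _ := by rw [hY, hK]; ring
    · calc nb * (18 * (blockLength n * (Cθ * x))
            + blockConst lam * Real.exp (-(blockLength n : ℝ)) / n)
          = 18 * Cθ * (nb * blockLength n) * x
            + blockConst lam * nb * Real.exp (-(blockLength n : ℝ)) * (1 / n) := by ring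
        _ ≤ 18 * Cθ * Y * x + blockConst lam * Y * (1 / n) * (1 / n) := by gcongr
        _ ≤ (18 * Cθ + blockConst lam + (2 * lam + 2)) * Y * (x + 1 / (n : ℝ) ^ 2) := by
            have e2 : (1 / (n : ℝ)) * (1 / n) = 1 / (n : ℝ) ^ 2 := by ring
            rw [mul_assoc _ (1 / (n : ℝ)), e2]
            have hz : 0 < 1 / (n : ℝ) ^ 2 := by positivity
            have t1 : 0 ≤ Y * x := by positivity
            have t2 : 0 ≤ Y * (1 / (n : ℝ) ^ 2) := by positivity
            have t3 := mul_nonneg hbC.le t1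
            have t4 := mul_nonneg hCθ.le t2
            have t5 := mul_nonneg (by linarith : 0 ≤ 2 * lam + 2) t1
            have t6 := mul_nonneg (by linarith : 0 ≤ 2 * lam + 2) t2
            linarith
        _ = _ := by rw [hY, hK]; ring
  have huhs : ∑ j ∈ Finset.Ico (highLevel c n) (dyadicLevel n), uh j ≤ K * c * (Ch * R) := by
    rw [huh, ← Finset.mul_sum]
    gcongr
    exact hhor n (by omega) _ fun j hj =>
      (two_pow_lt_of_lt_dyadicLevel (Finset.mem_Ico.1 hj).2).le
  -- the levels which are not estimated
  have hb : ∑ p ∈ W.nearSigma x0 c (max (highLevel c n) (dyadicLevel n)) N,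
      W.coeff f p.1 p.2 ^ 2 ≤ Cs * (c * R) := by
    refine (hsq x0 c n hc (inv_le_of_inv_le₀ hn0 hcn) _ N
      (hJ0.trans (hJs.le.trans (le_max_left _ _)))
      ((le_two_pow_dyadicLevel _).trans (pow_le_pow_right₀ one_le_two (le_max_right _ _)))
      _ (hcoeff f hf)).trans ?_
    gcongr
    rw [hR]
    refine Real.rpow_le_rpow_of_exponent_le (by linarith) ?_
    exact neg_le_neg (div_le_self (by linarith) (by linarith))
  -- the vertical block
  obtain ⟨v1, v2⟩ := W.upperExp_coeffError_vertical (x0 := x0) (c := c) hr hB hlam hlam_eq hf'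
    (by omega : 3 ≤ n)
  have hθ : ∑ p ∈ W.nearSigma x0 c (W.lowLevel c) (highLevel c n), W.coeff f p.1 p.2 ^ 2
      ≤ Cs * (c * c ^ (2 * α)) := by
    refine (hsq x0 c c⁻¹ hc le_rfl _ _ hJ0 (W.two_pow_of_lowLevel_le le_rfl) _
      (hcoeff f hf)).trans (le_of_eq ?_)
    rw [Real.inv_rpow hc.le, ← Real.rpow_neg hc.le, neg_neg]
  have hev : Real.exp (-(W.verticalCard x0 c n : ℝ)) ≤ 3 * (1 / n) := by
    have : Real.exp (-(W.verticalCard x0 c n : ℝ)) ≤ Real.exp (1 - Real.log n) :=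
      Real.exp_le_exp.2 (by linarith)
    rw [Real.exp_sub, Real.exp_log hn0] at this
    refine this.trans ?_
    rw [div_eq_mul_one_div]
    gcongr
    exact Real.exp_one_lt_d9.le.trans (by norm_num)
  have hc2 : 0 < c ^ (2 * α) := by positivity
  have hl0 : 0 < Real.log n / n := by positivity
  have hcR : 0 < c * R := by positivity
  constructor
  · refine (W.upperExp_coeffError_split v2 hh N hb).mono (EventuallyLE.refl _ _) ?_
    have g1 : (2 * lam + 2) * ((W.verticalCard x0 c n : ℝ) / n)
        ≤ (2 * lam + 2) * (Cv * (Real.log n / n)) := by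
      rw [← mul_div_assoc Cv]
      gcongr
      exact hvert x0 c n hc hn
    have e : ∀ Z : ℝ, Z * c * (R + c⁻¹ * (Real.log n / n)) = Z * (c * R) + Z * (Real.log n / n) :=
      fun Z => by field_simp
    rw [e]
    have p1 : 0 ≤ ((2 * lam + 2) * Cv + 18 * Cs + 3 * blockConst lam) * (c * R) := by positivity
    have p2 : 0 ≤ (18 * Cs + 3 * blockConst lam + K * Ch + Cs) * (Real.log n / n) := by
      positivity
    linarith
  · refine (W.upperExp_coeffError_split v1 hh N hb).mono (EventuallyLE.refl _ _) ?_
    have g2 : blockConst lam * Real.exp (-(W.verticalCard x0 c n : ℝ)) / n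
        ≤ 3 * blockConst lam * (c * R) := by
      calc blockConst lam * Real.exp (-(W.verticalCard x0 c n : ℝ)) / n
          ≤ blockConst lam * (3 * (1 / n)) / n := by gcongr
        _ = 3 * blockConst lam * (1 / n * (1 / n)) := by ring
        _ ≤ 3 * blockConst lam * (c * R) := by gcongr
    have e : ∀ Z : ℝ, Z * c * (R + c ^ (2 * α)) = Z * (c * R) + Z * (c * c ^ (2 * α)) :=
      fun Z => by ring
    rw [e]
    have hcc : 0 < c * c ^ (2 * α) := by positivity
    have p1 : 0 ≤ ((2 * lam + 2) * Cv + 18 * Cs) * (c * R) := by positivity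
    have p2 : 0 ≤ ((2 * lam + 2) * Cv + 3 * blockConst lam + K * Ch + Cs)
        * (c * c ^ (2 * α)) := by positivity
    linarith

/-- The maximum risk at sample size `n`. The first bound is good for small `α`, where every
coefficient of the levels below `J^*` can be charged with the noise level; the second one for large
`α`, where the coefficients themselves are small. -/
lemma exists_risk_le (hr : 1 ≤ r) (hB : IsBrownianReal B P) {lam x0 : ℝ}
    (hlam : 1 < lam) (hlam_eq : lam - Real.log lam - 1 = 2) (hx0 : x0 ∈ Ioo (0 : ℝ) 1)
    {α M : ℝ} (hα : 0 < α) (hαr : α < r) (hM : 0 < M) :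
    ∃ C : ℝ, 0 < C ∧ ∃ c0 : ℝ, 0 < c0 ∧ ∀ n : ℕ, 8 ≤ n → ∀ c : ℝ,
      (n : ℝ)⁻¹ ≤ c → c ≤ c0 →
      maxRisk P B (W.estimator lam x0 c n) n x0 c α M ≤ ENNReal.ofReal
        (C * ((n : ℝ) ^ (-(2 * α / (1 + 2 * α))) + c⁻¹ * (Real.log n / n))) ∧
      maxRisk P B (W.estimator lam x0 c n) n x0 c α M ≤ ENNReal.ofReal
        (C * ((n : ℝ) ^ (-(2 * α / (1 + 2 * α))) + c ^ (2 * α)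
          + (Real.log n / n) ^ (2 * α / (1 + 2 * α)))) := by
  obtain ⟨Cθ, hCθ, hcoeff⟩ := W.exists_coeff_sq_le hα hαr hM
  obtain ⟨Cu, hCu, c1, hc1, hU⟩ := W.exists_upperExp_high hr hB hlam hlam_eq hx0 hα hαr hM
  obtain ⟨Cl, hCl, hlowsum⟩ := exists_sum_low_le hα hCθ.le
  obtain ⟨c2, hc2, hvc⟩ := W.exists_le_verticalCard hx0
  obtain ⟨Kφ, hKφ, hφ⟩ := W.exists_father_bound
  obtain ⟨Kψ, hKψ, hψ⟩ := W.exists_mother_bound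
  have hD := W.one_le_reach
  set K1 : ℝ := 8 * ((2 : ℝ) ^ W.j0 * Kφ) ^ 2 with hK1
  set K2 : ℝ := (2 * W.reach + 3) * Kψ * Cl with hK2
  have hK1p : 0 < K1 := by positivity
  have hK2p : 0 < K2 := by positivity
  refine ⟨K1 + 8 * K2 ^ 2 + 2 * Cu + 1, by positivity, min c1 c2, lt_min hc1 hc2,
    fun n hn c hcn hc0 => ?_⟩
  have hn8 : (8 : ℝ) ≤ n := by exact_mod_cast hn
  have hn0 : (0 : ℝ) < n := by linarith
  have hc : 0 < c := (inv_pos.2 hn0).trans_le hcn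
  obtain ⟨hj0, hclt, hI, -⟩ := hvc c n hc (hc0.trans (min_le_right _ _)) hn
  have hlog := two_le_log_of_eight_le hn
  set R := (n : ℝ) ^ (-(2 * α / (1 + 2 * α))) with hR
  have hR1 : 1 / (n : ℝ) ≤ R := by
    rw [one_div, ← Real.rpow_neg_one]
    refine Real.rpow_le_rpow_of_exponent_le (by linarith) ?_
    rw [neg_le_neg_iff, div_le_one (by linarith)]
    linarith
  have hR0 : 0 < R := by positivity
  set l := Real.log n / n with hl
  have hl0 : 0 < l := by positivity
  set τ : ℕ → ℝ := fun j => √(min (6 * l)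
    (8 * (Cθ * ((2 : ℝ) ^ j) ^ (-(2 * α + 1))) + 4 / (n : ℝ) ^ 2)) with hτ
  have hτ0 : ∀ j, 0 < τ j := fun j => Real.sqrt_pos.2 (lt_min (by positivity) (by positivity))
  have hτ2 : ∀ j, τ j ^ 2 = min (6 * l)
      (8 * (Cθ * ((2 : ℝ) ^ j) ^ (-(2 * α + 1))) + 4 / (n : ℝ) ^ 2) := fun j =>
    Real.sq_sqrt (le_min (by positivity) (by positivity))
  have hJs := W.lowLevel_lt_highLevel hc hclt hj0 hn
  have hSlow : ∀ j ∈ Finset.Ico W.j0 (W.lowLevel c), (2 : ℝ) ^ j ≤ c⁻¹ := fun j hj => by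
    have := (Finset.mem_Ico.1 hj).2
    rw [W.lowLevel_eq hj0] at this
    exact (two_pow_lt_of_lt_dyadicLevel this).le
  obtain ⟨s1, s2⟩ := hlowsum n (by omega) c hcn _ hSlow
  have hS : ∑ p ∈ W.nearSigma x0 c W.j0 (W.lowLevel c), Kψ * √((2 : ℝ) ^ p.1) * τ p.1
      ≤ (2 * W.reach + 3) * Kψ
        * ∑ j ∈ Finset.Ico W.j0 (W.lowLevel c), √((2 : ℝ) ^ j) * τ j := by
    rw [nearSigma, Finset.sum_sigma, Finset.mul_sum]
    refine Finset.sum_le_sum fun j hj => ?_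
    have e : ∑ _k ∈ W.nearIndices x0 c j, Kψ * √((2 : ℝ) ^ j) * τ j
        = (W.nearIndices x0 c j).card * (Kψ * √((2 : ℝ) ^ j) * τ j) := by
      rw [Finset.sum_const, nsmul_eq_mul]
    refine e.trans_le ?_
    have := W.card_nearIndices_le_of_le_one (x0 := x0) hc (Finset.mem_Ico.1 hj).1 (hSlow j hj)
    have hτj := hτ0 j
    calc _ ≤ (2 * W.reach + 3) * (Kψ * √((2 : ℝ) ^ j) * τ j) := by gcongr
      _ = _ := by ring
  have hS0 : 0 ≤ ∑ p ∈ W.nearSigma x0 c W.j0 (W.lowLevel c), Kψ * √((2 : ℝ) ^ p.1) * τ p.1 :=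
    Finset.sum_nonneg fun p _ => by have := hτ0 p.1; positivity
  have hrisk : ∀ f ∈ holderClass α M, ∀ U : ℝ, (∀ N, UpperExpLE P
      (fun ω => ∑ p ∈ W.nearSigma x0 c (W.lowLevel c) N,
        W.coeffError B lam x0 c n f p.1 p.2 ω ^ 2) U) →
      risk P B (W.estimator lam x0 c n) n x0 c f ≤ ENNReal.ofReal (K1 / n
        + 8 * (∑ p ∈ W.nearSigma x0 c W.j0 (W.lowLevel c), Kψ * √((2 : ℝ) ^ p.1) * τ p.1) ^ 2
        + 2 * U / c + 1 / n) := by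
    intro f hf U hUf
    have hf' := continuousOn_of_mem_holderClass hf
    refine W.risk_le hr hB hf' (by omega) hKφ.le hφ hKψ.le hψ hc hI hτ0 (fun p hp => ?_) hUf
    obtain ⟨hp1, hp2⟩ := Finset.mem_Ico.1 (Finset.mem_sigma.1 hp).1
    obtain ⟨q1, q2⟩ := W.upperExp_coeffError_low (lam := lam) (x0 := x0) hr hB hf'
      (by omega : 3 ≤ n) hJs.le hp1 hp2 p.2
    rw [hτ2]
    refine q2.min (q1.mono (EventuallyLE.refl _ _) ?_)
    have := hcoeff f hf p.1 hp1 p.2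
    linarith
  have hKR : K1 / n + 1 / n ≤ (K1 + 1) * R := by
    rw [← add_div, div_eq_mul_one_div]
    gcongr
  constructor
  · refine iSup₂_le fun f hf => (hrisk f hf _ fun N =>
      (hU f hf n hn c hcn (hc0.trans (min_le_left _ _)) N).1).trans
      (ENNReal.ofReal_le_ofReal ?_)
    have hsum : (∑ p ∈ W.nearSigma x0 c W.j0 (W.lowLevel c),
        Kψ * √((2 : ℝ) ^ p.1) * τ p.1) ^ 2 ≤ K2 ^ 2 * (c⁻¹ * l) := by
      have : _ ≤ K2 * √(c⁻¹ * l) := hS.trans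
        ((mul_le_mul_of_nonneg_left s1 (by positivity)).trans (le_of_eq (by rw [hK2]; ring)))
      calc _ ≤ (K2 * √(c⁻¹ * l)) ^ 2 := by gcongr
        _ = _ := by rw [mul_pow, Real.sq_sqrt (by positivity)]
    have e : 2 * (Cu * c * (R + c⁻¹ * l)) / c = 2 * Cu * R + 2 * Cu * (c⁻¹ * l) := by
      field_simp
    rw [e]
    have hcl : 0 < c⁻¹ * l := by positivity
    have p1 : 0 ≤ 8 * K2 ^ 2 * R := by positivity
    have p2 : 0 ≤ (K1 + 1) * (c⁻¹ * l) := by positivity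
    linarith
  · refine iSup₂_le fun f hf => (hrisk f hf _ fun N =>
      (hU f hf n hn c hcn (hc0.trans (min_le_left _ _)) N).2).trans
      (ENNReal.ofReal_le_ofReal ?_)
    have hsum : (∑ p ∈ W.nearSigma x0 c W.j0 (W.lowLevel c),
        Kψ * √((2 : ℝ) ^ p.1) * τ p.1) ^ 2 ≤ K2 ^ 2 * l ^ (2 * α / (1 + 2 * α)) := by
      have : _ ≤ K2 * l ^ (α / (1 + 2 * α)) := hS.trans
        ((mul_le_mul_of_nonneg_left s2 (by positivity)).trans (le_of_eq (by rw [hK2]; ring)))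
      calc _ ≤ (K2 * l ^ (α / (1 + 2 * α))) ^ 2 := by gcongr
        _ = _ := by
          rw [mul_pow, ← Real.rpow_natCast (l ^ _), ← Real.rpow_mul hl0.le]
          congr 2
          push_cast
          ring
    have e : 2 * (Cu * c * (R + c ^ (2 * α))) / c = 2 * Cu * R + 2 * Cu * c ^ (2 * α) := by
      field_simp
    rw [e]
    have hcl : 0 < c ^ (2 * α) := by positivity
    have hll : 0 < l ^ (2 * α / (1 + 2 * α)) := by positivity
    have p1 : 0 ≤ 8 * K2 ^ 2 * R := by positivity
    have p2 : 0 ≤ (K1 + 8 * K2 ^ 2 + 1) * c ^ (2 * α) := by positivity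
    have p3 : 0 ≤ (K1 + 2 * Cu + 1) * l ^ (2 * α / (1 + 2 * α)) := by positivity
    linarith

end IntervalWaveletBasis

/-! ### Rates of convergence -/

lemma limsup_lt_top_of_eventually_le {u : ℕ → ℝ≥0∞} {C : ℝ}
    (h : ∀ᶠ n in atTop, u n ≤ ENNReal.ofReal C) : limsup u atTop < ⊤ :=
  (limsup_le_of_le (h := h)).trans_lt ENNReal.ofReal_lt_top

lemma eventually_rpow_neg_le {γ c0 : ℝ} (hγ : 0 < γ) (hc0 : 0 < c0) :
    ∀ᶠ n : ℕ in atTop, (n : ℝ) ^ (-γ) ≤ c0 :=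
  (((tendsto_rpow_neg_atTop hγ).comp tendsto_natCast_atTop_atTop).eventually_le_const hc0)

namespace IntervalWaveletBasis

variable {r : ℕ} (W : IntervalWaveletBasis r) {Ω : Type*} [MeasurableSpace Ω] {P : Measure Ω}
  {B : ℝ≥0 → Ω → ℝ}

/-- Below the critical smoothness the estimator attains the rate without logarithmic factor. -/
theorem limsup_maxRisk_lt_top_of_lt (hB : IsBrownianReal B P)
    {lam : ℝ} (hlam : 1 < lam) (hlam_eq : lam - Real.log lam - 1 = 2)
    {x0 γ : ℝ} (hx0 : x0 ∈ Ioo (0 : ℝ) 1) (hγ : γ ∈ Ioo (0 : ℝ) 1)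
    (hr : (1 - γ) / (2 * γ) < r) {α M : ℝ} (hα : 0 < α) (hαγ : α < (1 - γ) / (2 * γ))
    (hM : 0 < M) :
    limsup (fun n : ℕ => ENNReal.ofReal ((n : ℝ) ^ (2 * α / (1 + 2 * α))) *
      maxRisk P B (W.estimator lam x0 ((n : ℝ) ^ (-γ)) n) n x0 ((n : ℝ) ^ (-γ)) α M)
      atTop < ⊤ := by
  obtain ⟨hγ0, hγ1⟩ := hγ
  have hr1 : 1 ≤ r := Nat.one_le_iff_ne_zero.2 fun h => by
    rw [h, Nat.cast_zero] at hr
    linarith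
  obtain ⟨C, hC, c0, hc0, h⟩ := W.exists_risk_le hr1 hB hlam hlam_eq hx0 hα (hαγ.trans hr) hM
  set e := 2 * α / (1 + 2 * α) with he
  -- `c⁻¹ / n` is smaller than `n ^ (-e)` by the power `n ^ (-δ)`, which absorbs the logarithm
  set δ := 1 - γ - e with hδ
  have hδ0 : 0 < δ := by
    rw [lt_div_iff₀ (by linarith)] at hαγ
    rw [hδ, sub_pos, he, div_lt_iff₀ (by linarith)]
    nlinarith
  refine limsup_lt_top_of_eventually_le (C := C * (1 + 1 / δ)) ?_
  filter_upwards [eventually_ge_atTop 8, eventually_rpow_neg_le hγ0 hc0] with n hn hnc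
  have hn8 : (8 : ℝ) ≤ n := by exact_mod_cast hn
  have hn0 : (0 : ℝ) < n := by linarith
  have hcn : (n : ℝ)⁻¹ ≤ (n : ℝ) ^ (-γ) := by
    rw [← Real.rpow_neg_one]
    exact Real.rpow_le_rpow_of_exponent_le (by linarith) (by linarith)
  refine (mul_le_mul_right (h n hn _ hcn hnc).1 _).trans ?_
  rw [← ENNReal.ofReal_mul (by positivity)]
  refine ENNReal.ofReal_le_ofReal ?_
  have hlog : Real.log n ≤ (n : ℝ) ^ δ / δ := Real.log_le_rpow_div hn0.le hδ0
  have e1 : (n : ℝ) ^ e * (n : ℝ) ^ (-e) = 1 := by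
    rw [← Real.rpow_add hn0, add_neg_cancel, Real.rpow_zero]
  have e2 : (n : ℝ) ^ e * (((n : ℝ) ^ (-γ))⁻¹ * (((n : ℝ) ^ δ / δ) / n)) = 1 / δ := by
    have : (n : ℝ) ^ e * (n : ℝ) ^ γ * (n : ℝ) ^ δ = n := by
      rw [← Real.rpow_add hn0, ← Real.rpow_add hn0, hδ]
      conv_rhs => rw [← Real.rpow_one (n : ℝ)]
      congr 1
      ring
    rw [Real.rpow_neg hn0.le, inv_inv]
    calc (n : ℝ) ^ e * ((n : ℝ) ^ γ * ((n : ℝ) ^ δ / δ / n))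
        = ((n : ℝ) ^ e * (n : ℝ) ^ γ * (n : ℝ) ^ δ) / n * (1 / δ) := by ring
      _ = 1 / δ := by rw [this, div_self hn0.ne', one_mul]
  calc (n : ℝ) ^ e * (C * ((n : ℝ) ^ (-e) + ((n : ℝ) ^ (-γ))⁻¹ * (Real.log n / n)))
      ≤ (n : ℝ) ^ e * (C * ((n : ℝ) ^ (-e) + ((n : ℝ) ^ (-γ))⁻¹ * (((n : ℝ) ^ δ / δ) / n))) := by
        gcongr
    _ = C * ((n : ℝ) ^ e * (n : ℝ) ^ (-e)
          + (n : ℝ) ^ e * (((n : ℝ) ^ (-γ))⁻¹ * (((n : ℝ) ^ δ / δ) / n))) := by ring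
    _ = C * (1 + 1 / δ) := by rw [e1, e2]

/-- From the critical smoothness on the estimator attains the rate with a logarithmic factor. -/
theorem limsup_maxRisk_lt_top_of_le (hB : IsBrownianReal B P)
    {lam : ℝ} (hlam : 1 < lam) (hlam_eq : lam - Real.log lam - 1 = 2)
    {x0 γ : ℝ} (hx0 : x0 ∈ Ioo (0 : ℝ) 1) (hγ : γ ∈ Ioo (0 : ℝ) 1)
    {α M : ℝ} (hαγ : (1 - γ) / (2 * γ) ≤ α) (hαr : α < r) (hM : 0 < M) :
    limsup (fun n : ℕ => ENNReal.ofReal (((n : ℝ) / Real.log n) ^ (2 * α / (1 + 2 * α))) *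
      maxRisk P B (W.estimator lam x0 ((n : ℝ) ^ (-γ)) n) n x0 ((n : ℝ) ^ (-γ)) α M)
      atTop < ⊤ := by
  obtain ⟨hγ0, hγ1⟩ := hγ
  have hα : 0 < α := lt_of_lt_of_le (div_pos (by linarith) (by linarith)) hαγ
  have hr1 : 1 ≤ r := Nat.one_le_iff_ne_zero.2 fun h => by
    rw [h, Nat.cast_zero] at hαr
    linarith
  obtain ⟨C, hC, c0, hc0, h⟩ := W.exists_risk_le hr1 hB hlam hlam_eq hx0 hα hαr hM
  set e := 2 * α / (1 + 2 * α) with he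
  have he0 : 0 < e := by positivity
  have heγ : e ≤ γ * (2 * α) := by
    rw [div_le_iff₀ (by linarith)] at hαγ
    rw [he, div_le_iff₀ (by linarith)]
    nlinarith
  refine limsup_lt_top_of_eventually_le (C := C * 3) ?_
  filter_upwards [eventually_ge_atTop 8, eventually_rpow_neg_le hγ0 hc0] with n hn hnc
  have hn8 : (8 : ℝ) ≤ n := by exact_mod_cast hn
  have hn0 : (0 : ℝ) < n := by linarith
  have hlog := two_le_log_of_eight_le hn
  have hcn : (n : ℝ)⁻¹ ≤ (n : ℝ) ^ (-γ) := by
    rw [← Real.rpow_neg_one]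
    exact Real.rpow_le_rpow_of_exponent_le (by linarith) (by linarith)
  refine (mul_le_mul_right (h n hn _ hcn hnc).2 _).trans ?_
  rw [← ENNReal.ofReal_mul (by positivity)]
  refine ENNReal.ofReal_le_ofReal ?_
  have hle : ((n : ℝ) / Real.log n) ^ e ≤ (n : ℝ) ^ e := by
    refine Real.rpow_le_rpow (by positivity) (div_le_self hn0.le (by linarith)) he0.le
  have e1 : ((n : ℝ) / Real.log n) ^ e * (n : ℝ) ^ (-e) ≤ 1 := by
    refine (mul_le_mul_of_nonneg_right hle (by positivity)).trans (le_of_eq ?_)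
    rw [← Real.rpow_add hn0, add_neg_cancel, Real.rpow_zero]
  have e2 : ((n : ℝ) / Real.log n) ^ e * ((n : ℝ) ^ (-γ)) ^ (2 * α) ≤ 1 := by
    refine (mul_le_mul_of_nonneg_right hle (by positivity)).trans ?_
    rw [← Real.rpow_mul hn0.le, ← Real.rpow_add hn0]
    exact Real.rpow_le_one_of_one_le_of_nonpos (by linarith) (by linarith)
  have e3 : ((n : ℝ) / Real.log n) ^ e * (Real.log n / n) ^ e ≤ 1 := by
    rw [← Real.mul_rpow (by positivity) (by positivity), div_mul_div_cancel₀ (by positivity),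
      div_self hn0.ne', Real.one_rpow]
  calc _ = C * (((n : ℝ) / Real.log n) ^ e * (n : ℝ) ^ (-e)
        + ((n : ℝ) / Real.log n) ^ e * ((n : ℝ) ^ (-γ)) ^ (2 * α)
        + ((n : ℝ) / Real.log n) ^ e * (Real.log n / n) ^ e) := by ring
    _ ≤ C * 3 := by
      gcongr
      linarith

end IntervalWaveletBasis

/-! ### Two signals that cannot be told apart -/

/-- Change of measure for a shifted Gaussian law: apart from an event of probability `1/4`, the
likelihood ratio is at most its value two standard deviations above the mean. -/
lemma gaussianReal_le_shift {v : ℝ≥0} (hv : v ≠ 0) {m : ℝ} (hm : 0 ≤ m) {S : Set ℝ}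
    (hS : MeasurableSet S) :
    gaussianReal m v S ≤ ENNReal.ofReal (Real.exp (m ^ 2 / (2 * v) + 2 * (m / √(v : ℝ)))) *
      gaussianReal 0 v S + ENNReal.ofReal (1 / 4) := by
  have hv0 : (0 : ℝ) < v := by exact_mod_cast pos_iff_ne_zero.2 hv
  have hs : 0 < √(v : ℝ) := Real.sqrt_pos.2 hv0
  have hss : √(v : ℝ) ^ 2 = v := Real.sq_sqrt hv0.le
  have hsub : S ⊆ (S ∩ Iic (m + 2 * √(v : ℝ))) ∪ {x | 2 * √(v : ℝ) ≤ |x - m|} := fun x hx => by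
    by_cases h : x ≤ m + 2 * √(v : ℝ)
    · exact Or.inl ⟨hx, h⟩
    · rw [not_le] at h
      have : 2 * √(v : ℝ) ≤ x - m := by linarith
      exact Or.inr (this.trans (le_abs_self _))
  refine (measure_mono hsub).trans ((measure_union_le _ _).trans (add_le_add ?_ ?_))
  · rw [gaussianReal_apply _ hv, gaussianReal_apply _ hv,
      ← lintegral_const_mul _ (measurable_gaussianPDF 0 v)]
    refine le_trans (setLIntegral_mono' (hS.inter measurableSet_Iic) (fun x hx => ?_))
      (lintegral_mono_set (inter_subset_left : S ∩ Iic (m + 2 * √(v : ℝ)) ⊆ S))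
    rw [gaussianPDF, gaussianPDF, ← ENNReal.ofReal_mul (Real.exp_pos _).le]
    refine ENNReal.ofReal_le_ofReal ?_
    rw [gaussianPDFReal, gaussianPDFReal, mul_left_comm]
    refine mul_le_mul_of_nonneg_left ?_ (by positivity)
    rw [← Real.exp_add]
    refine Real.exp_le_exp.2 ?_
    have hx2 : x ≤ m + 2 * √(v : ℝ) := hx.2
    have e1 : m / √(v : ℝ) = m * √(v : ℝ) / v := by
      rw [div_eq_div_iff hs.ne' hv0.ne', mul_assoc, ← sq, hss]
    rw [e1]
    have : m ^ 2 / (2 * v) + 2 * (m * √(v : ℝ) / v) + -(x - 0) ^ 2 / (2 * v)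
        - -(x - m) ^ 2 / (2 * v) = m * (m + 2 * √(v : ℝ) - x) / v := by
      field_simp
      ring
    have h2 : 0 ≤ m * (m + 2 * √(v : ℝ) - x) / v :=
      div_nonneg (mul_nonneg hm (by linarith)) hv0.le
    linarith
  · have h := meas_ge_le_variance_div_sq (μ := gaussianReal m v) (X := id)
      (memLp_id_gaussianReal 2) (c := 2 * √(v : ℝ)) (by positivity)
    simp only [variance_id_gaussianReal, id_eq, integral_id_gaussianReal] at h
    refine h.trans (ENNReal.ofReal_le_ofReal (le_of_eq ?_))
    rw [mul_pow, hss]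
    field_simp
    norm_num

section Laws

variable {Ω : Type*} [MeasurableSpace Ω] {P : Measure Ω} {B : ℝ≥0 → Ω → ℝ}

/-- Brownian motion on `[0,1]` has a version all of whose paths are continuous and all of whose
coordinates are measurable. -/
lemma exists_continuous_version (hB : IsBrownianReal B P) :
    ∃ b : unitInterval → Ω → ℝ, (∀ t, Measurable (b t)) ∧ (∀ ω, Continuous (b · ω)) ∧
      ∀ᵐ ω ∂P, ∀ t, b t ω = pathOf B ω t := by
  classical
  have hm : ∀ t : unitInterval, AEMeasurable (fun ω => pathOf B ω t) P := fun t =>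
    hB.isGaussianProcess.aemeasurable _
  obtain ⟨d, hd⟩ := TopologicalSpace.exists_dense_seq unitInterval
  have hae : ∀ᵐ ω ∂P, Continuous (B · ω) ∧ ∀ i, pathOf B ω (d i) = (hm (d i)).mk _ ω :=
    hB.cont.and (ae_all_iff.2 fun i => (hm (d i)).ae_eq_mk)
  obtain ⟨G, hG, hGm, hGs⟩ := hae.exists_measurable_mem
  -- on a measurable set `G` of full measure keep the path, elsewhere take the zero path
  set b : unitInterval → Ω → ℝ := fun t => G.indicator fun ω => pathOf B ω t with hb
  have hcont : ∀ ω, Continuous (b · ω) := fun ω => by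
    by_cases hω : ω ∈ G
    · simpa [hb, hω] using continuous_pathOf (hGs ω hω).1
    · simpa [hb, hω] using continuous_const
  have hdm : ∀ i, Measurable (b (d i)) := fun i => by
    have : b (d i) = G.indicator ((hm (d i)).mk _) := by
      refine indicator_congr fun ω hω => (hGs ω hω).2 i
    rw [this]
    exact (hm (d i)).measurable_mk.indicator hGm
  refine ⟨b, fun t => ?_, hcont, ?_⟩
  · obtain ⟨u, hu, hut⟩ := mem_closure_iff_seq_limit.1 (hd t)
    have hu' : ∀ n, Measurable (b (u n)) := fun n => by
      obtain ⟨i, hi⟩ := hu n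
      rw [← hi]
      exact hdm i
    exact measurable_of_tendsto_metrizable hu'
      (tendsto_pi_nhds.2 fun ω => ((hcont ω).tendsto t).comp hut)
  · filter_upwards [hG] with ω hω t
    simp [hb, hω]

/-- The law of the path observed under the signal `f` and the law under the zero signal, compared
through the likelihood ratio in the direction of `f`. The path splits into its component along `f`
and an independent remainder, and the signal only shifts the first component. -/
lemma exists_paths_measure_le (hB : IsBrownianReal B P) {f : ℝ → ℝ}
    (hf : ContDiffOn ℝ 1 f (Icc 0 1)) {v : ℝ} (hv : ∫ x in Icc (0 : ℝ) 1, f x ^ 2 = v)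
    (hv0 : 0 < v) {n : ℕ} (hn : 0 < n) :
    ∃ Z Z' : Ω → {z : unitInterval → ℝ // Continuous z}, Measurable Z ∧ Measurable Z' ∧
      (∀ᵐ ω ∂P, (Z ω).1 = observedPath B (fun _ => 0) n ω) ∧
      (∀ᵐ ω ∂P, (Z' ω).1 = observedPath B f n ω) ∧
      ∀ A, MeasurableSet A → P (Z' ⁻¹' A) ≤
        ENNReal.ofReal (Real.exp (v * n / 2 + 2 * √(v * n))) * P (Z ⁻¹' A)
          + ENNReal.ofReal (1 / 4) := by
  have hP : IsProbabilityMeasure P := hB.isGaussianProcess.isProbabilityMeasure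
  have hn0 : (0 : ℝ) < n := by exact_mod_cast hn
  obtain ⟨b, hbm, hbc, hbB⟩ := exists_continuous_version hB
  obtain ⟨hG, hmean, hcov⟩ := wienerProcess_gaussian hB
  have hXm := (hasGaussianLaw_wiener hB hf).aemeasurable
  set X : Ω → ℝ := hXm.mk _ with hX
  have hXmeas : Measurable X := hXm.measurable_mk
  have hXae : wiener B f =ᵐ[P] X := hXm.ae_eq_mk
  -- regress the path on `X = ∫ f dB`; the signal moves the path in the direction `κ` only
  set κ : unitInterval → ℝ := fun t => (∫ x in (0 : ℝ)..t, f x) / v with hκ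
  have hκc : Continuous κ := (continuous_primitive hf.continuousOn).div_const v
  set B' : unitInterval → Ω → ℝ := fun t ω => b t ω - κ t * X ω with hB'
  have hB'm : ∀ t, Measurable (B' t) := fun t => (hbm t).sub (hXmeas.const_mul _)
  have hB'c : ∀ ω, Continuous (B' · ω) := fun ω => (hbc ω).sub (hκc.mul continuous_const)
  -- independence of the component along `f` and the remainder
  have hGP : IsGaussianProcess (Sum.elim (fun _ : Unit => X) B') P := by
    have h1 : IsGaussianProcess (Sum.elim (fun _ : Unit => wiener B f)
        fun t ω => pathOf B ω t - κ t * wiener B f ω) P := by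
      classical
      refine hG.of_isGaussianProcess fun s => ?_
      rcases s with s | t
      · refine ⟨{Sum.inl ⟨f, hf⟩}, ContinuousLinearMap.proj ⟨Sum.inl ⟨f, hf⟩, by simp⟩,
          fun ω => ?_⟩
        rfl
      · refine ⟨{Sum.inr t, Sum.inl ⟨f, hf⟩},
          ContinuousLinearMap.proj ⟨Sum.inr t, by simp⟩
            - κ t • ContinuousLinearMap.proj ⟨Sum.inl ⟨f, hf⟩, by simp⟩, fun ω => ?_⟩
        rfl
    refine h1.congr fun s => ?_
    rcases s with s | t
    · exact hXae
    · filter_upwards [hXae, hbB] with ω h2 h3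
      simp only [Sum.elim_inr, hB']
      rw [h2, h3]
  have hcov0 : ∀ t, cov[X, B' t; P] = 0 := fun t => by
    have e1 : cov[X, B' t; P]
        = cov[wiener B f, fun ω => pathOf B ω t - κ t * wiener B f ω; P] := by
      have hB'ae : B' t =ᵐ[P] fun ω => pathOf B ω t - κ t * wiener B f ω := by
        filter_upwards [hXae, hbB] with ω h2 h3
        simp only [hB']
        rw [h2, h3]
      rw [covariance, covariance, integral_congr_ae hXae.symm, integral_congr_ae hB'ae]
      refine integral_congr_ae ?_
      filter_upwards [hXae, hbB] with ω h2 h3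
      simp only [hB']
      rw [h2, h3]
    have hL : MemLp (wiener B f) 2 P := (hasGaussianLaw_wiener hB hf).memLp_two
    have hLt : MemLp (fun ω => pathOf B ω t) 2 P :=
      (hG.hasGaussianLaw_eval (Sum.inr t)).memLp_two
    have c1 : cov[wiener B f, fun ω => pathOf B ω t; P] = ∫ x in (0 : ℝ)..t, f x :=
      hcov (Sum.inl ⟨f, hf⟩) (Sum.inr t)
    have c2 : cov[wiener B f, wiener B f; P] = v := by
      have := hcov (Sum.inl ⟨f, hf⟩) (Sum.inl ⟨f, hf⟩)
      refine this.trans ?_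
      rw [← hv]
      simp only [wienerCov, sq]
    rw [e1, covariance_fun_sub_right hL hLt (hL.const_mul _), covariance_const_mul_right, c1, c2,
      hκ]
    field_simp
    ring
  have hind : IndepFun (fun ω (_ : Unit) => X ω) (fun ω t => B' t ω) P :=
    hGP.indepFun_of_covariance_eq_zero (fun _ => hXmeas.aemeasurable)
      (fun t => (hB'm t).aemeasurable) fun _ t => hcov0 t
  set w : Ω → {z : unitInterval → ℝ // Continuous z} := fun ω => ⟨fun t => B' t ω, hB'c ω⟩ with hw
  have hwm : Measurable w := Measurable.subtype_mk (measurable_pi_lambda _ hB'm)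
  have hindw : IndepFun X w P := by
    have h1 : IndepFun X (fun ω t => B' t ω) P :=
      hind.comp (φ := fun x : Unit → ℝ => x ()) (ψ := id)
        (measurable_pi_apply (X := fun _ : Unit => ℝ) ()) measurable_id
    rw [IndepFun_iff_Indep] at h1 ⊢
    convert h1 using 1
    exact MeasurableSpace.comap_comp
  set V : ℝ≥0 := v.toNNReal with hV
  have hVv : (V : ℝ) = v := Real.coe_toNNReal v hv0.le
  have hV0 : V ≠ 0 := by rw [hV]; simpa using hv0
  have hXlaw : P.map X = gaussianReal 0 V := by
    rw [← Measure.map_congr hXae, map_wiener hB hf, hv]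
  -- `Φ` rebuilds the observed path from the component along `f` and the remainder
  set Φ : ℝ × {z : unitInterval → ℝ // Continuous z} → {z : unitInterval → ℝ // Continuous z} :=
    fun p => ⟨fun t => (√(n : ℝ))⁻¹ * (p.2.1 t + κ t * p.1),
      continuous_const.mul (p.2.2.add (hκc.mul continuous_const))⟩ with hΦ
  have hΦm : Measurable Φ := by
    refine Measurable.subtype_mk (measurable_pi_lambda _ fun t => ?_)
    refine Measurable.const_mul (Measurable.add ?_ (measurable_fst.const_mul _)) _
    exact (measurable_pi_apply t).comp (measurable_subtype_coe.comp measurable_snd)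
  set θ : ℝ := √(n : ℝ) * v with hθ
  have hsn : 0 < √(n : ℝ) := Real.sqrt_pos.2 hn0
  have hlaw : ∀ s : ℝ, P.map (fun ω => (X ω + s, w ω)) = (gaussianReal s V).prod (P.map w) := by
    intro s
    have h1 : IndepFun (fun ω => X ω + s) w P :=
      hindw.comp (φ := fun x => x + s) (measurable_id.add_const s) measurable_id
    rw [(indepFun_iff_map_prod_eq_prod_map_map (hXmeas.add_const s).aemeasurable
      hwm.aemeasurable).1 h1]
    congr 1
    have : P.map (fun ω => X ω + s) = (P.map X).map (· + s) :=
      (Measure.map_map (measurable_id.add_const s) hXmeas).symm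
    rw [this, hXlaw, gaussianReal_map_add_const, zero_add]
  have hpre : ∀ (s : ℝ) (A : Set {z : unitInterval → ℝ // Continuous z}), MeasurableSet A →
      P ((fun ω => Φ (X ω + s, w ω)) ⁻¹' A)
        = ∫⁻ y, gaussianReal s V ((fun x => (x, y)) ⁻¹' (Φ ⁻¹' A)) ∂(P.map w) := by
    intro s A hA
    rw [← Measure.prod_apply_symm (hΦm hA), ← hlaw s,
      Measure.map_apply ((hXmeas.add_const s).prodMk hwm) (hΦm hA)]
    rfl
  refine ⟨fun ω => Φ (X ω + 0, w ω), fun ω => Φ (X ω + θ, w ω),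
    hΦm.comp ((hXmeas.add_const 0).prodMk hwm), hΦm.comp ((hXmeas.add_const θ).prodMk hwm),
    ?_, ?_, fun A hA => ?_⟩
  · filter_upwards [hbB] with ω hω
    funext t
    simp only [hΦ, hw, hB', observedPath, intervalIntegral.integral_zero]
    rw [hω t]
    simp only [pathOf]
    ring
  · filter_upwards [hbB] with ω hω
    funext t
    simp only [hΦ, hw, hB', observedPath]
    rw [hω t, hκ, hθ]
    simp only [pathOf]
    field_simp
    ring
  · rw [hpre θ A hA, hpre 0 A hA]
    have hmeas : Measurable fun y => gaussianReal 0 V ((fun x => (x, y)) ⁻¹' (Φ ⁻¹' A)) :=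
      measurable_measure_prodMk_right (hΦm hA)
    have hwP : IsProbabilityMeasure (P.map w) := Measure.isProbabilityMeasure_map hwm.aemeasurable
    have e : v * n / 2 + 2 * √(v * n) = θ ^ 2 / (2 * V) + 2 * (θ / √(V : ℝ)) := by
      have hsv := Real.sqrt_pos.2 hv0
      have h1 : √(n : ℝ) ^ 2 = n := Real.sq_sqrt hn0.le
      have h2 : √v ^ 2 = v := Real.sq_sqrt hv0.le
      have h3 : √(n : ℝ) * v / √v = √v * √(n : ℝ) := by
        rw [div_eq_iff hsv.ne']
        nlinarith
      rw [hVv, hθ, h3, Real.sqrt_mul hv0.le, mul_pow, h1]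
      field_simp
    rw [e]
    calc ∫⁻ y, gaussianReal θ V ((fun x => (x, y)) ⁻¹' (Φ ⁻¹' A)) ∂(P.map w)
        ≤ ∫⁻ y, (ENNReal.ofReal (Real.exp (θ ^ 2 / (2 * V) + 2 * (θ / √(V : ℝ))))
            * gaussianReal 0 V ((fun x => (x, y)) ⁻¹' (Φ ⁻¹' A)) + ENNReal.ofReal (1 / 4))
            ∂(P.map w) :=
          lintegral_mono fun y => gaussianReal_le_shift hV0 (by positivity)
            (measurable_prodMk_right (hΦm hA))
      _ = _ := by
          rw [lintegral_add_right _ measurable_const, lintegral_const_mul _ hmeas, lintegral_const,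
            measure_univ, mul_one]

end Laws

section TwoPoints

variable {Ω : Type*} [MeasurableSpace Ω] {P : Measure Ω} {B : ℝ≥0 → Ω → ℝ}

/-- An estimator with small risk at the zero signal has a large risk at a signal `f` which is
constant on the window and close to zero in the sense of likelihood ratios. -/
lemma le_risk_of_risk_zero_le (hB : IsBrownianReal B P) {f : ℝ → ℝ}
    (hf : ContDiffOn ℝ 1 f (Icc 0 1)) {v : ℝ} (hv : ∫ x in Icc (0 : ℝ) 1, f x ^ 2 = v)
    (hv0 : 0 < v) {n : ℕ} (hn : 0 < n) {T : (unitInterval → ℝ) → ℝ → ℝ} (hT : IsEstimator T)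
    {x0 c ρ r0 : ℝ} (hc : 0 < c) (hρ : 0 < ρ) (hfρ : ∀ x ∈ Icc (x0 - c) (x0 + c), f x = ρ)
    (h0 : risk P B T n x0 c (fun _ => 0) ≤ ENNReal.ofReal r0)
    (hsmall : Real.exp (v * n / 2 + 2 * √(v * n)) * (4 * r0 / ρ ^ 2) ≤ 1 / 4) :
    ENNReal.ofReal (ρ ^ 2 / 8) ≤ risk P B T n x0 c f := by
  have hP : IsProbabilityMeasure P := hB.isGaussianProcess.isProbabilityMeasure
  obtain ⟨Z, Z', hZ, hZ', hZ0, hZf, hle⟩ := exists_paths_measure_le hB hf hv hv0 hn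
  set I := Icc (x0 - c) (x0 + c) with hI
  have hvolI : volume I = ENNReal.ofReal (2 * c) := by
    rw [hI, Real.volume_Icc]
    congr 1
    ring
  set U : {z : unitInterval → ℝ // Continuous z} → ℝ≥0∞ := fun z =>
    ∫⁻ x in I, ENNReal.ofReal (T z.1 x ^ 2) with hU
  set V : {z : unitInterval → ℝ // Continuous z} → ℝ≥0∞ := fun z =>
    ∫⁻ x in I, ENNReal.ofReal ((T z.1 x - f x) ^ 2) with hV
  have hUm : Measurable U :=
    Measurable.lintegral_prod_right' (f := fun p : {z : unitInterval → ℝ // Continuous z} × ℝ =>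
      ENNReal.ofReal (T p.1.1 p.2 ^ 2)) (ENNReal.measurable_ofReal.comp (hT.pow_const 2))
  have hr0 : risk P B T n x0 c (fun _ => 0)
      = ENNReal.ofReal (1 / (2 * c)) * ∫⁻ ω, U (Z ω) ∂P := by
    rw [risk]
    congr 1
    refine lintegral_congr_ae ?_
    filter_upwards [hZ0] with ω hω
    simp only [hU, hω, sub_zero, hI]
  have hrf : risk P B T n x0 c f = ENNReal.ofReal (1 / (2 * c)) * ∫⁻ ω, V (Z' ω) ∂P := by
    rw [risk]
    congr 1
    refine lintegral_congr_ae ?_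
    filter_upwards [hZf] with ω hω
    simp only [hV, hω, hI]
  set ε := ENNReal.ofReal (c * ρ ^ 2 / 2) with hε
  have hε0 : 0 < c * ρ ^ 2 / 2 := by positivity
  -- `A`: the paths on which the estimate is not close to zero on the window
  set A : Set {z : unitInterval → ℝ // Continuous z} := {z | ε ≤ U z} with hA
  have hAm : MeasurableSet A := measurableSet_le measurable_const hUm
  -- where the estimate is small on the window it is far from `f`
  have hVA : ∀ z, z ∉ A → ε ≤ V z := by
    intro z hz
    by_contra hlt
    rw [not_le] at hlt
    have hzU : U z < ε := not_le.1 hz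
    have hTz : Measurable (T z.1) := hT.comp measurable_prodMk_left
    have h1 : ENNReal.ofReal (2 * c * ρ ^ 2) ≤ 2 * U z + 2 * V z := by
      calc ENNReal.ofReal (2 * c * ρ ^ 2) = ∫⁻ _ in I, ENNReal.ofReal (ρ ^ 2) := by
            rw [setLIntegral_const, hvolI, ← ENNReal.ofReal_mul (by positivity)]
            congr 1
            ring
        _ ≤ ∫⁻ x in I, (2 * ENNReal.ofReal (T z.1 x ^ 2)
              + 2 * ENNReal.ofReal ((T z.1 x - f x) ^ 2)) := by
            refine setLIntegral_mono' measurableSet_Icc fun x hx => ?_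
            have e2 : (2 : ℝ≥0∞) = ENNReal.ofReal 2 := by simp
            rw [e2, ← ENNReal.ofReal_mul zero_le_two, ← ENNReal.ofReal_mul zero_le_two,
              ← ENNReal.ofReal_add (by positivity) (by positivity)]
            refine ENNReal.ofReal_le_ofReal ?_
            rw [hfρ x hx]
            nlinarith [sq_nonneg (2 * T z.1 x - ρ)]
        _ = 2 * U z + 2 * V z := by
            have hm : Measurable fun x => 2 * ENNReal.ofReal (T z.1 x ^ 2) :=
              (ENNReal.measurable_ofReal.comp (hTz.pow_const 2)).const_mul 2
            rw [lintegral_add_left hm,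
              lintegral_const_mul' _ _ (by simp), lintegral_const_mul' _ _ (by simp)]
    have h2 : 2 * U z + 2 * V z < 2 * ε + 2 * ε :=
      ENNReal.add_lt_add ((ENNReal.mul_lt_mul_iff_right (by simp) (by simp)).2 hzU)
        ((ENNReal.mul_lt_mul_iff_right (by simp) (by simp)).2 hlt)
    refine absurd (h1.trans_lt h2) (not_lt.2 (le_of_eq ?_))
    have e2 : (2 : ℝ≥0∞) = ENNReal.ofReal 2 := by simp
    rw [e2, hε, ← ENNReal.ofReal_mul zero_le_two,
      ← ENNReal.ofReal_add (by positivity) (by positivity)]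
    congr 1
    ring
  have hP0 : P (Z ⁻¹' A) ≤ ENNReal.ofReal (4 * r0 / ρ ^ 2) := by
    have h1 : ε * P (Z ⁻¹' A) ≤ ∫⁻ ω, U (Z ω) ∂P :=
      mul_meas_ge_le_lintegral (hUm.comp hZ) ε
    have h2 : ENNReal.ofReal (1 / (2 * c)) * (ε * P (Z ⁻¹' A)) ≤ ENNReal.ofReal r0 :=
      (mul_le_mul_right h1 _).trans (hr0 ▸ h0)
    rw [← mul_assoc, hε, ← ENNReal.ofReal_mul (by positivity),
      show 1 / (2 * c) * (c * ρ ^ 2 / 2) = ρ ^ 2 / 4 by field_simp; ring] at h2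
    have h3 := mul_le_mul_right h2 (ENNReal.ofReal (4 / ρ ^ 2))
    rw [← mul_assoc, ← ENNReal.ofReal_mul (by positivity),
      ← ENNReal.ofReal_mul (by positivity),
      show 4 / ρ ^ 2 * (ρ ^ 2 / 4) = 1 by field_simp, ENNReal.ofReal_one, one_mul] at h3
    refine h3.trans (le_of_eq ?_)
    congr 1
    ring
  have hPf : P (Z' ⁻¹' A) ≤ ENNReal.ofReal (1 / 2) := by
    refine (hle A hAm).trans ?_
    calc _ ≤ ENNReal.ofReal (Real.exp (v * n / 2 + 2 * √(v * n)))
            * ENNReal.ofReal (4 * r0 / ρ ^ 2) + ENNReal.ofReal (1 / 4) := by gcongr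
      _ ≤ ENNReal.ofReal (1 / 4) + ENNReal.ofReal (1 / 4) := by
          rw [← ENNReal.ofReal_mul (Real.exp_pos _).le]
          gcongr
      _ = ENNReal.ofReal (1 / 2) := by
          rw [← ENNReal.ofReal_add (by norm_num) (by norm_num)]
          norm_num
  have hPc : ENNReal.ofReal (1 / 2) ≤ P (Z' ⁻¹' A)ᶜ := by
    rw [prob_compl_eq_one_sub (hZ' hAm)]
    refine le_trans (le_of_eq ?_) (tsub_le_tsub_left hPf 1)
    rw [← ENNReal.ofReal_one, ← ENNReal.ofReal_sub _ (by norm_num)]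
    norm_num
  rw [hrf]
  calc ENNReal.ofReal (ρ ^ 2 / 8)
      = ENNReal.ofReal (1 / (2 * c)) * (ε * ENNReal.ofReal (1 / 2)) := by
        rw [hε, ← ENNReal.ofReal_mul hε0.le, ← ENNReal.ofReal_mul (by positivity)]
        congr 1
        field_simp
        norm_num
    _ ≤ ENNReal.ofReal (1 / (2 * c)) * (ε * P (Z' ⁻¹' A)ᶜ) := by gcongr
    _ = ENNReal.ofReal (1 / (2 * c)) * ∫⁻ ω, ((Z' ⁻¹' A)ᶜ).indicator (fun _ => ε) ω ∂P := by
        rw [lintegral_indicator_const (hZ' hAm).compl]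
    _ ≤ ENNReal.ofReal (1 / (2 * c)) * ∫⁻ ω, V (Z' ω) ∂P := by
        gcongr with ω
        by_cases hω : ω ∈ (Z' ⁻¹' A)ᶜ
        · rw [indicator_of_mem hω]
          exact hVA _ hω
        · rw [indicator_of_notMem hω]
          exact zero_le

end TwoPoints

/-! ### Rescaled bumps in Hölder classes -/

lemma iteratedDeriv_rescale {g : ℝ → ℝ} {k : ℕ} (hg : ContDiff ℝ k g) (a h x0 x : ℝ) :
    iteratedDeriv k (fun x => a * g (h⁻¹ * (x - x0))) x
      = a * (h⁻¹ ^ k * iteratedDeriv k g (h⁻¹ * (x - x0))) := by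
  have h1 := iteratedDeriv_comp_sub_const k (fun y => g (h⁻¹ * y)) x0
  rw [iteratedDeriv_const_mul_field a (fun x => g (h⁻¹ * (x - x0))), h1,
    iteratedDeriv_comp_const_mul hg]

/-- The derivatives of a smooth function of compact support are Hölder continuous of every
exponent `s ∈ [0,1]`. -/
lemma exists_holder_iteratedDeriv {g : ℝ → ℝ} (hg : ∀ m : ℕ, ContDiff ℝ m g)
    (hc : HasCompactSupport g) (k : ℕ) :
    ∃ Λ : ℝ, 0 < Λ ∧ ∀ s : ℝ, 0 ≤ s → s ≤ 1 → ∀ u v,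
      |iteratedDeriv k g u - iteratedDeriv k g v| ≤ Λ * |u - v| ^ s := by
  have h1 : ContDiff ℝ 1 (iteratedDeriv k g) := by
    rw [iteratedDeriv_eq_iterate]
    exact ContDiff.iterate_deriv' 1 k (by exact_mod_cast hg (1 + k))
  have h2 : HasCompactSupport (iteratedDeriv k g) := by
    rw [iteratedDeriv_eq_iterate]
    clear h1
    induction k with
    | zero => exact hc
    | succ k ih =>
      rw [Function.iterate_succ', Function.comp_apply]
      exact ih.deriv
  obtain ⟨C, hC⟩ := ContDiff.lipschitzWith_of_hasCompactSupport h2 h1 one_ne_zero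
  obtain ⟨D, hD⟩ := h2.exists_bound_of_continuous h1.continuous
  have hD0 : 0 ≤ D := (norm_nonneg _).trans (hD 0)
  refine ⟨C + 2 * D + 1, by positivity, fun s hs0 hs1 u v => ?_⟩
  rcases le_or_gt |u - v| 1 with h | h
  · have h3 := hC.dist_le_mul u v
    rw [Real.dist_eq, Real.dist_eq] at h3
    have h4 : |u - v| ≤ |u - v| ^ s := by
      rcases (abs_nonneg (u - v)).eq_or_lt with h0 | h0
      · rw [← h0]
        positivity
      · simpa using Real.rpow_le_rpow_of_exponent_ge h0 h hs1
    calc _ ≤ (C : ℝ) * |u - v| := h3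
      _ ≤ (C + 2 * D + 1) * |u - v| ^ s := by
        refine mul_le_mul ?_ h4 (abs_nonneg _) (by positivity)
        linarith
  · have h4 : 1 ≤ |u - v| ^ s := Real.one_le_rpow h.le hs0
    have h5 := hD u
    have h6 := hD v
    rw [Real.norm_eq_abs] at h5 h6
    calc _ ≤ |iteratedDeriv k g u| + |iteratedDeriv k g v| := abs_sub _ _
      _ ≤ (C + 2 * D + 1) * 1 := by
        have := C.coe_nonneg
        linarith
      _ ≤ (C + 2 * D + 1) * |u - v| ^ s := by gcongr

/-- Bumps of width `h` and height proportional to `h ^ α` around an interior point belong to a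
fixed Hölder class. -/
lemma exists_bump_mem_holderClass {α M x0 : ℝ} (hα : 0 < α) (hM : 0 < M)
    (hx0 : x0 ∈ Ioo (0 : ℝ) 1) :
    ∃ β : ℝ, 0 < β ∧ ∀ h : ℝ, 0 < h → ∃ f ∈ holderClass α M, ContDiffOn ℝ 1 f (Icc 0 1) ∧
      (∀ x ∈ Icc (x0 - h) (x0 + h), f x = β * h ^ α) ∧
      0 < ∫ x in Icc (0 : ℝ) 1, f x ^ 2 ∧
      ∫ x in Icc (0 : ℝ) 1, f x ^ 2 ≤ 4 * h * (β * h ^ α) ^ 2 := by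
  let g : ContDiffBump (0 : ℝ) := ⟨1, 2, one_pos, one_lt_two⟩
  have hg : ∀ m : ℕ, ContDiff ℝ m (g : ℝ → ℝ) := fun m => g.contDiff
  set k := ⌈α⌉₊ - 1 with hk
  have hk1 : (⌈α⌉₊ : ℝ) = k + 1 := by
    have := Nat.ceil_pos.2 hα
    have h2 : ⌈α⌉₊ = k + 1 := by omega
    rw [h2]
    push_cast
    rfl
  have hks : (k : ℝ) < α := by
    have := Nat.ceil_lt_add_one hα.le
    linarith
  have hks1 : α - k ≤ 1 := by
    have := Nat.le_ceil α
    linarith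
  obtain ⟨Λ, hΛ, hhol⟩ := exists_holder_iteratedDeriv hg g.hasCompactSupport k
  refine ⟨M / Λ, by positivity, fun h hh => ?_⟩
  set ρ := M / Λ * h ^ α with hρ
  have hρ0 : 0 < ρ := by positivity
  set f : ℝ → ℝ := fun x => ρ * g (h⁻¹ * (x - x0)) with hf
  have hfm : ∀ m : ℕ, ContDiff ℝ m f := fun m =>
    contDiff_const.mul ((hg m).comp (contDiff_const.mul (contDiff_id.sub contDiff_const)))
  have hfc : Continuous f := (hfm 0).continuous
  have hone : ∀ x ∈ Icc (x0 - h) (x0 + h), f x = ρ := fun x hx => by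
    have : g (h⁻¹ * (x - x0)) = 1 := by
      refine g.one_of_mem_closedBall ?_
      change h⁻¹ * (x - x0) ∈ Metric.closedBall (0 : ℝ) 1
      rw [mem_closedBall_zero_iff, Real.norm_eq_abs, abs_mul, abs_of_pos (inv_pos.2 hh),
        inv_mul_le_iff₀ hh, mul_one, abs_le]
      constructor <;> linarith [hx.1, hx.2]
    simp only [hf]
    rw [this, mul_one]
  have hle : ∀ x, f x ^ 2 ≤ (Icc (x0 - 2 * h) (x0 + 2 * h)).indicator (fun _ => ρ ^ 2) x :=
    fun x => by
    by_cases hx : x ∈ Icc (x0 - 2 * h) (x0 + 2 * h)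
    · rw [indicator_of_mem hx]
      simp only [hf]
      rw [mul_pow]
      refine mul_le_of_le_one_right (sq_nonneg _) ?_
      exact pow_le_one₀ g.nonneg g.le_one
    · rw [indicator_of_notMem hx]
      have : g (h⁻¹ * (x - x0)) = 0 := by
        refine g.zero_of_le_dist ?_
        change 2 ≤ dist (h⁻¹ * (x - x0)) 0
        rw [dist_zero_right, Real.norm_eq_abs, abs_mul, abs_of_pos (inv_pos.2 hh),
          le_inv_mul_iff₀ hh]
        by_contra hlt
        rw [not_le, abs_lt] at hlt
        exact hx ⟨by linarith, by linarith⟩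
      simp only [hf]
      rw [this, mul_zero]
      norm_num
  have hf2 : IntegrableOn (fun x => f x ^ 2) (Icc 0 1) :=
    (hfc.pow 2).continuousOn.integrableOn_Icc
  refine ⟨f, ⟨(hfm k).contDiffOn, fun x y hx hxy hy => ?_⟩, (hfm 1).contDiffOn, hone, ?_, ?_⟩
  · have hI : ∀ x ∈ Icc (0 : ℝ) 1, iteratedDerivWithin k f (Icc 0 1) x
        = ρ * (h⁻¹ ^ k * iteratedDeriv k g (h⁻¹ * (x - x0))) := fun x hx => by
      rw [iteratedDerivWithin_eq_iteratedDeriv (uniqueDiffOn_Icc one_pos) (hfm k).contDiffAt hx]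
      exact iteratedDeriv_rescale (hg k) ρ h x0 x
    rw [hI x ⟨hx, hxy.le.trans hy⟩, hI y ⟨hx.trans hxy.le, hy⟩, ← mul_sub, ← mul_sub,
      abs_mul ρ, abs_mul (h⁻¹ ^ k), abs_of_pos hρ0, abs_of_pos (pow_pos (inv_pos.2 hh) k)]
    have h1 := hhol (α - k) (by linarith) hks1 (h⁻¹ * (x - x0)) (h⁻¹ * (y - x0))
    have e1 : |h⁻¹ * (x - x0) - h⁻¹ * (y - x0)| = h⁻¹ * |x - y| := by
      rw [← mul_sub, sub_sub_sub_cancel_right, abs_mul, abs_of_pos (inv_pos.2 hh)]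
    rw [e1, Real.mul_rpow (inv_pos.2 hh).le (abs_nonneg _)] at h1
    calc ρ * (h⁻¹ ^ k * |iteratedDeriv k g (h⁻¹ * (x - x0))
          - iteratedDeriv k g (h⁻¹ * (y - x0))|)
        ≤ ρ * (h⁻¹ ^ k * (Λ * (h⁻¹ ^ (α - k) * |x - y| ^ (α - k)))) := by gcongr
      _ = M * (h ^ α * (h⁻¹ ^ k * h⁻¹ ^ (α - k))) * |x - y| ^ (α - k) := by
          rw [hρ]
          field_simp
      _ = M * |x - y| ^ (α - k) := by
          rw [← Real.rpow_natCast, ← Real.rpow_add (inv_pos.2 hh), add_sub_cancel,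
            Real.inv_rpow hh.le, mul_inv_cancel₀ (by positivity), mul_one]
  · set δ := min h (min x0 (1 - x0)) with hδ
    have hδ0 : 0 < δ := lt_min hh (lt_min hx0.1 (sub_pos.2 hx0.2))
    have d1 : δ ≤ h := min_le_left _ _
    have d2 : δ ≤ x0 := (min_le_right _ _).trans (min_le_left _ _)
    have d3 : δ ≤ 1 - x0 := (min_le_right _ _).trans (min_le_right _ _)
    have hsub : Icc (x0 - δ) (x0 + δ) ⊆ Icc 0 1 := Icc_subset_Icc (by linarith) (by linarith)
    calc 0 < 2 * δ * ρ ^ 2 := by positivity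
      _ = ∫ x in Icc (x0 - δ) (x0 + δ), f x ^ 2 := by
          rw [setIntegral_congr_fun (g := fun _ => ρ ^ 2) measurableSet_Icc fun x hx => by
            simp only
            rw [hone x ⟨by linarith [hx.1], by linarith [hx.2]⟩]]
          rw [setIntegral_const, Real.volume_real_Icc, max_eq_left (by linarith), smul_eq_mul]
          ring
      _ ≤ _ := setIntegral_mono_set hf2 (ae_of_all _ fun x => sq_nonneg _)
          (LE.le.eventuallyLE hsub)
  · have hi : Integrable ((Icc (x0 - 2 * h) (x0 + 2 * h)).indicator fun _ : ℝ => ρ ^ 2) :=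
      (integrableOn_const (by simp)).integrable_indicator measurableSet_Icc
    calc ∫ x in Icc (0 : ℝ) 1, f x ^ 2
        ≤ ∫ x in Icc (0 : ℝ) 1, (Icc (x0 - 2 * h) (x0 + 2 * h)).indicator (fun _ => ρ ^ 2) x :=
          setIntegral_mono hf2 hi.integrableOn hle
      _ ≤ ∫ x, (Icc (x0 - 2 * h) (x0 + 2 * h)).indicator (fun _ => ρ ^ 2) x :=
          setIntegral_le_integral hi (ae_of_all _ fun x =>
            indicator_nonneg (fun _ _ => sq_nonneg ρ) x)
      _ = 4 * h * ρ ^ 2 := by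
          rw [integral_indicator_const _ measurableSet_Icc, Real.volume_real_Icc,
            max_eq_left (by linarith), smul_eq_mul]
          ring

lemma zero_mem_holderClass (α : ℝ) {M : ℝ} (hM : 0 < M) : (fun _ => 0) ∈ holderClass α M := by
  refine ⟨contDiffOn_const, fun x y _ _ _ => ?_⟩
  have : ∀ z, iteratedDerivWithin (⌈α⌉₊ - 1) (fun _ : ℝ => (0 : ℝ)) (Icc 0 1) z = 0 := fun z => by
    simp
  rw [this, this, sub_zero, abs_zero]
  positivity

/-! ### Impossibility of adaptation without a logarithmic factor -/

lemma exists_eventually_le_of_limsup_lt_top {e : ℝ} {R : ℕ → ℝ≥0∞}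
    (h : limsup (fun n : ℕ => ENNReal.ofReal ((n : ℝ) ^ e) * R n) atTop < ⊤) :
    ∃ C : ℝ, 0 ≤ C ∧ ∀ᶠ n : ℕ in atTop, R n ≤ ENNReal.ofReal (C * (n : ℝ) ^ (-e)) := by
  obtain ⟨C, hC, -⟩ := ENNReal.lt_iff_exists_nnreal_btwn.1 h
  refine ⟨C, C.coe_nonneg, ?_⟩
  filter_upwards [eventually_lt_of_limsup_lt hC, eventually_gt_atTop 0] with n hn hn0
  have hn0' : (0 : ℝ) < n := by exact_mod_cast hn0
  have h1 := mul_le_mul_right hn.le (ENNReal.ofReal ((n : ℝ) ^ (-e)))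
  rw [← mul_assoc, ← ENNReal.ofReal_mul (by positivity), ← Real.rpow_add hn0', neg_add_cancel,
    Real.rpow_zero, ENNReal.ofReal_one, one_mul] at h1
  refine h1.trans (le_of_eq ?_)
  rw [mul_comm, ENNReal.ofReal_mul C.coe_nonneg, ENNReal.ofReal_coe_nnreal]

set_option maxHeartbeats 1000000 in
/-- Above the critical smoothness no estimator attains the rates without logarithmic factor for
two smoothness indices. -/
theorem not_limsup_maxRisk_lt_top {Ω : Type*} [MeasurableSpace Ω] {P : Measure Ω}
    {B : ℝ≥0 → Ω → ℝ} (hB : IsBrownianReal B P) {x0 γ : ℝ} (hx0 : x0 ∈ Ioo (0 : ℝ) 1)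
    (hγ : γ ∈ Ioo (0 : ℝ) 1) {α₁ α₂ M₁ M₂ : ℝ} (h1 : (1 - γ) / (2 * γ) ≤ α₁) (h12 : α₁ < α₂)
    (hM₁ : 0 < M₁) (hM₂ : 0 < M₂) {T : ℕ → (unitInterval → ℝ) → ℝ → ℝ}
    (hT : ∀ n, IsEstimator (T n))
    (H1 : limsup (fun n : ℕ => ENNReal.ofReal ((n : ℝ) ^ (2 * α₁ / (1 + 2 * α₁))) *
      maxRisk P B (T n) n x0 ((n : ℝ) ^ (-γ)) α₁ M₁) atTop < ⊤)
    (H2 : limsup (fun n : ℕ => ENNReal.ofReal ((n : ℝ) ^ (2 * α₂ / (1 + 2 * α₂))) *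
      maxRisk P B (T n) n x0 ((n : ℝ) ^ (-γ)) α₂ M₂) atTop < ⊤) : False := by
  obtain ⟨hγ0, hγ1⟩ := hγ
  have hα₁ : 0 < α₁ := lt_of_lt_of_le (div_pos (by linarith) (by linarith)) h1
  have hα₂ : 0 < α₂ := hα₁.trans h12
  obtain ⟨C1, hC1, H1⟩ := exists_eventually_le_of_limsup_lt_top H1
  obtain ⟨C2, hC2, H2⟩ := exists_eventually_le_of_limsup_lt_top H2
  set e1 := 2 * α₁ / (1 + 2 * α₁) with he1
  set e2 := 2 * α₂ / (1 + 2 * α₂) with he2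
  have he1p : 0 < e1 := by positivity
  have he : e1 < e2 := by
    rw [he1, he2, div_lt_div_iff₀ (by linarith) (by linarith)]
    nlinarith
  obtain ⟨β, hβ, hbump⟩ := exists_bump_mem_holderClass hα₁ hM₁ hx0
  -- the constant `A` makes the likelihood ratio at most a small power of `n`
  set s : ℝ := (e2 - e1) / 3 with hs
  have hs0 : 0 < s := by rw [hs]; linarith
  set A : ℝ := s / (4 * β ^ 2) with hA
  have hA0 : 0 < A := by positivity
  have hAlog : Tendsto (fun n : ℕ => A * Real.log n) atTop atTop :=
    (Real.tendsto_log_atTop.comp tendsto_natCast_atTop_atTop).const_mul_atTop hA0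
  set D : ℝ := 4 * Real.exp 1 * C2 / β ^ 2 with hD
  have hD0 : 0 ≤ D := by positivity
  obtain ⟨n, hn1, hn2, hn3, hn4, hn5, hn6⟩ := (H1.and (H2.and ((eventually_gt_atTop 0).and
    ((hAlog.eventually_ge_atTop 1).and
    (((tendsto_rpow_atTop he1p).comp hAlog).eventually_gt_atTop (8 * C1 / β ^ 2) |>.and
    (eventually_rpow_neg_le (γ := (e2 - e1) / 2) (c0 := 1 / (4 * (D + 1))) (by linarith)
      (by positivity))))))).exists
  have hn0 : (0 : ℝ) < n := by exact_mod_cast hn3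
  have hn1' : (1 : ℝ) ≤ n := by exact_mod_cast hn3
  set c : ℝ := (n : ℝ) ^ (-γ) with hc
  have hc0 : 0 < c := by positivity
  set l : ℝ := A * Real.log n with hl
  have hl0 : 0 < l := by linarith
  -- the width of the bump: as large as the likelihood ratio permits, and wider than the window
  set h : ℝ := (l / n) ^ (1 / (1 + 2 * α₁)) with hh
  have hh0 : 0 < h := by positivity
  have hch : c ≤ h := by
    have hexp : 1 / (1 + 2 * α₁) ≤ γ := by
      rw [div_le_iff₀ (by linarith)] at h1 ⊢
      nlinarith
    calc c ≤ (n : ℝ) ^ (-(1 / (1 + 2 * α₁))) :=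
          Real.rpow_le_rpow_of_exponent_le hn1' (by linarith)
      _ = (1 / n : ℝ) ^ (1 / (1 + 2 * α₁)) := by
          rw [one_div (n : ℝ), Real.inv_rpow hn0.le, Real.rpow_neg hn0.le]
      _ ≤ h := by
          rw [hh]
          gcongr
  obtain ⟨f, hfH, hf1, hfρ, hv0, hvle⟩ := hbump h hh0
  set ρ := β * h ^ α₁ with hρ
  have hρ0 : 0 < ρ := by positivity
  set v := ∫ x in Icc (0 : ℝ) 1, f x ^ 2 with hv
  have hρ2 : ρ ^ 2 = β ^ 2 * l ^ e1 * (n : ℝ) ^ (-e1) := by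
    rw [hρ, mul_pow, hh, ← Real.rpow_natCast (_ ^ α₁), ← Real.rpow_mul (by positivity),
      ← Real.rpow_mul (by positivity), mul_assoc, Real.rpow_neg hn0.le, ← div_eq_mul_inv,
      ← Real.div_rpow hl0.le hn0.le]
    congr 2
    rw [he1]
    push_cast
    ring
  have hvn : v * n ≤ s * Real.log n := by
    have e : h * (h ^ α₁) ^ 2 = l / n := by
      rw [← Real.rpow_natCast (h ^ α₁), ← Real.rpow_mul hh0.le, ← Real.rpow_one_add' hh0.le
        (by push_cast; linarith), hh, ← Real.rpow_mul (by positivity)]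
      conv_rhs => rw [← Real.rpow_one (l / n)]
      congr 1
      push_cast
      field_simp
    calc v * n ≤ 4 * h * ρ ^ 2 * n := by gcongr
      _ = 4 * β ^ 2 * (h * (h ^ α₁) ^ 2) * n := by rw [hρ]; ring
      _ = s * Real.log n := by
          rw [e, hl, hA]
          field_simp
  have hK : Real.exp (v * n / 2 + 2 * √(v * n)) ≤ Real.exp 1 * (n : ℝ) ^ (3 / 2 * s) := by
    rw [Real.rpow_def_of_pos hn0, ← Real.exp_add]
    refine Real.exp_le_exp.2 ?_
    have hvn0 : 0 ≤ v * n := by positivity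
    have := Real.sq_sqrt hvn0
    nlinarith [sq_nonneg (√(v * n) - 1)]
  have hρlow : β ^ 2 * (n : ℝ) ^ (-e1) ≤ ρ ^ 2 := by
    rw [hρ2]
    gcongr
    exact le_mul_of_one_le_right (by positivity) (Real.one_le_rpow hn4 he1p.le)
  have hr0 : risk P B (T n) n x0 c (fun _ => 0) ≤ ENNReal.ofReal (C2 * (n : ℝ) ^ (-e2)) :=
    (le_iSup₂_of_le (f := fun f (_ : f ∈ holderClass α₂ M₂) => risk P B (T n) n x0 c f)
      _ (zero_mem_holderClass α₂ hM₂) le_rfl).trans hn2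
  have hrf : risk P B (T n) n x0 c f ≤ ENNReal.ofReal (C1 * (n : ℝ) ^ (-e1)) :=
    (le_iSup₂_of_le (f := fun f (_ : f ∈ holderClass α₁ M₁) => risk P B (T n) n x0 c f)
      _ hfH le_rfl).trans hn1
  have hsmall : Real.exp (v * n / 2 + 2 * √(v * n)) * (4 * (C2 * (n : ℝ) ^ (-e2)) / ρ ^ 2)
      ≤ 1 / 4 := by
    calc _ ≤ Real.exp 1 * (n : ℝ) ^ (3 / 2 * s)
            * (4 * (C2 * (n : ℝ) ^ (-e2)) / (β ^ 2 * (n : ℝ) ^ (-e1))) := by gcongr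
      _ = D * ((n : ℝ) ^ (3 / 2 * s) * (n : ℝ) ^ (-e2) * (n : ℝ) ^ e1) := by
          rw [hD, Real.rpow_neg hn0.le e1]
          field_simp
      _ = D * (n : ℝ) ^ (-((e2 - e1) / 2)) := by
          rw [← Real.rpow_add hn0, ← Real.rpow_add hn0, hs]
          congr 2
          ring
      _ ≤ D * (1 / (4 * (D + 1))) := by gcongr
      _ ≤ 1 / 4 := by
          rw [mul_one_div, div_le_div_iff₀ (by positivity) (by norm_num)]
          linarith
  have hfin := (le_risk_of_risk_zero_le hB hf1 rfl hv0 hn3 (hT n) hc0 hρ0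
    (fun x hx => hfρ x ⟨by linarith [hx.1], by linarith [hx.2]⟩) hr0 hsmall).trans hrf
  rw [ENNReal.ofReal_le_ofReal_iff (by positivity), hρ2] at hfin
  have hn5' : 8 * C1 / β ^ 2 < l ^ e1 := hn5
  rw [div_lt_iff₀ (by positivity)] at hn5'
  have hne : 0 < (n : ℝ) ^ (-e1) := by positivity
  nlinarith

theorem corollary3 {Ω : Type*} [MeasurableSpace Ω] (P : Measure Ω) [IsProbabilityMeasure P]
    (B : ℝ≥0 → Ω → ℝ) (hB : IsBrownianReal B P)
    (r : ℕ) (W : IntervalWaveletBasis r)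
    (lam : ℝ) (hlam : 1 < lam) (hlam_eq : lam - Real.log lam - 1 = 2)
    (x0 γ : ℝ) (hx0 : x0 ∈ Ioo (0 : ℝ) 1) (hγ : γ ∈ Ioo (0 : ℝ) 1)
    (hr : (1 - γ) / (2 * γ) < r) :
    -- the estimator attains the rate `n^{-2α/(1+2α)}` below the critical smoothness
    (∀ α M : ℝ, 0 < α → α < (1 - γ) / (2 * γ) → 0 < M →
      limsup (fun n : ℕ => ENNReal.ofReal ((n : ℝ) ^ (2 * α / (1 + 2 * α))) *
        maxRisk P B (W.estimator lam x0 ((n : ℝ) ^ (-γ)) n) n x0 ((n : ℝ) ^ (-γ)) α M)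
        atTop < ⊤) ∧
    -- and the rate `(n / log n)^{-2α/(1+2α)}` from the critical smoothness on
    (∀ α M : ℝ, (1 - γ) / (2 * γ) ≤ α → α < r → 0 < M →
      limsup (fun n : ℕ => ENNReal.ofReal (((n : ℝ) / Real.log n) ^ (2 * α / (1 + 2 * α))) *
        maxRisk P B (W.estimator lam x0 ((n : ℝ) ^ (-γ)) n) n x0 ((n : ℝ) ^ (-γ)) α M)
        atTop < ⊤) ∧
    -- where no estimator attains `n^{-2α/(1+2α)}` for two different smoothness indices
    (∀ α₁ α₂ M₁ M₂ : ℝ, (1 - γ) / (2 * γ) ≤ α₁ → α₁ < α₂ → 0 < M₁ → 0 < M₂ →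
      ∀ T : ℕ → (unitInterval → ℝ) → ℝ → ℝ, (∀ n, IsEstimator (T n)) →
        ¬ (limsup (fun n : ℕ => ENNReal.ofReal ((n : ℝ) ^ (2 * α₁ / (1 + 2 * α₁))) *
              maxRisk P B (T n) n x0 ((n : ℝ) ^ (-γ)) α₁ M₁) atTop < ⊤ ∧
           limsup (fun n : ℕ => ENNReal.ofReal ((n : ℝ) ^ (2 * α₂ / (1 + 2 * α₂))) *
              maxRisk P B (T n) n x0 ((n : ℝ) ^ (-γ)) α₂ M₂) atTop < ⊤)) := by
  exact ⟨fun _ _ hα hαγ hM => W.limsup_maxRisk_lt_top_of_lt hB hlam hlam_eq hx0 hγ hr hα hαγ hM,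
    fun _ _ hαγ hαr hM => W.limsup_maxRisk_lt_top_of_le hB hlam hlam_eq hx0 hγ hαγ hαr hM,
    fun _ _ _ _ h1 h12 hM₁ hM₂ _ hT H =>
      not_limsup_maxRisk_lt_top hB hx0 hγ h1 h12 hM₁ hM₂ hT H.1 H.2⟩
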